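/- Let \[f_0(x)=x^{13} - 6x^{12} - 4542x^{11} - 226075x^{10} + 8156061x^9 + 770464590x^8 + 11462215447x^7 - 970419905164x^6 - 33706100049495x^5 + 18705429494567x^4 + 29408002566579439x^3 + 237585722590314749x^2 - 2291157493210202812x - 11381632704121436976 \in \mathbb{Q}[x].\] Then $f_0$ is irreducible over $\mathbb{Q}$, and the Galois group over $\mathbb{Q}$ of its splitting field is isomorphic to $PSL_3(3)=PSL_3(\mathbb{F}_3)$. The number $p=83420911386433$ is prime, and it is the only prime number that ramifies in the splitting field of $f_0$ (in particular, $p$ does ramify there). Moreover, every root field $\mathbb{Q}(\theta)$, where $f_0(\theta)=0$, has discriminant equal to $p^4$. -/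

import Mathlib

open Polynomial NumberField IntermediateField

/-- The polynomial `f₀` over `ℚ`. -/
noncomputable def psl33Poly : ℚ[X] :=
  X ^ 13 - 6 * X ^ 12 - 4542 * X ^ 11 - 226075 * X ^ 10 + 8156061 * X ^ 9 + 770464590 * X ^ 8
    + 11462215447 * X ^ 7 - 970419905164 * X ^ 6 - 33706100049495 * X ^ 5
    + 18705429494567 * X ^ 4 + 29408002566579439 * X ^ 3 + 237585722590314749 * X ^ 2
    - 2291157493210202812 * X - 11381632704121436976

/-- The natural number `q` (used for primes) ramifies in the number field `L`: some prime ideal `P`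
of the ring of integers above `q` occurs in `q 𝓞 L` with exponent (ramification index) `> 1`. -/
def RamifiesIn (q : ℕ) (L : Type*) [Field L] : Prop :=
  ∃ P : Ideal (𝓞 L), P.IsPrime ∧ P.LiesOver (Ideal.span {(q : ℤ)}) ∧
    1 < Ideal.ramificationIdx' (Ideal.span {(q : ℤ)}) P

/-! Write f for `psl33Poly` and p for `psl33Prime`. The proof has a group-theoretic half and an
arithmetic half, both resting on explicit certificates checked by evaluation.

The translates of the difference set {0, 4, 10, 12} in ℤ/13 are the lines of the projective plane of
order 3. A collineation is determined by the image of a frame, and there are 5616 ordered frames;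
PSL₃(𝔽₃) acts faithfully by collineations and has at least 5616 elements. So it is the full
collineation group.

Modulo 5, Frobenius permutes the roots of f in a 13-cycle, which labels the roots in characteristic
zero by ℤ/13. Let g be the polynomial of degree 13 encoded by `lineRed`. Over ℤ[y]/(g), a multiple
of f acquires a quartic factor whose roots sum to y, so every root of g is a sum of distinct roots
of f. The conjugates t^(5^i) are linearly independent modulo 5, so reduction modulo 5 identifies the
summands, and they form a line. The Galois group permutes the roots of g, hence the lines
(`exists_roots_collineation`). Its image contains a Singer cycle, and it has even order because f
has an irreducible quadratic factor modulo 3. By a Sylow argument such a group is everything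
(`eq_collineationGroup`). The 13-cycle also gives irreducibility.

For the arithmetic, disc f = p^4 m^2 with m = `psl33Index`, and two explicit elements together with
1, θ, …, θ^10 are integral and have discriminant p^4. A nontrivial inertia element above q makes two
roots congruent, hence two rows of the matrix of conjugates of these elements, so q divides p^4.
Thus only p can ramify, and by Minkowski some prime does. In a root field the field discriminant
times a square equals p^4. Dedekind's criterion shows that ℤ[θ] is maximal at p
(`not_dvd_det_toMatrix`), so no power of p is lost and the square is 1. -/

/-! ### The projective plane of order 3 and its collineations. -/

/-- The planar difference set `{0, 4, 10, 12}` in `ℤ/13`. -/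
def planarSet : Finset (ZMod 13) := {0, 4, 10, 12}

lemma planarSet_translate_injective : ∀ j j' : ZMod 13,
    (∀ i, i - j ∈ planarSet ↔ i - j' ∈ planarSet) → j = j' := by
  unfold planarSet; decide +kernel

/-- Each nonzero residue modulo 13 is a difference of two elements of the planar set in exactly one
way, so two distinct points determine their line. -/
lemma line_unique : ∀ a b j j' : ZMod 13, a ≠ b → a - j ∈ planarSet → b - j ∈ planarSet →
    a - j' ∈ planarSet → b - j' ∈ planarSet → j = j' := by
  unfold planarSet; decide +kernel

/-- The permutations of `ℤ/13` which permute the translates of `planarSet`. -/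
def collineationGroup : Subgroup (Equiv.Perm (ZMod 13)) where
  carrier := {π | ∀ j, ∃ j', ∀ i, i - j ∈ planarSet ↔ π i - j' ∈ planarSet}
  one_mem' j := ⟨j, fun _ => Iff.rfl⟩
  mul_mem' {π ρ} hπ hρ j := by
    obtain ⟨k, hk⟩ := hρ j
    obtain ⟨l, hl⟩ := hπ k
    exact ⟨l, fun i => (hk i).trans (hl _)⟩
  inv_mem' {π} hπ := by
    choose φ hφ using hπ
    -- The induced map on lines is injective, hence surjective by finiteness; so every line is the
    -- image of a line, which is what the inverse needs.
    have hinj : Function.Injective φ := fun a b hab =>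
      planarSet_translate_injective a b fun i => by rw [hφ a i, hφ b i, hab]
    intro j
    obtain ⟨k, rfl⟩ := (Finite.injective_iff_surjective.mp hinj) j
    exact ⟨k, fun i => by simpa using (hφ k (π⁻¹ i)).symm⟩

/-- Collinearity of three points of the plane. -/
def planeCollinear (a b c : ZMod 13) : Prop :=
  ∃ j, a - j ∈ planarSet ∧ b - j ∈ planarSet ∧ c - j ∈ planarSet

lemma collineation_collinear {π : Equiv.Perm (ZMod 13)} (hπ : π ∈ collineationGroup)
    {a b c : ZMod 13} : planeCollinear (π a) (π b) (π c) ↔ planeCollinear a b c := by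
  have key : ∀ {π : Equiv.Perm (ZMod 13)}, π ∈ collineationGroup → ∀ {a b c},
      planeCollinear a b c → planeCollinear (π a) (π b) (π c) := by
    rintro π hπ a b c ⟨j, h1, h2, h3⟩
    obtain ⟨j', h⟩ := hπ j
    exact ⟨j', (h _).1 h1, (h _).1 h2, (h _).1 h3⟩
  refine ⟨fun h => ?_, key hπ⟩
  simpa using key (inv_mem hπ) h

/-- A collineation fixing two points of each of two lines fixes their intersection. -/
lemma collineation_fixes_meet {π : Equiv.Perm (ZMod 13)} (hπ : π ∈ collineationGroup)
    {a b c d : ZMod 13} (m j k : ZMod 13) (ha : π a = a) (hb : π b = b) (hc : π c = c)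
    (hd : π d = d)
    (hab : a ≠ b) (hcd : c ≠ d) (hjk : j ≠ k)
    (haj : a - j ∈ planarSet) (hbj : b - j ∈ planarSet) (hmj : m - j ∈ planarSet)
    (hck : c - k ∈ planarSet) (hdk : d - k ∈ planarSet) (hmk : m - k ∈ planarSet) :
    π m = m := by
  obtain ⟨j', hj'⟩ := hπ j
  obtain ⟨k', hk'⟩ := hπ k
  have e1 : j' = j := by
    have h1 := (hj' a).1 haj
    have h2 := (hj' b).1 hbj
    rw [ha] at h1
    rw [hb] at h2
    exact line_unique a b _ _ hab h1 h2 haj hbj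
  have e2 : k' = k := by
    have h1 := (hk' c).1 hck
    have h2 := (hk' d).1 hdk
    rw [hc] at h1
    rw [hd] at h2
    exact line_unique c d _ _ hcd h1 h2 hck hdk
  subst e1 e2
  by_contra hne
  exact hjk (line_unique _ _ _ _ hne ((hj' m).1 hmj) hmj ((hk' m).1 hmk) hmk)

/-- The points 0, 1, 2, 4 form a frame. Intersecting lines through points already known to be fixed
yields new fixed points, and this process exhausts the plane of order 3. -/
lemma collineation_eq_one {π : Equiv.Perm (ZMod 13)} (hπ : π ∈ collineationGroup)
    (h0 : π 0 = 0) (h1 : π 1 = 1) (h2 : π 2 = 2) (h4 : π 4 = 4) : π = 1 := by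
  have h5 : π 5 = 5 := collineation_fixes_meet hπ 5 1 5 h0 h1 h2 h4
    (by decide) (by decide) (by decide) (by decide) (by decide) (by decide) (by decide) (by decide)
    (by decide)
  have h3 : π 3 = 3 := collineation_fixes_meet hπ 3 3 4 h0 h2 h1 h4
    (by decide) (by decide) (by decide) (by decide) (by decide) (by decide) (by decide) (by decide)
    (by decide)
  have h12 : π 12 = 12 := collineation_fixes_meet hπ 12 0 2 h0 h4 h1 h2
    (by decide) (by decide) (by decide) (by decide) (by decide) (by decide) (by decide) (by decide)
    (by decide)
  have h11 : π 11 = 11 := collineation_fixes_meet hπ 11 1 12 h0 h1 h3 h12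
    (by decide) (by decide) (by decide) (by decide) (by decide) (by decide) (by decide) (by decide)
    (by decide)
  have h7 : π 7 = 7 := collineation_fixes_meet hπ 7 3 7 h0 h2 h4 h11
    (by decide) (by decide) (by decide) (by decide) (by decide) (by decide) (by decide) (by decide)
    (by decide)
  have h10 : π 10 = 10 := collineation_fixes_meet hπ 10 0 10 h0 h4 h1 h7
    (by decide) (by decide) (by decide) (by decide) (by decide) (by decide) (by decide) (by decide)
    (by decide)
  have h6 : π 6 = 6 := collineation_fixes_meet hπ 6 2 7 h1 h2 h4 h11
    (by decide) (by decide) (by decide) (by decide) (by decide) (by decide) (by decide) (by decide)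
    (by decide)
  have h8 : π 8 = 8 := collineation_fixes_meet hπ 8 9 4 h0 h6 h1 h4
    (by decide) (by decide) (by decide) (by decide) (by decide) (by decide) (by decide) (by decide)
    (by decide)
  have h9 : π 9 = 9 := collineation_fixes_meet hπ 9 9 10 h0 h6 h1 h7
    (by decide) (by decide) (by decide) (by decide) (by decide) (by decide) (by decide) (by decide)
    (by decide)
  refine Equiv.ext fun i => ?_
  rw [Equiv.Perm.one_apply]
  have key : ∀ i : ZMod 13, i = 0 ∨ i = 1 ∨ i = 2 ∨ i = 3 ∨ i = 4 ∨ i = 5 ∨ i = 6 ∨ i = 7 ∨ i = 8 ∨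
      i = 9 ∨ i = 10 ∨ i = 11 ∨ i = 12 := by decide
  rcases key i with h | h | h | h | h | h | h | h | h | h | h | h | h <;> subst h <;> assumption

/-! ### Counting frames: an upper bound for the collineation group. -/

/-- Collinearity, encoded in the bits of a single numeral for fast evaluation. -/
def collinearCode (a b c : ℕ) : Bool :=
  -- 5137 = 2^0 + 2^4 + 2^10 + 2^12 encodes the planar set. Since j runs over all residues, adding j
  -- instead of subtracting it covers the same translates.
  (List.range 13).any fun j =>
    Nat.testBit 5137 ((a + j) % 13) && Nat.testBit 5137 ((b + j) % 13) &&
      Nat.testBit 5137 ((c + j) % 13)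

lemma mem_planarSet_iff_testBit : ∀ a j : ZMod 13,
    a - j ∈ planarSet ↔ Nat.testBit 5137 ((a.val + (-j).val) % 13) = true := by
  unfold planarSet; decide +kernel

lemma collinearCode_iff (a b c : ZMod 13) :
    collinearCode a.val b.val c.val = true ↔ planeCollinear a b c := by
  unfold collinearCode planeCollinear
  simp only [mem_planarSet_iff_testBit, List.any_eq_true, List.mem_range, Bool.and_eq_true,
    and_assoc]
  constructor
  · rintro ⟨j, hj, h⟩
    refine ⟨-(j : ZMod 13), ?_⟩
    rw [neg_neg, ZMod.val_natCast, Nat.mod_eq_of_lt hj]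
    exact h
  · rintro ⟨j, h⟩
    exact ⟨(-j).val, ZMod.val_lt _, h⟩

/-- The ordered quadruples of points, no three of which are collinear. -/
def planeFrames : Set (ZMod 13 × ZMod 13 × ZMod 13 × ZMod 13) :=
  {q | ¬ planeCollinear q.1 q.2.1 q.2.2.1 ∧ ¬ planeCollinear q.1 q.2.1 q.2.2.2 ∧
    ¬ planeCollinear q.1 q.2.2.1 q.2.2.2 ∧ ¬ planeCollinear q.2.1 q.2.2.1 q.2.2.2}

/-- Counts the ordered frames. -/
def frameCount : ℕ :=
  ∑ a ∈ Finset.range 13, ∑ b ∈ Finset.range 13, ∑ c ∈ Finset.range 13, ∑ d ∈ Finset.range 13,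
    if collinearCode a b c then 0 else if collinearCode a b d then 0 else
      if collinearCode a c d then 0 else if collinearCode b c d then 0 else 1

-- The count is 13 · 12 · 9 · 4: any point, another point, a point off their line, a point off the
-- three sides of the triangle.
set_option maxRecDepth 10000 in
lemma frameCount_eq : frameCount = 5616 := by decide +kernel

lemma card_planeFrames : Nat.card planeFrames = 5616 := by
  classical
  have h1 : Nat.card planeFrames = (Finset.univ.filter
      (fun q : ZMod 13 × ZMod 13 × ZMod 13 × ZMod 13 => q ∈ planeFrames)).card := by
    rw [Nat.card_eq_fintype_card, Fintype.card_subtype]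
  have hs : ∀ F : ℕ → ℕ, ∑ a : ZMod 13, F a.val = ∑ a ∈ Finset.range 13, F a :=
    fun F => Fin.sum_univ_eq_sum_range F 13
  rw [h1, Finset.card_filter, ← frameCount_eq, frameCount, Fintype.sum_prod_type, ← hs]
  refine Finset.sum_congr rfl fun a _ => ?_
  rw [Fintype.sum_prod_type, ← hs]
  refine Finset.sum_congr rfl fun b _ => ?_
  rw [Fintype.sum_prod_type, ← hs]
  refine Finset.sum_congr rfl fun c _ => ?_
  rw [← hs]
  refine Finset.sum_congr rfl fun d _ => ?_
  simp only [planeFrames, Set.mem_ofPred_eq, ← collinearCode_iff]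
  split_ifs <;> simp_all

/-- Sending a collineation to its image of the frame (0, 1, 2, 4) is injective, by
`collineation_eq_one`. -/
lemma card_collineationGroup_le : Nat.card collineationGroup ≤ 5616 := by
  rw [← card_planeFrames]
  have hfr : ∀ a b c : ZMod 13, collinearCode a.val b.val c.val = false →
      ¬ planeCollinear a b c := fun a b c h h' => by
    rw [← collinearCode_iff, h] at h'
    exact absurd h' (by simp)
  refine Nat.card_le_card_of_injective
    (fun π : collineationGroup => (⟨(π.1 0, π.1 1, π.1 2, π.1 4), ?_⟩ : planeFrames)) ?_
  · refine ⟨?_, ?_, ?_, ?_⟩ <;> dsimp only <;> rw [collineation_collinear π.2] <;>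
      exact hfr _ _ _ (by decide)
  · rintro ⟨π, hπ⟩ ⟨ρ, hρ⟩ h
    replace h := congrArg Subtype.val h
    simp only [Prod.mk.injEq] at h
    rw [Subtype.mk.injEq]
    have := collineation_eq_one (mul_mem (inv_mem hρ) hπ)
      (by simp [h.1]) (by simp [h.2.1]) (by simp [h.2.2.1]) (by simp [h.2.2.2])
    rwa [inv_mul_eq_one, eq_comm] at this

/-! ### The action of PSL₃(𝔽₃) on the plane. -/

open scoped LinearAlgebra.Projectivization

lemma card_GL_three_zmod_three : Nat.card (GL (Fin 3) (ZMod 3)) = 11232 := by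
  rw [Matrix.card_GL_field]
  simp [Fin.prod_univ_three]

/-- The map g ↦ (det g · g, det g) embeds GL₃ into SL₃ × 𝔽₃ˣ: the determinant of det g · g is (det
g)^4 = 1. -/
lemma le_card_SL_three_zmod_three :
    5616 ≤ Nat.card (Matrix.SpecialLinearGroup (Fin 3) (ZMod 3)) := by
  have hu : ∀ u : (ZMod 3)ˣ, (u : ZMod 3) ^ 3 * u = 1 := by decide
  let φ : GL (Fin 3) (ZMod 3) → Matrix.SpecialLinearGroup (Fin 3) (ZMod 3) × (ZMod 3)ˣ :=
    fun g => (⟨(g.det : ZMod 3) • g.val, by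
      rw [Matrix.det_smul, Fintype.card_fin]; exact hu g.det⟩, g.det)
  have hφ : Function.Injective φ := by
    intro g h hgh
    have h1 : g.det = h.det := congrArg Prod.snd hgh
    have h2 : (g.det : ZMod 3) • g.val = (h.det : ZMod 3) • h.val :=
      congrArg (fun x => x.1.val) hgh
    rw [h1] at h2
    exact Units.ext (smul_right_injective _ (Units.ne_zero h.det) h2)
  have := Nat.card_le_card_of_injective φ hφ
  have h2 : Nat.card (ZMod 3)ˣ = 2 := by
    rw [Nat.card_eq_fintype_card]; decide
  rw [Nat.card_prod, card_GL_three_zmod_three, h2] at this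
  omega

lemma center_SL_three_zmod_three :
    Subgroup.center (Matrix.SpecialLinearGroup (Fin 3) (ZMod 3)) = ⊥ := by
  rw [eq_bot_iff]
  intro A hA
  obtain ⟨r, hr, hA⟩ := Matrix.SpecialLinearGroup.mem_center_iff.1 hA
  have : ∀ r : ZMod 3, r ^ 3 = 1 → r = 1 := by decide
  rw [Fintype.card_fin] at hr
  rw [this r hr, map_one] at hA
  exact Subgroup.mem_bot.2 (Subtype.ext hA.symm)

lemma le_card_PSL_three_zmod_three :
    5616 ≤ Nat.card (Matrix.ProjectiveSpecialLinearGroup (Fin 3) (ZMod 3)) := by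
  have h := Subgroup.card_eq_card_quotient_mul_card_subgroup
    (Subgroup.center (Matrix.SpecialLinearGroup (Fin 3) (ZMod 3)))
  rw [center_SL_three_zmod_three, Subgroup.card_bot, mul_one,
    ← center_SL_three_zmod_three] at h
  exact h ▸ le_card_SL_three_zmod_three

/-- Homogeneous coordinates of the points of the plane, labelled by a Singer cycle. -/
def singerPoint (i : ZMod 13) : Fin 3 → ZMod 3 :=
  ![![1, 0, 0], ![0, 1, 0], ![0, 0, 1], ![1, 0, 2], ![2, 1, 1], ![1, 2, 0], ![0, 1, 2], ![2, 0, 2],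
    ![2, 2, 1], ![1, 2, 1], ![1, 1, 1], ![1, 1, 0], ![0, 1, 1]] i

/-- Homogeneous coordinates of the lines of the plane, labelled by a Singer cycle. -/
def singerLine (j : ZMod 13) : Fin 3 → ZMod 3 :=
  ![![0, 1, 2], ![0, 0, 1], ![1, 0, 0], ![0, 1, 0], ![1, 0, 1], ![1, 1, 0], ![1, 1, 1], ![1, 2, 2],
    ![1, 1, 2], ![0, 1, 1], ![1, 0, 2], ![1, 2, 0], ![1, 2, 1]] j

lemma singerPoint_ne_zero : ∀ i, singerPoint i ≠ 0 := by decide +kernel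

lemma exists_singerPoint : ∀ u : Fin 3 → ZMod 3, u ≠ 0 →
    ∃ i, ∃ a : ZMod 3, a • singerPoint i = u := by decide +kernel

lemma exists_singerLine : ∀ u : Fin 3 → ZMod 3, u ≠ 0 →
    ∃ i, ∃ a : ZMod 3, a ≠ 0 ∧ a • singerLine i = u := by decide +kernel

lemma singerPoint_injective : ∀ i j, ∀ a : ZMod 3, a • singerPoint i = singerPoint j → i = j := by
  decide +kernel

/-- This ties coordinates to the difference set: linear incidence becomes membership in a translate,
so linear maps induce collineations of the labels. -/
lemma singer_incidence : ∀ i j, singerLine j ⬝ᵥ singerPoint i = 0 ↔ i - j ∈ planarSet := by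
  unfold planarSet; decide +kernel

/-- The labelling of the points of the projective plane over `𝔽₃` by `ℤ/13`. -/
noncomputable def singerEquiv : ZMod 13 ≃ ℙ (ZMod 3) (Fin 3 → ZMod 3) :=
  Equiv.ofBijective (fun i => Projectivization.mk _ (singerPoint i) (singerPoint_ne_zero i)) <| by
    constructor
    · intro i j h
      obtain ⟨a, ha⟩ := (Projectivization.mk_eq_mk_iff' _ _ _ _ _).1 h
      exact (singerPoint_injective j i a ha).symm
    · intro x
      induction x using Projectivization.ind with
      | _ v hv =>
        obtain ⟨i, a, h⟩ := exists_singerPoint v hv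
        refine ⟨i, ?_⟩
        have ha : a ≠ 0 := by rintro rfl; exact hv (by rw [← h, zero_smul])
        refine (Projectivization.mk_eq_mk_iff' _ _ _ _ _).2 ⟨a⁻¹, ?_⟩
        rw [← h, smul_smul, inv_mul_cancel₀ ha, one_smul]

/-- `PSL₃(𝔽₃)` as a group of permutations of the labels of the points of the plane. -/
noncomputable def pslToPerm :
    Matrix.ProjectiveSpecialLinearGroup (Fin 3) (ZMod 3) →* Equiv.Perm (ZMod 13) :=
  (Equiv.permCongrHom singerEquiv.symm).toMonoidHom.comp
    Projectivization.PSLAction.toPermHom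

lemma pslToPerm_injective : Function.Injective pslToPerm :=
  (Equiv.permCongrHom singerEquiv.symm).injective.comp
    Matrix.ProjectiveSpecialLinearGroup.toPermHom_injective

-- A matrix M moves the line with covector ℓ to the line with covector ℓM⁻¹. The nonzero scalars
-- lost in choosing representatives do not affect the vanishing of the pairing.
open Matrix in
lemma pslToPerm_mem (g : Matrix.ProjectiveSpecialLinearGroup (Fin 3) (ZMod 3)) :
    pslToPerm g ∈ collineationGroup := by
  obtain ⟨M, rfl⟩ := QuotientGroup.mk_surjective g
  set π := pslToPerm (M : Matrix.ProjectiveSpecialLinearGroup (Fin 3) (ZMod 3)) with hπ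
  have key : ∀ i, ∃ a : ZMod 3, a ≠ 0 ∧ a • singerPoint (π i) = M.1 *ᵥ singerPoint i := by
    intro i
    have h1 : singerEquiv (π i) = M • singerEquiv i := by
      rw [hπ]
      change singerEquiv (singerEquiv.symm _) = _
      rw [Equiv.apply_symm_apply]
      rfl
    obtain ⟨a, ha⟩ := (Projectivization.mk_eq_mk_iff _ _ _ _ _).1 h1.symm
    exact ⟨a, a.ne_zero, ha⟩
  intro j
  have hne : singerLine j ᵥ* (M⁻¹).1 ≠ 0 := by
    intro h0
    have h1 : singerLine j ᵥ* (M⁻¹).1 ᵥ* M.1 = singerLine j := by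
      rw [Matrix.vecMul_vecMul, ← Matrix.SpecialLinearGroup.coe_mul, inv_mul_cancel,
        Matrix.SpecialLinearGroup.coe_one, Matrix.vecMul_one]
    have h2 : ∀ j, (0 : Fin 3 → ZMod 3) ≠ singerLine j := by decide +kernel
    rw [h0, Matrix.zero_vecMul] at h1
    exact h2 j h1
  obtain ⟨j', b, hb, hj'⟩ := exists_singerLine _ hne
  refine ⟨j', fun i => ?_⟩
  obtain ⟨a, ha, hi⟩ := key i
  rw [← singer_incidence, ← singer_incidence]
  have h2 : singerLine j ⬝ᵥ singerPoint i = b * a * (singerLine j' ⬝ᵥ singerPoint (π i)) := by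
    calc singerLine j ⬝ᵥ singerPoint i
        = (singerLine j ᵥ* (M⁻¹).1) ⬝ᵥ (M.1 *ᵥ singerPoint i) := by
          rw [← Matrix.dotProduct_mulVec, Matrix.mulVec_mulVec,
            ← Matrix.SpecialLinearGroup.coe_mul, inv_mul_cancel,
            Matrix.SpecialLinearGroup.coe_one, Matrix.one_mulVec]
      _ = _ := by
          rw [← hj', ← hi, smul_dotProduct, dotProduct_smul, smul_eq_mul, smul_eq_mul, mul_assoc]
  rw [h2, mul_eq_zero, mul_eq_zero]
  simp [ha, hb]

/-- The chain 5616 ≤ |PSL₃(𝔽₃)| ≤ |collineations| ≤ 5616 forces equality throughout. -/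
lemma card_PSL_and_collineationGroup :
    Nat.card (Matrix.ProjectiveSpecialLinearGroup (Fin 3) (ZMod 3)) = Nat.card collineationGroup ∧
      Nat.card collineationGroup = 5616 := by
  have h := Nat.card_le_card_of_injective (pslToPerm.codRestrict collineationGroup pslToPerm_mem)
    fun a b hab => pslToPerm_injective (congrArg Subtype.val hab)
  have := le_card_PSL_three_zmod_three
  have := card_collineationGroup_le
  omega

/-- The collineation group of the plane is `PSL₃(𝔽₃)`. -/
lemma nonempty_collineationGroup_mulEquiv :
    Nonempty (collineationGroup ≃* Matrix.ProjectiveSpecialLinearGroup (Fin 3) (ZMod 3)) := by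
  have hb := (Nat.bijective_iff_injective_and_card
    (pslToPerm.codRestrict collineationGroup pslToPerm_mem)).2
      ⟨fun a b hab => pslToPerm_injective (congrArg Subtype.val hab),
        card_PSL_and_collineationGroup.1⟩
  exact ⟨(MulEquiv.ofBijective _ hb).symm⟩

/-! ### Groups of collineations containing a Singer cycle. -/

/-- A collineation of order three. -/
def collineationX : Equiv.Perm (ZMod 13) where
  toFun i := (![0, 2, 6, 9, 4, 7, 1, 8, 5, 11, 10, 3, 12] : Fin 13 → ZMod 13) i
  invFun i := (![0, 6, 1, 11, 4, 8, 2, 5, 7, 3, 10, 9, 12] : Fin 13 → ZMod 13) i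
  left_inv := by unfold Function.LeftInverse; decide +kernel
  right_inv := by unfold Function.RightInverse Function.LeftInverse; decide +kernel

/-- A collineation of order three. -/
def collineationY : Equiv.Perm (ZMod 13) where
  toFun i := (![2, 10, 12, 1, 7, 8, 4, 6, 9, 5, 3, 11, 0] : Fin 13 → ZMod 13) i
  invFun i := (![12, 3, 0, 10, 6, 9, 7, 4, 5, 8, 1, 11, 2] : Fin 13 → ZMod 13) i
  left_inv := by unfold Function.LeftInverse; decide +kernel
  right_inv := by unfold Function.RightInverse Function.LeftInverse; decide +kernel

/-- Multiplication by `3`, a multiplier of the planar difference set. -/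
def multiplierThree : Equiv.Perm (ZMod 13) where
  toFun i := 3 * i
  invFun i := 9 * i
  left_inv := by unfold Function.LeftInverse; decide +kernel
  right_inv := by unfold Function.RightInverse Function.LeftInverse; decide +kernel

lemma collineationX_mem : collineationX ∈ collineationGroup := by
  change ∀ j, ∃ j', ∀ i, i - j ∈ planarSet ↔ collineationX i - j' ∈ planarSet
  unfold planarSet; decide +kernel

lemma collineationY_mem : collineationY ∈ collineationGroup := by
  change ∀ j, ∃ j', ∀ i, i - j ∈ planarSet ↔ collineationY i - j' ∈ planarSet
  unfold planarSet; decide +kernel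

lemma collineationX_pow : collineationX ^ 3 = 1 := by
  refine Equiv.ext ?_; decide +kernel

lemma collineationY_pow : collineationY ^ 3 = 1 := by
  refine Equiv.ext ?_; decide +kernel

/-- The multiplier 3 is a commutator of two elements of order three; `mem_of_index_three` then puts
it in every subgroup of index 3. -/
lemma commutator_collineations :
    collineationX * collineationY = multiplierThree * (collineationY * collineationX) := by
  refine Equiv.ext ?_; decide +kernel

/-- In a group of order six all elements of order dividing three commute: a subgroup of index
three contains every commutator of two such elements. -/
lemma mem_of_index_three {G : Type*} [Group G] [Finite G] (H : Subgroup G) (hH : H.index = 3)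
    {x y z : G} (hx : x ^ 3 = 1) (hy : y ^ 3 = 1) (hz : x * y = z * (y * x)) : z ∈ H := by
  have hc : Nat.card (G ⧸ H) = 3 := hH
  let e : (G ⧸ H) ≃ Fin 3 := Finite.equivFinOfCardEq hc
  let φ : G →* Equiv.Perm (Fin 3) :=
    (Equiv.permCongrHom e).toMonoidHom.comp (MulAction.toPermHom G (G ⧸ H))
  -- In S₃ the elements of cube 1 form the abelian group A₃. Hence z acts trivially on the three
  -- cosets and in particular fixes H itself.
  have hcomm : ∀ a b : Equiv.Perm (Fin 3), a ^ 3 = 1 → b ^ 3 = 1 → a * b = b * a := by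
    decide +kernel
  have h1 := hcomm (φ x) (φ y) (by rw [← map_pow, hx, map_one]) (by rw [← map_pow, hy, map_one])
  rw [← map_mul, ← map_mul, hz, map_mul, mul_eq_right] at h1
  have h2 : MulAction.toPermHom G (G ⧸ H) z = 1 :=
    (Equiv.permCongrHom e).injective (h1.trans (map_one _).symm)
  have h3 : z • ((1 : G) : G ⧸ H) = ((1 : G) : G ⧸ H) := by
    have := DFunLike.congr_fun h2 ((1 : G) : G ⧸ H)
    simpa using this
  rw [MulAction.Quotient.smul_mk, smul_eq_mul, mul_one, QuotientGroup.eq, mul_one] at h3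
  exact inv_mem_iff.1 h3

lemma addRight_pow (c : ZMod 13) (n : ℕ) :
    (Equiv.addRight c : Equiv.Perm (ZMod 13)) ^ n = Equiv.addRight (n * c) := by
  induction n with
  | zero => refine Equiv.ext fun i => ?_; simp
  | succ n ih =>
    rw [pow_succ, ih]
    refine Equiv.ext fun i => ?_
    simp only [Equiv.Perm.mul_apply, Equiv.coe_addRight]
    push_cast
    ring

lemma orderOf_addRight_one : orderOf (Equiv.addRight (1 : ZMod 13)) = 13 := by
  have : Fact (Nat.Prime 13) := ⟨by norm_num⟩
  refine orderOf_eq_prime ?_ ?_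
  · rw [addRight_pow]
    rw [ZMod.natCast_self, zero_mul]
    exact Equiv.ext fun i => add_zero i
  · intro h
    have := DFunLike.congr_fun h 0
    simp at this

lemma multiplierThree_pow : multiplierThree ^ 3 = 1 := by
  refine Equiv.ext ?_; decide +kernel

lemma multiplierThree_ne_one : multiplierThree ≠ 1 := fun h => by
  have := DFunLike.congr_fun h 1
  revert this; decide

lemma multiplierThree_mul_addRight :
    multiplierThree * Equiv.addRight 1 = Equiv.addRight 1 ^ 3 * multiplierThree := by
  refine Equiv.ext ?_; decide +kernel

/-- The multiplier group {1, 3, 9} has odd order, so an affine map with such a slope has square 1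
only if it is the identity. The two equations are that condition evaluated at 0 and 1. -/
lemma affine_involution : ∀ k c : ZMod 13, (k = 1 ∨ k = 3 ∨ k = 9) → k * c + c = 0 →
    k * (k * 1 + c) + c = 1 → k = 1 ∧ c = 0 := by decide +kernel

/-- A collineation normalizing the Singer cycle is affine, with slope a multiplier. -/
lemma collineation_affine {π : Equiv.Perm (ZMod 13)} (hπ : π ∈ collineationGroup)
    (h : π * Equiv.addRight 1 * π⁻¹ ∈ Subgroup.zpowers (Equiv.addRight (1 : ZMod 13))) :
    ∃ k : ZMod 13, (k = 1 ∨ k = 3 ∨ k = 9) ∧ ∀ i, π i = k * i + π 0 := by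
  obtain ⟨n, hn⟩ := (mem_powers_iff_mem_zpowers.2 h)
  simp only [addRight_pow, mul_one] at hn
  have h1 : ∀ i, π (i + 1) = π i + n := fun i => by
    have := DFunLike.congr_fun hn (π i)
    simpa using this.symm
  have h2 : ∀ m : ℕ, π (m : ZMod 13) = n * m + π 0 := fun m => by
    induction m with
    | zero => simp
    | succ m ih => push_cast; rw [h1, ih]; ring
  have h3 : ∀ i, π i = n * i + π 0 := fun i => by
    have := h2 i.val
    rwa [ZMod.natCast_zmod_val] at this
  refine ⟨n, ?_, h3⟩
  -- An affine map carrying the planar set to one of its translates must have a multiplier as slope.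
  have key : ∀ k c : ZMod 13, (∃ j', ∀ i, i - 0 ∈ planarSet ↔ k * i + c - j' ∈ planarSet) →
      k = 1 ∨ k = 3 ∨ k = 9 := by
    unfold planarSet; decide +kernel
  obtain ⟨j', hj'⟩ := hπ 0
  exact key n (π 0) ⟨j', fun i => by rw [hj' i, h3 i]⟩

/-- A group of collineations of even order containing the Singer cycle is the full group. -/
theorem eq_collineationGroup {Γ : Subgroup (Equiv.Perm (ZMod 13))} (hΓ : Γ ≤ collineationGroup)
    (hσ : Equiv.addRight 1 ∈ Γ) (h2 : 2 ∣ Nat.card Γ) : Γ = collineationGroup := by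
  have hp : Fact (Nat.Prime 13) := ⟨by norm_num⟩
  have hA := card_PSL_and_collineationGroup.2
  have hdvd : Nat.card Γ ∣ 5616 := hA ▸ Subgroup.card_dvd_of_le hΓ
  let s : Γ := ⟨Equiv.addRight 1, hσ⟩
  have hs : orderOf s = 13 := by
    rw [← Subgroup.orderOf_coe]
    exact orderOf_addRight_one
  have hcz : Nat.card (Subgroup.zpowers s) = 13 := by rw [Nat.card_zpowers, hs]
  have h13 : 13 ∣ Nat.card Γ := hs.symm.dvd.trans (orderOf_dvd_natCard s)
  -- Since 13² does not divide 5616, the Singer cycle generates a Sylow 13-subgroup.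
  have hfac : (Nat.card Γ).factorization 13 = 1 := by
    have hpos : Nat.card Γ ≠ 0 := Nat.card_pos.ne'
    refine le_antisymm ?_ ?_
    · by_contra hlt
      have : 13 ^ 2 ∣ Nat.card Γ := (hp.out.pow_dvd_iff_le_factorization hpos).2 (by omega)
      exact absurd (this.trans hdvd) (by norm_num)
    · exact (hp.out.dvd_iff_one_le_factorization hpos).1 h13
  let P : Sylow 13 Γ := Sylow.ofCard (Subgroup.zpowers s) (by rw [hcz, hfac, pow_one])
  have hP : (P : Subgroup Γ) = Subgroup.zpowers s := rfl
  set N := Subgroup.normalizer (P : Set Γ) with hN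
  have hn1 : Nat.card (Sylow 13 Γ) % 13 = 1 := card_sylow_modEq_one 13 Γ
  rw [P.card_eq_index_normalizer, ← hN] at hn1
  have hmul := N.card_mul_index
  have haff : ∀ π ∈ N, ∃ k : ZMod 13, (k = 1 ∨ k = 3 ∨ k = 9) ∧
      ∀ i, π.1 i = k * i + π.1 0 := by
    intro π hπ
    refine collineation_affine (hΓ π.2) ?_
    have h := (Subgroup.mem_normalizer_iff.1 hπ s).1 (hP ▸ Subgroup.mem_zpowers s)
    rw [hP] at h
    obtain ⟨n, hn⟩ := h
    exact ⟨n, congrArg Subtype.val hn⟩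
  -- An element of the normalizer is i ↦ ki + c with 3 choices of k and 13 of c.
  have hN39 : Nat.card N ≤ 39 := by
    let T : Finset (ZMod 13 × ZMod 13) := ({1, 3, 9} : Finset (ZMod 13)) ×ˢ Finset.univ
    have hT : Nat.card T = 39 := by
      rw [Nat.card_eq_fintype_card, Fintype.card_coe]; rfl
    rw [← hT]
    refine Nat.card_le_card_of_injective
      (fun π : N => (⟨(π.1.1 1 - π.1.1 0, π.1.1 0), ?_⟩ : T)) ?_
    · obtain ⟨k, hk, h⟩ := haff π.1 π.2
      simp only [T, Finset.mem_product, Finset.mem_univ, and_true, h 1, mul_one,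
        add_sub_cancel_right]
      simpa using hk
    · intro π ρ h
      have h := congrArg Subtype.val h
      simp only [Prod.mk.injEq] at h
      obtain ⟨k, -, hk⟩ := haff π.1 π.2
      obtain ⟨l, -, hl⟩ := haff ρ.1 ρ.2
      rw [hk 1, hl 1, mul_one, mul_one, add_sub_cancel_right, add_sub_cancel_right] at h
      refine Subtype.ext (Subtype.ext (Equiv.ext fun i => ?_))
      rw [hk, hl, h.1, h.2]
  have hNodd : ¬ 2 ∣ Nat.card N := by
    intro h
    obtain ⟨π, hπ⟩ := exists_prime_orderOf_dvd_card' 2 h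
    obtain ⟨k, hk, hi⟩ := haff π.1 π.2
    have h1 : π ^ 2 = 1 := hπ ▸ pow_orderOf_eq_one π
    have h2 : ∀ i, π.1.1 (π.1.1 i) = i := fun i => by
      have := DFunLike.congr_fun (congrArg (fun x : N => x.1.1) h1) i
      simpa [pow_two] using this
    have e0 := h2 0
    have e1 := h2 1
    rw [hi (π.1.1 0)] at e0
    rw [hi (π.1.1 1), hi 1] at e1
    obtain ⟨rfl, hc⟩ := affine_involution k _ hk e0 e1
    have : π = 1 := by
      refine Subtype.ext (Subtype.ext (Equiv.ext fun i => ?_))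
      rw [hi, hc]
      simp
    rw [this, orderOf_one] at hπ
    omega
  have hN13 : 13 ∣ Nat.card N := by
    exact hcz.symm.dvd.trans (Subgroup.card_dvd_of_le (hP ▸ Subgroup.le_normalizer))
  have hdiv : Nat.card N * N.index ∣ 5616 := hmul.symm ▸ hdvd
  have h2' : 2 ∣ Nat.card N * N.index := hmul.symm ▸ h2
  -- The index is the number of Sylow 13-subgroups. It is 1 modulo 13 and divides 432 = 5616/13, so
  -- it is 1, 27 or 144; it is even because the normalizer has odd order.
  have hidx : N.index = 144 := by
    have key : ∀ n < 433, n ∣ 432 → n % 13 = 1 → n % 2 = 0 → n = 144 := by decide +kernel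
    have h432 : N.index ∣ 432 := by
      obtain ⟨c, hc⟩ := hN13
      rw [hc, mul_assoc] at hdiv
      exact (Dvd.intro_left _ rfl).trans
        (Nat.dvd_of_mul_dvd_mul_left (by norm_num) (hdiv.trans (by norm_num : 5616 ∣ 13 * 432)))
    have h2'' : 2 ∣ N.index := (Nat.prime_two.dvd_mul.1 h2').resolve_left hNodd
    exact key _ (Nat.lt_succ_of_le (Nat.le_of_dvd (by norm_num) h432)) h432 hn1
      (Nat.mod_eq_zero_of_dvd h2'')
  have hcases : Nat.card N = 13 ∨ Nat.card N = 39 := by omega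
  refine Subgroup.eq_of_le_of_card_ge hΓ ?_
  rw [hA, ← hmul, hidx]
  rcases hcases with h | h
  swap
  · rw [h]
  -- It remains to exclude a normalizer of order 13. In that case Γ has index 3, hence contains the
  -- multiplier 3, an element of order 3 normalizing the Singer cycle.
  exfalso
  rw [hidx, h] at hmul
  have hind : (Γ.subgroupOf collineationGroup).index = 3 := by
    have := (Γ.subgroupOf collineationGroup).card_mul_index
    rw [Nat.card_congr (Subgroup.subgroupOfEquivOfLe hΓ).toEquiv, hA, ← hmul] at this
    omega
  have hcomm : multiplierThree ∈ collineationGroup := by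
    have : multiplierThree = collineationX * collineationY * (collineationY * collineationX)⁻¹ := by
      rw [commutator_collineations, mul_inv_cancel_right]
    rw [this]
    exact mul_mem (mul_mem collineationX_mem collineationY_mem)
      (inv_mem (mul_mem collineationY_mem collineationX_mem))
  have hmem : (⟨multiplierThree, hcomm⟩ : collineationGroup) ∈ Γ.subgroupOf collineationGroup :=
    mem_of_index_three _ hind (x := ⟨collineationX, collineationX_mem⟩)
      (y := ⟨collineationY, collineationY_mem⟩) (Subtype.ext collineationX_pow)
      (Subtype.ext collineationY_pow) (Subtype.ext commutator_collineations)
  have hmΓ : multiplierThree ∈ Γ := hmem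
  let t : Γ := ⟨multiplierThree, hmΓ⟩
  have ht3 : t ^ 3 = 1 := Subtype.ext multiplierThree_pow
  have ht1 : t ≠ 1 := fun h => multiplierThree_ne_one (congrArg Subtype.val h)
  have hts : t * s * t⁻¹ = s ^ 3 := by
    rw [mul_inv_eq_iff_eq_mul]
    exact Subtype.ext multiplierThree_mul_addRight
  have htN : t ∈ N := by
    refine Subgroup.mem_normalizer_fintype ?_
    rintro _ ⟨n, rfl⟩
    refine ⟨3 * n, ?_⟩
    change s ^ (3 * n) = t * s ^ n * t⁻¹
    rw [← conj_zpow, hts, zpow_mul]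
    rfl
  have : orderOf (⟨t, htN⟩ : N) = 3 := by
    have : Fact (Nat.Prime 3) := ⟨by norm_num⟩
    exact orderOf_eq_prime (Subtype.ext ht3) fun h => ht1 (congrArg Subtype.val h)
  have hd := this.symm.dvd.trans (orderOf_dvd_natCard (⟨t, htN⟩ : N))
  rw [h] at hd
  omega

/-! ### Arithmetic with coefficient lists. -/

/-- The value at `x` of the polynomial with the given integer coefficients, leading one first. -/
def polyVal {R : Type*} [CommRing R] (x : R) : List ℤ → R
  | [] => 0
  | a :: l => a * x ^ l.length + polyVal x l

/-- Coefficients of `X * t + c * r + a * b`, reduced modulo `q`. -/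
def stepMod (q c a : ℤ) : List ℤ → List ℤ → List ℤ → List ℤ
  | [], _, _ => []
  | r :: rs, t, b => ((t.headD 0 + c * r + a * b.headD 0) % q) :: stepMod q c a rs t.tail b.tail

/-- Coefficients, modulo `q`, of the product of two polynomials modulo `X ^ n - r`. -/
def mulMod (q : ℤ) (r a b : List ℤ) : List ℤ :=
  a.foldl (fun acc x => stepMod q (acc.headD 0) x r acc.tail b) (r.map fun _ => 0)

lemma length_stepMod (q c a : ℤ) (r t b : List ℤ) : (stepMod q c a r t b).length = r.length := by
  induction r generalizing t b with
  | nil => rfl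
  | cons x r ih => simp [stepMod, ih]

lemma length_mulMod (q : ℤ) (r a b : List ℤ) : (mulMod q r a b).length = r.length := by
  have : ∀ acc : List ℤ, acc.length = r.length →
      (a.foldl (fun acc x => stepMod q (acc.headD 0) x r acc.tail b) acc).length = r.length := by
    induction a with
    | nil => exact fun acc h => h
    | cons x a ih => exact fun acc _ => ih _ (length_stepMod ..)
  exact this _ (by simp)

section PolyVal

variable {R S : Type*} [CommRing R] [CommRing S]

lemma map_polyVal (φ : R →+* S) (x : R) (l : List ℤ) : φ (polyVal x l) = polyVal (φ x) l := by
  induction l with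
  | nil => simp [polyVal]
  | cons a l ih => simp [polyVal, ih]

lemma intCast_emod_eq {q : ℤ} (hq : (q : R) = 0) (z : ℤ) : ((z % q : ℤ) : R) = z := by
  have := Int.emod_add_mul_ediv z q
  conv_rhs => rw [← this]
  push_cast
  rw [hq, zero_mul, add_zero]

lemma polyVal_map_zero {α : Type*} (x : R) (l : List α) : polyVal x (l.map fun _ => 0) = 0 := by
  induction l with
  | nil => rfl
  | cons a l ih => simpa [polyVal] using ih

lemma polyVal_stepMod {q : ℤ} (hq : (q : R) = 0) (x : R) (c a : ℤ) (r t b : List ℤ)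
    (ht : t.length + 1 = r.length) (hb : b.length = r.length) :
    polyVal x (stepMod q c a r t b) = x * polyVal x t + c * polyVal x r + a * polyVal x b := by
  induction r generalizing t b with
  | nil => simp at ht
  | cons r₀ r ih =>
    obtain _ | ⟨b₀, b⟩ := b
    · simp at hb
    simp only [List.length_cons, add_left_inj] at hb ht
    obtain _ | ⟨t₀, t⟩ := t
    · obtain rfl : r = [] := List.length_eq_zero_iff.1 ht.symm
      obtain rfl : b = [] := List.length_eq_zero_iff.1 hb
      simp only [stepMod, polyVal, intCast_emod_eq hq, List.headD_nil, List.headD_cons]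
      push_cast
      ring
    · simp only [stepMod, polyVal, intCast_emod_eq hq, List.headD_cons, List.tail_cons,
        length_stepMod, ih t b ht hb]
      rw [List.length_cons] at ht
      rw [hb, ← ht]
      push_cast
      ring

/-- `mulMod` computes products of values at the roots of `X ^ n - r`. -/
lemma polyVal_mulMod {q : ℤ} (hq : (q : R) = 0) {x : R} {r : List ℤ} (hr : r ≠ [])
    (hx : x ^ r.length = polyVal x r) (a b : List ℤ) (hb : b.length = r.length) :
    polyVal x (mulMod q r a b) = polyVal x a * polyVal x b := by
  -- Loop invariant of Horner's scheme. Multiplying the accumulator by x produces one term in x^n,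
  -- which is replaced by r.
  have : ∀ acc : List ℤ, acc.length = r.length →
      polyVal x (a.foldl (fun acc x => stepMod q (acc.headD 0) x r acc.tail b) acc) =
        polyVal x acc * x ^ a.length + polyVal x a * polyVal x b := by
    induction a with
    | nil => intro acc _; simp [polyVal]
    | cons a₀ a ih =>
      intro acc hacc
      rw [List.foldl_cons, ih _ (length_stepMod ..)]
      obtain _ | ⟨c, t⟩ := acc
      · exact absurd (List.length_eq_zero_iff.1 hacc.symm) hr
      rw [polyVal_stepMod hq x _ _ r _ b (by simpa using hacc) hb]
      simp only [List.headD_cons, List.tail_cons, polyVal, List.length_cons, ← hx]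
      rw [← hacc, List.length_cons]
      ring
  rw [mulMod, this _ (by simp), polyVal_map_zero, zero_mul, zero_add]

lemma polyVal_eq_sum (x : R) (l : List ℤ) :
    polyVal x l = ∑ i : Fin l.length, (l.getD i 0 : ℤ) * x ^ (l.length - 1 - i) := by
  induction l with
  | nil => rfl
  | cons a l ih =>
    simp only [List.length_cons]
    rw [Fin.sum_univ_succ, polyVal, ih]
    simp only [Fin.val_zero, List.getD_cons_zero, add_tsub_cancel_right, tsub_zero, Fin.val_succ,
      List.getD_cons_succ]
    congr 1
    refine Finset.sum_congr rfl fun i _ => ?_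
    congr 2
    omega

lemma polyVal_eq_sum_of_length (x : R) (l : List ℤ) {n : ℕ} (hl : l.length = n + 1) :
    polyVal x l = ∑ i : Fin (n + 1), (l.getD i 0 : ℤ) * x ^ (n - i) := by
  rw [polyVal_eq_sum]
  have : ∀ m, m = n + 1 → ∑ i : Fin m, ((l.getD i 0 : ℤ) : R) * x ^ (m - 1 - i) =
      ∑ i : Fin (n + 1), ((l.getD i 0 : ℤ) : R) * x ^ (n - i) := by
    rintro _ rfl
    rfl
  exact this _ hl

end PolyVal

/-! ### The discriminant of the polynomial. -/

/-- The lower coefficients of `X ^ 13 - psl33Poly`. -/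
def psl33Red : List ℤ :=
  [6, 4542, 226075, -8156061, -770464590, -11462215447, 970419905164, 33706100049495,
    -18705429494567, -29408002566579439, -237585722590314749, 2291157493210202812,
    11381632704121436976]

lemma aeval_psl33Poly {R : Type*} [CommRing R] [Algebra ℚ R] (x : R) :
    aeval x psl33Poly = x ^ 13 - polyVal x psl33Red := by
  simp only [psl33Poly, psl33Red, polyVal, map_add, map_sub, map_mul, map_pow, aeval_X, map_ofNat,
    List.length_cons, List.length_nil]
  push_cast
  ring

lemma psl33Red_ne_nil : psl33Red ≠ [] := by simp [psl33Red]

lemma length_psl33Red : psl33Red.length = 13 := rfl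

/-- Coefficients of the derivative of `psl33Poly`. -/
def psl33Deriv : List ℤ :=
  [13, -72, -49962, -2260750, 73404549, 6163716720, 80235508129, -5822519430984, -168530500247475,
  74821717978268, 88224007699738317, 475171445180629498, -2291157493210202812]

/-- The coefficients of `X ^ (12 - j) * f'` modulo `f = psl33Poly`, for `j = 0, …, 12`. -/
def psl33DerivRows : List (List ℤ) :=
  [[5670607571682923970921, 312455678133695624073059, -4760076507768648879200421,
  -1533789323720867832076565934, -51992861241303573084814513634, 858623300406795869962906159656,
  117673653965901258447726113158374, 2187013042702247014208719624375300,
  -44510476788008034674609303743899820, -2837353222522442318311156205382526913,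
  -17655185348571741268626965922961268041, 216264068708697461309382004389843108236,
  1000937137032105466467735096349011971568], [87943194359949177893, 5142948405523228903563,
  -86982310649193541916947, -24641834172694159271360396, -816519265986266380281406461,
  15764255944524982681352795236, 1866647141257928614943001672827,
  32331827635300157556941287818922, -777209065066384375616212235438735,
  -42865461566381003078906437583892489, -251119537071862450607487140255384886,
  3238862030337276749239492423701375816, 14772359974058656529921244770646273120],
  [1297912202764142370, 80155721143364323673, -752168819431505740977, -380407811889097028214697,
  -14055983074305445488955826, 183476127172405437522271839, 30641205243897931452473984626,
  607127304540351237587807474147, -11415730926528466056326938784228,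
  -752931059867441562383831905934945, -4696456176298331020299664273162059,
  57245871480643426278505809091430244, 265140761445251851745077114759031376], [23295494445998151,
  1158139236088153464, -25652414630359278169, -6018697726310537728302, -190408338162374902771486,
  3892370502877797062017264, 450494103456828151247910336, 8034793732863917039734632862,
  -178072961958917537437971009598, -10979978697627770506991192238611,
  -67857099409790871338281717317656, 838220704752803652420650288867040,
  3872224822658100311231172604429632], [340216990243932, 21254192504534559, -387126333599785680,
  -102566970699756205069, -3243867200644623456450, 71716805736950165596394,
  7792010943783642730434868, 120340764049130146581445488, -3432594178836119277588781478,
  -171709057035055878517172292154, -974876575340286292451726524463,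
  12973600054815776202004450035412, 58729998237996384798723216530256], [5160067959031,
  309256582489746, -2182836165384243, -1553688697437719005, -60481141661753868178,
  731782443782332755840, 130862616404525056948251, 2784578284340984673098784,
  -53585002840162206150793857, -3336072891441290667995696901, -19961765252147903025513328545,
  251081899321224484988600523756, 1151071685008022737622033040240], [101134144365, 4553263092841,
  -150094701216084, -25046737852701618, -728832446813972740, 17439135411426667172,
  1891003795541963761995, 32720029620999471947391, -624259304045776302246891,
  -51693245233249338189628902, -361919714386555159928985666, 4066263515363830550641410840,
  19367646639952326508863569376], [1701658026, 90924196209, -3175667661251, -534797039444034,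
  -11167911191506032, 582234806508326600, 36943906322555394794, 239680975329484315731,
  -24636226053382692049479, -592429059816569243302149, -1650881637200836448701488,
  42369937322263442573039808, 167496978212648430513841728], [14716428, 1613359458, 24082180233,
  -6502684121351, -414768954973926, 170575473778488, 750917674854589916, 22662791658442560602,
  -256352419209705288129, -24360948947016820402803, -159648307421687722978257,
  1845531543127504052295084, 8652283036775004024844272], [760197, 10155246, -1839455316,
  -147779356542, -302471017334, 170935914950304, 8884117269941547, 13207374208632608,
  -2960484480883389913, -242132607824223938430, -2005073619910830613320, 20963646134301778267296,
  103800490261587505221120], [9120, 705477, -31267794, -3901259316, -73396080222, 6724166043466,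
  275471319826944, 33887734845867, -294192258242761792, -2789890963892938873,
  26068375582980545250, 161708170112839897560, 68289796224728621856], [6, 9084, 678225, -32624244,
  -3852322950, -68773292682, 6792939336148, 269648800395960, -168348865451103,
  -294080025665794390, -2613442948493462239, 27493889918522433744, 147961225153578680688], [13,
  -72, -49962, -2260750, 73404549, 6163716720, 80235508129, -5822519430984, -168530500247475,
  74821717978268, 88224007699738317, 475171445180629498, -2291157493210202812]]

/-- A lower triangular matrix bringing `psl33DerivRows` into upper triangular form. -/
def psl33Elimination : List (List ℤ) :=
  [[1], [-87943194359949177893, 5670607571682923970921], [374054669857788686670237660135175896679,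
  -48991601756598013359203483931434326503003, 1685291738153326107220471329564717705606836],
  [-8568469105737758083699754555533964465860574825185823340473,
  -58724778211570253573370354004966460611227945363266047939509,
  19638934096957971211966023410676366018856111006457912471491058,
  1213249979498309151585353801890961112937751232176097710726271210],
  [40508786440904631530265654522753282426262809003436133679368995134807362171759,
  -1287287459581853522444019233696253347107970629891233205707410638129972649730753,
  -66671904649038704808970295128099500030774255940636465969897447704750900491452814,
  -3968867520758280712263928253506130053940656923276797515910684211476805946840707930,
  183676159180318929901279161191169661678779528706930481529653195949317388062422932500],
  [21321235406409040533996468952639047750466151775858211551911279634528603848535740118506694566999,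
  1376425471619890072323903833165820767541771581863089536091011923711309840131884263108859988109158,
  -140154989439032330008578519219484167025295143474544605907458464917259530695821432172293038901872912,
  -4803964962264844758585589960541221094177708023898634900876811168208868738013033065971507539853236308,
  -59633813137002815845271084977381985250264419678801252117195719850909078729572934654799725845043036431,
  13983621040977606830079962169493693550020011346138340672817909227025384068522486912143734579203025728757],
  [131326292943460982154931669206503919237537585007632454948965613918740722867401766433936794777337823938859655545257,
  1633240568807970751279144903638457011608138510166196342882254306473569347340636855274987922971453756616712754009874,
  -418450437560233454944289244256731480222944375023552471662213461487991029624645854355073717207074517525529668037586842,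
  -29951312468926551992327739387414191043000224229283166342312803455375920295271366807610877266858824641393510701313230016,
  2840447731400783882608093965777297749580302055959614736912218170000588949842026729262914930261240066438441681342191595,
  37796775929392254540618882292848372987188974798846518831951058155744296886286002310046314138214438462884527803276698533957,
  1547548540632072287371203154276515286047046363184024552643818881721435806389796303126318249600039135578637418371519174478218],
  [-121020740732422262803582230237729508135659292126643646987570041749868020551050455728763210297056049447169377651774689481063533658347,
  3733510205712406005104957312993863941959882951502646356173563055831475971514860585575551660663463015690493528982811871254285437801756,
  505257386844575048108127133731756794775629032842846663336559063729854699987107919443419342461368344651127005588339085383523214012127702,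
  7367578500425436071015914542418875788466403149722433574535532694653962395469190662480617176701128867435009454131243365158283397074437601,
  -1194491072789272130562669116915517415694467870020973029985869118250201611617891472068596360171739567201920788769828842197299597637158055175,
  -37664391169922923086501492441606055743017361132657901898288110217521094380061699559961294965548849231291472792798963055196153653836853040247,
  466411090314965882349897360529027321068494461919512208680136138409407168468654167484846883691632102172311284823975585835811096489043878075407,
  49410687110235556439387785966231697383320402657265647795841451370817441757193370080230469372996243919475475810662617703719655218829968070884815],
  [-27623871651023865872843679310114933350326585040788085674508981958499279207829344264242774114509919045286775330975763133468907048739719081737643658805,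
  -464899070211102796404827594975729986673849082889874287863146514108545740864069378965873239837610266534719125291856628469122083268091497614733325181476,
  148584703766824200455882812073999074573849068717780570248509107582890637194947767596075499952639948133501256547484071410026999191950782970539419626925286,
  7012073487200584790462982685561731272800443858326041124528227305953340616406597385480655311882636589153029287388608512555752854014108221957486911970484287,
  -163976277082961053516825370430570313615661892472306136178502543869312903152885620926588502232441822891874863270804781481448816362324421311730075691879381795,
  -19918782669111564560019982995689593074949895328728338727737812396466957693069523949080214554870041784948682981375751512385379505096758331730999280718262775589,
  -299459388796360216915668495188289311627326605906394022408221099491805574525676228506027074086114717562312257575512912542943830215190620456519206573590273772071,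
  13689456981944646088114578251441440224040649363005338619460931818507147733143646907404137517731206437490607947616628282968020845103638602621166865593992771836479,
  468171237014304048043038293012392704470810564070425908524710322816440748840961189590224001848654236395285920630728956833482591697361875550473883307822088757440042],
  [-1438018726115320105777337522798836625857464942123347738195798912456761959559553469231550998147601314607640753285733419748682021570250377437090945791948187772098353495,
  -292507932123417795426165057270087908770450429601235745821243066358471693162963351152974289867460488575073266979962353973259867428958837504398481795990399680119466768590,
  -560149685421540308838609873116131016931479774163450630157733100834686072424547392551075030597321630440866252779305435972582980069179035056414073852017134047478453120866,
  1903640971818224076733698107841029465808306883873720590348710503530879254858825495202981529381944861323282243934211057524951030518581569047562143361266023392890995639833827,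
  74867110619697209936275862292236016021351144794095390727466707732023799551953714688152876086518772012882216414917983402072146282160450721566241270881535280727373016189876469,
  -2317738484140359894919131551246864836119839002875518723773875344111044632933795222325908612137392184407889924429260147477855544189299258557936092966933265415914600697131166336,
  -241545633165085271101103203521873632598962858851160327223263676587747706830992655203200382655443532347062191550438660981362837538013223434379946499688551189634508288767250043617,
  -3360800539659363266447713433944906348398299836148240080890883536510428668471922028623327468817851929628723108372961595437722403383441436943620336050081288956653213252602179605461,
  164254227835689583511662495654209889577566300240857304361986780244827686255411183738499902106874769640082705770568012081694332209360653417835595454111376798012538707845036165457805,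
  5890740038237389860501117671361185910513997312427718986701926175502935625963166642850191609057938971265866193103528697809297976442141016858398941015921185891308652837879408181937311],
  [89460820776668476018503265842841167725841342587976005637732820256514140508360482191722290979764169681008366147372452330940197394076317917525284584505900716528780298023255,
  -1667114705372007858515846899630891091968853615904195796022175111488531264163178041823845559866599052001151566792223250168249617541606667428409271767482979668713523444199010,
  -476471199900382318734212378691236733949909964915175547681863238077876072032156446698614216396261313827282828748548247262207821082670455497471161893281555396203372685626214570,
  -17052663183879725657432024384574425599976282562762342123811519225117891342701758304395506327973223575347188955877960790823722382186133825647830420958571409360867012663734371739,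
  1399887843366864051076861124529145267009419715475733593717892352954427330598687499957570542855449308637586516493956636375639843494836609770146274875416044984588537465653793169487,
  81296927176872732575622974444310563201533968022660557108120678276929189640686343667409344112330969625738253343684163839316150035799524993279363019952293345570157521464577120029524,
  -141789824100717729598942757372106139590390337976668247173356971485187419752841314989082573652755862625733339659550171818800411612478269196904417948038599733001165865740540341702533,
  -155332068441133076685499263159791601944264551897385596013901337387110145127264363976412751575978725960688684904884615406327285358682822381280625517027938692453114076093914261124232915,
  -3061687630699156270566611599746996483132501372356256168113206405365835775073744849847858130805863921834103877128393169985413992894599329767336739562042673675601286742195925091961646489,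
  62477218568718938252467371663693769507955384280179942912076870461263428467324578976664297456634462220116106972107626232587673352464304701297631920116986686100134803711155682534508933979,
  3886278191091650471681808343354791380203671629673570306344722623581965021394288316130133428159483037146909474568699124926948538907773536717517638876236466446055644935239689915430899136410],
  [164363726081635250084569308984053596923918549256767533776374718522405599174139306245416179382782376440871734312063986899477796297894847655166204873411651824329999790968327749,
  2986599359150502672676115689296845019568975701501285552532201655634997366139015493639702468069961100623084556075793354473523126106693588917279333633228160674078453302712015410,
  -815308408455213467768982996656821199075665973682917997889335778840951360824527526942269346009199886766680693699877345152811909935727930401780106094841130110180245319165434868966,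
  -59101616194269120555970484681767717047088717414488813887224878811737723223299071132505003606045570213408658725830715408724685248644866125496408817517803336853679789202530515328871,
  536809166952127955526586530451987373020886756521605469661148321606296346359828993694370705248623821642459538167408615867802067055390310571206936453787673227804160654490116631368153,
  191324428755259978118581754353427864051658622684584545688401134063993844899209938398787099616096005712889593036164008719951987304279724584219698432346584565771461169192773869642023670,
  5784174023838916835678596656350909635773486941212161672720015021687885709749816113062447375132116093530772201044316937956642425179213046794319685144096331047276064949665440051493719547,
  -162998949568815936108188422472354303360322783523873947102526058000602094540476585026115460181574956372285134709352315515660905235165328975226479009511645383650432662626289511631234986772,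
  -12958449242024400735129199524976181545675358089611619420913055927512209023555580714666019128203610934443107071046056916148513411473743302778317336007727615187253395199915664626474567542423,
  -154518726373437925001291007565138536782255000938509166693941543512531845628872690195002784318668986512455648108329573718917429144895762137150274978246675138095624910030368591443303026199453,
  7632894242149195365367073305024853021814566886865394292799087129050927214100014691024927666515513997695210723685121429585279541823628284963772936295019036011299016486245360539813365321240355,
  228985817092041826298510252477077716761286621724315341876567485238053678177281978698516275504167722492308364596832586145758261885743014922394879233508480082329726313602414507083531932343019453],
  [-2435939785591203228855843128728191374383702241398968213692067804938711637777523566850529398689550880150088683069448558752790454181495339311847754464465949439082196093868591849,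
  28113231609959456076262985929456137082105527894393903457889198078954464465239597782454640579628271224008978353885368588765655897891354197117417913180578467285835798782482149784,
  10849867220755215569353515047851653027384876487580958089832534775797369444532246287280912219590836780912835785329842486638303691188846083088635547133888932026552271963934800133746,
  491580853504364381731858814191011080051390213911852343671649044559859608935856377179183435452768749258264322072679357502092749013762863337918238481339466046584160680450798390149975,
  -22281442897229536159870625116972802184076877762713621801344659754914399458282214694109512642092138065909466664131873950274150820460505512492357389109886212219201986556952327221299291,
  -1741784954542459262219922695608384948299896747914487082280313882056255770460963373310258317752107244553262500339033061467574081268375293880577065467725387951547926112853350868274923556,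
  -19152452924160024482903585970813375340002983564937711027393505616640450025894094619584909491387855795162743226601871755568896395065938441543188493400019344202766257614801205232512609475,
  2416296530795550613144795687611391911421526663683636438147828367002921927561243293703793177795878279081392895836119157958436187359449129273547020629232049355270943859214553075118499655850,
  68716810280450899800257049813140723545593938788764056901147625215077223000509730123913192615553361496573150661227965649755735637397108972746147128725254702131479571343542521759480443467191,
  -326817493343400408363597568595828416167362336997893390508031309577934558112027563028779548694474032446271746612178542348770383644268341776836818430706791513343755356433061258651610246990677,
  -67713858908471307148867782009675634436961603693788549064143000318522921545843941720115809309510477038337720569121420439954645170823277879911282043477601330387370942079578396744308514123733801,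
  -240177995687477898436606080720416292128578285746868463409678520482846358608156247187949420780364272871454876031855955253349304322476282508805819701909541396870260771988846736936609155385507143,
  4367613287537671809489278970188834618135169859970293978982336104171363042806153982470415192544923443712153732412954714042171557343574409097115328591869602876964281383934234412890504158243711838]]

/-- The prime ramified in the splitting field of `psl33Poly`. -/
abbrev psl33Prime : ℤ := 83420911386433

/-- The index of `ℤ[θ]` in the ring of integers of the root field `ℚ(θ)` of `psl33Poly`. -/
def psl33Index : ℤ :=
  19786899140676964569828427182119698551621347313380881074359404914926666533699268583565017836670432044

/-- The matrix with the given rows. -/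
def rowsMatrix (rows : List (List ℤ)) : Matrix (Fin 13) (Fin 13) ℤ :=
  Matrix.of fun i j => (rows.getD i []).getD j 0

/-- The coefficients of `X ^ (12 - j)`. -/
def monomialRow (j : ℕ) : List ℤ := (List.range 13).map fun k => if k = j then 1 else 0

-- Modulus 0 makes `%` the identity, so this is exact arithmetic in ℤ[X]/(f). The rows form the
-- matrix of multiplication by f'(θ), whose determinant is the norm of f'(θ).
set_option maxRecDepth 10000 in
lemma psl33DerivRows_eq : ∀ j : Fin 13,
    psl33DerivRows.getD j [] = mulMod 0 psl33Red (monomialRow j) psl33Deriv := by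
  decide +kernel

set_option maxRecDepth 10000 in
lemma elimination_upper : ∀ i j : Fin 13, j < i →
    (rowsMatrix psl33Elimination * rowsMatrix psl33DerivRows) i j = 0 := by
  decide +kernel

set_option maxRecDepth 10000 in
lemma elimination_lower : ∀ i j : Fin 13, i < j →
    (rowsMatrix psl33Elimination i j : ℤ) = 0 := by
  unfold rowsMatrix Matrix.of
  decide +kernel

set_option maxRecDepth 10000 in
lemma elimination_diag :
    ∏ i, (rowsMatrix psl33Elimination * rowsMatrix psl33DerivRows) i i =
      (∏ i, rowsMatrix psl33Elimination i i) * (psl33Prime ^ 4 * psl33Index ^ 2) := by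
  decide +kernel

set_option maxRecDepth 10000 in
lemma elimination_diag_ne_zero : ∏ i, rowsMatrix psl33Elimination i i ≠ 0 := by
  decide +kernel

/-- Comparing determinants in (lower triangular) · D = (upper triangular) avoids expanding a 13 × 13
determinant. The truncated rows of `psl33Elimination` are completed by the default entry 0. -/
lemma det_psl33DerivRows : (rowsMatrix psl33DerivRows).det = psl33Prime ^ 4 * psl33Index ^ 2 := by
  have h1 : (rowsMatrix psl33Elimination).det = ∏ i, rowsMatrix psl33Elimination i i :=
    Matrix.det_of_isLowerTriangular _ fun i j hij => elimination_lower i j hij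
  have h2 : (rowsMatrix psl33Elimination * rowsMatrix psl33DerivRows).det =
      ∏ i, (rowsMatrix psl33Elimination * rowsMatrix psl33DerivRows) i i :=
    Matrix.det_of_isUpperTriangular fun i j hij => elimination_upper i j hij
  rw [Matrix.det_mul, h1, elimination_diag] at h2
  exact mul_left_cancel₀ elimination_diag_ne_zero h2

section

variable {E : Type*} [CommRing E]

/-- The Vandermonde matrix with decreasing exponents. -/
def revVandermonde (r : Fin 13 → E) : Matrix (Fin 13) (Fin 13) E :=
  Matrix.of fun i j => r i ^ (12 - (j : ℕ))

lemma polyVal_eq_rowSum (x : E) (l : List ℤ) (hl : l.length = 13) :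
    polyVal x l = ∑ j : Fin 13, (l.getD j 0 : ℤ) * x ^ (12 - (j : ℕ)) :=
  polyVal_eq_sum_of_length x l hl

lemma polyVal_monomialRow (x : E) (j : Fin 13) :
    polyVal x (monomialRow j) = x ^ (12 - (j : ℕ)) := by
  rw [polyVal_eq_rowSum x _ (by simp [monomialRow]), Finset.sum_eq_single j]
  · simp [monomialRow, List.getD_eq_getElem?_getD]
  · intro i _ hij
    have : (i : ℕ) ≠ j := fun h => hij (Fin.ext h)
    simp [monomialRow, List.getD_eq_getElem?_getD, this]
  · simp

lemma degree_polyVal_lt (l : List ℤ) : (polyVal (X : E[X]) l).degree < l.length := by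
  induction l with
  | nil => simp [polyVal]
  | cons a l ih =>
    rw [polyVal, List.length_cons]
    refine (degree_add_le _ _).trans_lt (max_lt ?_ (ih.trans (by exact_mod_cast Nat.lt_succ_self _)))
    have : (a : E[X]) = C (a : E) := by simp
    rw [this]
    exact (degree_C_mul_X_pow_le _ _).trans_lt (by exact_mod_cast Nat.lt_succ_self _)

lemma eval_polyVal_X (x : E) (l : List ℤ) : (polyVal (X : E[X]) l).eval x = polyVal x l := by
  have := map_polyVal (Polynomial.evalRingHom x) (X : E[X]) l
  simpa using this

lemma det_revVandermonde (r : Fin 13 → E) :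
    (revVandermonde r).det = ∏ i, ∏ j ∈ Finset.Ioi i, (r i - r j) := by
  have : revVandermonde r = Matrix.projVandermonde 1 r := by
    ext i j
    simp only [revVandermonde, Matrix.of_apply, Matrix.projVandermonde_apply, Pi.one_apply,
      one_pow, one_mul, Fin.val_rev]
    congr 1
    omega
  rw [this, Matrix.det_projVandermonde]
  simp

variable [IsDomain E]

lemma X_pow_sub_polyVal_eq_nodal {l : List ℤ} (hl : l.length = 13) {r : Fin 13 → E} (hr : Function.Injective r)
    (hroot : ∀ i, r i ^ 13 = polyVal (r i) l) :
    X ^ 13 - polyVal (X : E[X]) l = Lagrange.nodal Finset.univ r := by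
  have hlt : (polyVal (X : E[X]) l).degree < ((13 : ℕ) : WithBot ℕ) := by
    rw [← hl]
    exact degree_polyVal_lt l
  have hm : (X ^ 13 - polyVal (X : E[X]) l).Monic := monic_X_pow_sub hlt
  have hd : (X ^ 13 - polyVal (X : E[X]) l).degree = ((13 : ℕ) : WithBot ℕ) := by
    rw [degree_sub_eq_left_of_degree_lt (by rwa [degree_X_pow]), degree_X_pow]
  refine Polynomial.eq_of_degree_sub_lt_of_eval_index_eq Finset.univ (hr.injOn) ?_ ?_
  · have hn : (Lagrange.nodal Finset.univ r).degree = ((13 : ℕ) : WithBot ℕ) := by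
      rw [Lagrange.degree_nodal]; simp
    have := degree_sub_lt_left (hd.trans hn.symm) hm.ne_zero
      (by rw [hm.leadingCoeff, (Lagrange.nodal_monic).leadingCoeff])
    rw [hd] at this
    simpa using this
  · intro i _
    rw [Lagrange.eval_nodal_at_node (Finset.mem_univ i), eval_sub, eval_pow, eval_X,
      eval_polyVal_X, hroot, sub_self]

/-- The discriminant of `psl33Poly`, in terms of its roots. -/
theorem det_revVandermonde_sq {r : Fin 13 → E} (hr : Function.Injective r)
    (hroot : ∀ i, r i ^ 13 = polyVal (r i) psl33Red) :
    (revVandermonde r).det ^ 2 = ((psl33Prime ^ 4 * psl33Index ^ 2 : ℤ) : E) := by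
  have hder : derivative (X ^ 13 - polyVal (X : E[X]) psl33Red) =
      polyVal (X : E[X]) psl33Deriv := by
    simp only [psl33Red, psl33Deriv, polyVal, List.length_cons, List.length_nil, derivative_sub,
      derivative_add, derivative_mul, derivative_X_pow, derivative_intCast, derivative_zero]
    push_cast
    simp only [map_ofNat, map_one, map_zero]
    ring
  have hval : ∀ i, polyVal (r i) psl33Deriv = ∏ j ∈ {i}ᶜ, (r i - r j) := fun i => by
    rw [← eval_polyVal_X, ← hder, X_pow_sub_polyVal_eq_nodal rfl hr hroot,
      Lagrange.eval_nodal_derivative_eval_node_eq (Finset.mem_univ i), Lagrange.eval_nodal]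
    refine Finset.prod_congr ?_ fun _ _ => rfl
    ext j; simp
  -- The vectors of powers of the roots diagonalize multiplication by f'(θ), with eigenvalues f'(r
  -- i). As the Vandermonde determinant is nonzero it cancels, leaving the product of the f'(r i).
  have hmat : revVandermonde r * ((rowsMatrix psl33DerivRows).map (Int.cast : ℤ → E)).transpose =
      Matrix.diagonal (fun i => polyVal (r i) psl33Deriv) * revVandermonde r := by
    ext i j
    rw [Matrix.diagonal_mul, Matrix.mul_apply]
    have h := polyVal_mulMod (q := 0) (by simp) psl33Red_ne_nil (hroot i) (monomialRow j)
      psl33Deriv rfl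
    rw [polyVal_monomialRow, ← psl33DerivRows_eq,
      polyVal_eq_rowSum _ _ (by rw [psl33DerivRows_eq, length_mulMod]; rfl)] at h
    rw [revVandermonde, Matrix.of_apply, mul_comm, ← h]
    refine Finset.sum_congr rfl fun k _ => ?_
    simp [rowsMatrix, mul_comm]
  have hne : (revVandermonde r).det ≠ 0 := by
    rw [det_revVandermonde]
    refine Finset.prod_ne_zero_iff.2 fun i _ => Finset.prod_ne_zero_iff.2 fun j hj => ?_
    exact sub_ne_zero.2 fun h => (Finset.mem_Ioi.1 hj).ne (hr h)
  have hdet := congrArg Matrix.det hmat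
  rw [Matrix.det_mul, Matrix.det_mul, Matrix.det_transpose, Matrix.det_diagonal, mul_comm] at hdet
  have hC : ((rowsMatrix psl33DerivRows).map (Int.cast : ℤ → E)).det =
      ((psl33Prime ^ 4 * psl33Index ^ 2 : ℤ) : E) := by
    rw [← det_psl33DerivRows]
    exact ((Int.castRingHom E).map_det _).symm
  rw [← hC, mul_right_cancel₀ hne hdet]
  simp_rw [hval]
  rw [← Finset.prod_prod_Ioi_mul_eq_prod_prod_off_diag (fun j i => r i - r j), det_revVandermonde,
    ← Finset.prod_pow]
  -- Pairing (i, j) with (j, i) contributes one sign for each of the 78 pairs, an even number.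
  have hsign : ∏ i : Fin 13, ∏ _j ∈ Finset.Ioi i, (-1 : E) = 1 := by
    simp only [Finset.prod_const, Fin.card_Ioi, Finset.prod_pow_eq_pow_sum]
    exact Even.neg_one_pow (by decide)
  rw [← one_mul (∏ i, _ ^ 2), ← hsign, ← Finset.prod_mul_distrib]
  refine Finset.prod_congr rfl fun i _ => ?_
  rw [← Finset.prod_pow, ← Finset.prod_mul_distrib]
  exact Finset.prod_congr rfl fun j _ => by ring

end

/-! ### Integral elements of discriminant p^4. -/

/-- The numerator of an integral element of `ℚ(θ)` of degree `12` in `θ`. -/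
def integralNum : List ℤ :=
  [1,
  913612087682946567945384567844978656286407745131646389306947128722125659680639841221745339075218,
  54419742135608910626828547623000453523793727289586581662376237873979884065320322476070557096819210,
  106311587109148733976284698854380806346721736266929799232021004987506389959944371326030401055541341,
  128835484041307882200245737202686592960825921339876400812324516311280360056458687445847552768012069,
  471396011018168515608546788637918178738490460817242590843779265362300846568695859452181320026479358,
  264766367300555860254608164428578325504332395698381965668445074327961546222940412554206203614706291,
  65008738888216718469088976758042313671446674245569709005003412845941893728880936464066234217281460,
  280920633800509895572464040511596251626516061810329947832936485207506070938970685575149667807220149,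
  522603155497690350537968968952998045760681487699120334884292559513307837221930292403399494368803443,
  443931393130791252454305070686848437233217485187612586791133788868170906545920484158531023317916339,
  186742914548174755968576411434541137374424238584538702930600918788906371372287240389401453511096545,
  474108551390370208805162058799911973396716714769210703477095456855469843862595408824606129503710332]

/-- The denominator of an integral element of `ℚ(θ)` of degree `12` in `θ`. -/
def integralDen : ℤ :=
  534781057856134177562930464381613474368144521983267056063767700403423419829709961717973455045146812

/-- The numerator of an integral element of `ℚ(θ)` of degree `11` in `θ`, with denominator `37`. -/
def integralNum' : List ℤ :=
  [0, 1, 12, 33, 24, 19, 0, 3, 1, 20, 13, 8, 31]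

/-- The coordinates of the elements of an integral basis of `ℚ(θ)`, multiplied by the index. -/
def scaledBasis : List (List ℤ) :=
  (integralNum.map (37 * ·)) :: (integralNum'.map (integralDen * ·)) ::
    (List.range 11).map fun j => (monomialRow (j + 2)).map (psl33Index * ·)

/-- The coordinates of the powers of `θ` in the integral basis. -/
def powerCoords : List (List ℤ) :=
  [[534781057856134177562930464381613474368144521983267056063767700403423419829709961717973455045146812,
  -33803647244269023013979229010264210282597086569870916404357043762718649408183674125204577545783066,
  -43456397083413551811483932808860709648356834348006824990692872329314376149152644381409613027916594,
  -76162388215611497234087008115496510689270280677585468384891749739676243190483256565712804866059147,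
  -106908793936917164569556507574407105209952135456716887468957785221949344224123331256525664630206837,
  -454037381352192530817584481848863584269048713659741309446947269916580459034763702468968158584050216,
  -264766367300555860254608164428578325504332395698381965668445074327961546222940412554206203614706291,
  -62267902625167878765252823054507377702587451010174769837082571459775516749839016940400998200055806,
  -280007021712826949004518655943751272970229654065198301443629538078783945279290045733927922468144931,
  -504330913744031419179061277596098472634953332796487407098153616938865324028317495578964587587299083,
  -432054435990912947071015071304863714701494184500901183730143476194783272970072166222648333909938505,
  -179434017846711183425013334891781308124132976623485531816145341759129366094842121659627490798494801,
  -445786576672198865198855137196717635051838074670129665408580095865083948412495573746732023992378574],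
    [0, 37, -12, -33, -24, -19, 0, -3, -1, -20, -13, -8, -31]] ++
    (List.range 11).map fun j => monomialRow (j + 2)

/-- The products of the scaled basis elements with a given one. -/
def productRows (w : ℕ) : List (List ℤ) :=
  (List.range 13).map fun j => mulMod 0 psl33Red (scaledBasis.getD w []) (scaledBasis.getD j [])

/-- The matrix of the multiplication by a basis element in the integral basis. -/
def structureRows (w : ℕ) : List (List ℤ) :=
  (productRows w).map fun row => (List.range 13).map fun j =>
    ((List.range 13).map fun k => row.getD k 0 * (powerCoords.getD k []).getD j 0).sum /
      psl33Index ^ 2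

-- The division in `structureRows` is integer division; this identity certifies that it is exact.
-- Hence multiplication by the first basis element preserves the lattice.
set_option maxRecDepth 10000 in
lemma structureRows_zero : ∀ i j : Fin 13,
    psl33Index * (rowsMatrix (structureRows 0) * rowsMatrix scaledBasis) i j =
      rowsMatrix (productRows 0) i j := by
  unfold rowsMatrix Matrix.of
  decide +kernel

set_option maxRecDepth 10000 in
lemma structureRows_one : ∀ i j : Fin 13,
    psl33Index * (rowsMatrix (structureRows 1) * rowsMatrix scaledBasis) i j =
      rowsMatrix (productRows 1) i j := by
  unfold rowsMatrix Matrix.of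
  decide +kernel

set_option maxRecDepth 10000 in
lemma scaledBasis_upper : ∀ i j : Fin 13, j < i → rowsMatrix scaledBasis i j = (0 : ℤ) := by
  unfold rowsMatrix Matrix.of
  decide +kernel

set_option maxRecDepth 10000 in
lemma scaledBasis_diag : ∏ i, rowsMatrix scaledBasis i i = psl33Index ^ 12 := by
  decide +kernel

lemma psl33Index_ne_zero : psl33Index ≠ 0 := by unfold psl33Index; norm_num

lemma det_scaledBasis : (rowsMatrix scaledBasis).det = psl33Index ^ 12 :=
  (Matrix.det_of_isUpperTriangular fun i j hij => scaledBasis_upper i j hij).trans scaledBasis_diag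

lemma length_scaledBasis : ∀ j : Fin 13, (scaledBasis.getD j []).length = 13 := by decide +kernel

section

variable {E : Type*} [Field E] [CharZero E]

/-- The elements of the integral basis. -/
noncomputable def integralElement (x : E) (j : Fin 13) : E :=
  polyVal x (scaledBasis.getD j []) / (psl33Index : E)

lemma integralElement_eq_sum (x : E) (j : Fin 13) : integralElement x j =
    ∑ k : Fin 13, x ^ (12 - (k : ℕ)) * ((rowsMatrix scaledBasis j k : ℤ) / (psl33Index : E)) := by
  rw [integralElement, polyVal_eq_rowSum _ _ (length_scaledBasis j), Finset.sum_div]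
  refine Finset.sum_congr rfl fun k _ => ?_
  simp only [rowsMatrix, Matrix.of_apply]
  ring

lemma integralElement_of_le (x : E) (j : Fin 13) (hj : 2 ≤ j) :
    integralElement x j = x ^ (12 - (j : ℕ)) := by
  have hne : (psl33Index : E) ≠ 0 := by exact_mod_cast psl33Index_ne_zero
  have hrow : ∀ j k : Fin 13, 2 ≤ j →
      (if k = j then psl33Index else 0 : ℤ) = rowsMatrix scaledBasis j k := by
    unfold rowsMatrix Matrix.of
    decide +kernel
  rw [integralElement_eq_sum, Finset.sum_eq_single j]
  · rw [← hrow j j hj, if_pos rfl, div_self hne, mul_one]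
  · intro k _ hk
    rw [← hrow j k hj, if_neg hk]
    simp
  · simp

lemma integralElement_mul {x : E} (hx : x ^ 13 = polyVal x psl33Red) {w : Fin 13}
    (hw : ∀ i j : Fin 13, psl33Index * (rowsMatrix (structureRows w) * rowsMatrix scaledBasis) i j =
      rowsMatrix (productRows w) i j) (j : Fin 13) :
    integralElement x w * integralElement x j =
      ∑ k, ((rowsMatrix (structureRows w) j k : ℤ) : E) * integralElement x k := by
  have hne : (psl33Index : E) ≠ 0 := by exact_mod_cast psl33Index_ne_zero
  have hrow : ∀ w j : Fin 13, (productRows w).getD j [] =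
      mulMod 0 psl33Red (scaledBasis.getD w []) (scaledBasis.getD j []) := fun w j => by
    simp [productRows, List.getD_eq_getElem?_getD]
  have h1 := polyVal_mulMod (q := 0) (by simp) psl33Red_ne_nil hx (scaledBasis.getD w [])
    (scaledBasis.getD j []) (length_scaledBasis j)
  rw [polyVal_eq_rowSum _ _ (length_mulMod ..), ← hrow] at h1
  have h2 : ∀ l : Fin 13, ((((productRows w).getD j []).getD l 0 : ℤ) : E) = psl33Index *
      ∑ k, ((rowsMatrix (structureRows w) j k : ℤ) : E) * (rowsMatrix scaledBasis k l : ℤ) := by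
    intro l
    have := congrArg (Int.cast : ℤ → E) (hw j l)
    rw [Matrix.mul_apply] at this
    push_cast at this
    exact this.symm
  rw [integralElement, integralElement, div_mul_div_comm, ← h1]
  simp_rw [h2, integralElement_eq_sum, Finset.mul_sum, Finset.sum_mul, Finset.sum_div]
  rw [Finset.sum_comm]
  refine Finset.sum_congr rfl fun k _ => Finset.sum_congr rfl fun l _ => ?_
  field_simp

lemma isIntegral_of_pow_eq_polyVal {R : Type*} [CommRing R] {x : R}
    (hx : x ^ 13 = polyVal x psl33Red) : IsIntegral ℤ x := by
  refine ⟨X ^ 13 - polyVal X psl33Red, monic_X_pow_sub (degree_polyVal_lt psl33Red), ?_⟩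
  have h := map_polyVal (Polynomial.eval₂RingHom (algebraMap ℤ R) x) X psl33Red
  rw [Polynomial.coe_eval₂RingHom] at h
  rw [eval₂_sub, h, eval₂_X, eval₂_pow, eval₂_X, hx, sub_self]

/-- An element that maps a nonzero finitely generated ℤ-module in a field into itself is integral.
This is applied to the lattice of all these elements; only the first two need it, the others being
powers of x. -/
lemma isIntegral_integralElement {x : E} (hx : x ^ 13 = polyVal x psl33Red) (j : Fin 13) :
    IsIntegral ℤ (integralElement x j) := by
  have hxi := isIntegral_of_pow_eq_polyVal hx
  let N : Submodule ℤ E := Submodule.span ℤ (Set.range (integralElement x))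
  have hN : N ≠ ⊥ := by
    intro h
    have h1 : integralElement x 12 ∈ N := Submodule.subset_span ⟨12, rfl⟩
    rw [h, Submodule.mem_bot, integralElement_of_le x 12 (by decide)] at h1
    simp at h1
  have key : ∀ w : Fin 13, (∀ i j : Fin 13,
      psl33Index * (rowsMatrix (structureRows w) * rowsMatrix scaledBasis) i j =
        rowsMatrix (productRows w) i j) →
      IsIntegral ℤ (integralElement x w) := by
    intro w hw
    refine isIntegral_of_smul_mem_submodule N hN (Submodule.fg_span (Set.finite_range _)) _ ?_
    intro y hy
    induction hy using Submodule.span_induction with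
    | mem y hy =>
      obtain ⟨j, rfl⟩ := hy
      rw [smul_eq_mul, integralElement_mul hx hw]
      refine Submodule.sum_mem _ fun k _ => ?_
      rw [← zsmul_eq_mul]
      exact Submodule.smul_mem _ _ (Submodule.subset_span ⟨k, rfl⟩)
    | zero => simp
    | add y z _ _ hy hz => rw [smul_add]; exact add_mem hy hz
    | smul a y _ hy => rw [smul_comm]; exact Submodule.smul_mem _ _ hy
  by_cases hj : 2 ≤ j
  · rw [integralElement_of_le x j hj]
    exact hxi.pow _
  · have : j = 0 ∨ j = 1 := by omega
    rcases this with rfl | rfl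
    · exact key 0 structureRows_zero
    · exact key 1 structureRows_one

/-- The discriminant of the integral basis. -/
theorem det_integralElement_sq {r : Fin 13 → E} (hr : Function.Injective r)
    (hroot : ∀ i, r i ^ 13 = polyVal (r i) psl33Red) :
    (Matrix.of fun i j => integralElement (r i) j).det ^ 2 = (psl33Prime : E) ^ 4 := by
  have hne : (psl33Index : E) ≠ 0 := by exact_mod_cast psl33Index_ne_zero
  -- The base change from powers has determinant m^12 before scaling, and scaling 13 rows gives
  -- m^13. So the determinant is divided by m, and its square by m².
  have hmat : (psl33Index : E) • (Matrix.of fun i j => integralElement (r i) j) =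
      revVandermonde r * ((rowsMatrix scaledBasis).map (Int.cast : ℤ → E)).transpose := by
    ext i j
    rw [Matrix.smul_apply, Matrix.of_apply, integralElement_eq_sum, Matrix.mul_apply, smul_eq_mul,
      Finset.mul_sum]
    refine Finset.sum_congr rfl fun k _ => ?_
    simp only [revVandermonde, Matrix.of_apply, Matrix.transpose_apply, Matrix.map_apply]
    field_simp
  have hdet := congrArg Matrix.det hmat
  have hB : ((rowsMatrix scaledBasis).map (Int.cast : ℤ → E)).det = (psl33Index : E) ^ 12 := by
    have := congrArg (Int.cast : ℤ → E) det_scaledBasis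
    rw [Int.cast_pow] at this
    rw [← this]
    exact ((Int.castRingHom E).map_det _).symm
  rw [Matrix.det_smul, Matrix.det_mul, Matrix.det_transpose, hB, Fintype.card_fin] at hdet
  have hsq := det_revVandermonde_sq hr hroot
  rw [Int.cast_mul, Int.cast_pow, Int.cast_pow] at hsq
  have h13 : (psl33Index : E) * (Matrix.of fun i j => integralElement (r i) j).det =
      (revVandermonde r).det := by
    apply mul_right_cancel₀ (pow_ne_zero 12 hne)
    rw [← hdet]
    ring
  apply mul_right_cancel₀ (pow_ne_zero 2 hne)
  rw [← hsq, ← h13]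
  ring

end

/-! ### Line sums modulo 5. -/

/-- The lower coefficients of `X ^ 13 - g`, where `g` is the minimal polynomial of the sum of the
roots of `psl33Poly` on a line of the projective plane. -/
def lineRed : List ℤ :=
    [24, 13410, 2433387, 155161260, 1119399390, -297569422650, -12429042161526, -97129403665902,
    5387289140211004, 166483160205680631, 1964614964461651638, 9495849112166050344,
    8456318243973852903]

/-- The coefficients modulo `5` of `X ^ (5 ^ i)` modulo `psl33Poly`. -/
def frobRows : List (List ℤ) :=
    [[0, 0, 0, 0, 0, 0, 0, 0, 0, 0, 0, 1, 0], [0, 0, 0, 0, 0, 0, 0, 1, 0, 0, 0, 0, 0], [0, 2, 0,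
    0,     0, 1, 0, 0, 2, 1, 4, 2, 3], [3, 4, 4, 1, 0, 1, 2, 4, 1, 1, 2, 2, 1], [0, 0, 0, 4, 3, 3,
    0, 0,     4, 1, 4, 3, 2], [1, 2, 0, 4, 2, 2, 4, 0, 4, 1, 3, 4, 2], [1, 2, 3, 1, 2, 3, 3, 1, 1,
    1, 2, 2,     1], [3, 3, 0, 3, 2, 0, 0, 2, 2, 2, 0, 1, 3], [0, 0, 2, 2, 1, 1, 4, 1, 2, 1, 1, 1,
    2], [2, 2,     0, 3, 1, 4, 3, 4, 2, 4, 3, 0, 2], [4, 4, 4, 2, 1, 2, 3, 4, 3, 3, 4, 0, 0], [1,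
    0, 2, 3, 4, 4,     4, 4, 3, 4, 2, 2, 4], [0, 1, 0, 2, 4, 4, 2, 4, 1, 1, 0, 2, 1]]

/-- The inverse of `frobRows` modulo `5`. -/
def frobInv : List (List ℤ) :=
    [[4, 1, 1, 2, 4, 1, 0, 0, 2, 1, 4, 1, 0], [1, 0, 3, 4, 2, 3, 1, 2, 3, 1, 3, 4, 1], [2, 4, 4,
    3,     1, 3, 4, 1, 3, 1, 3, 2, 4], [2, 3, 3, 4, 4, 1, 0, 0, 0, 4, 1, 0, 4], [2, 3, 2, 2, 3, 4,
    3, 4,     1, 2, 4, 0, 2], [2, 4, 1, 3, 4, 0, 3, 0, 0, 3, 0, 2, 4], [4, 0, 1, 4, 4, 3, 0, 2, 1,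
    0, 4, 3,     4], [0, 1, 0, 0, 0, 0, 0, 0, 0, 0, 0, 0, 0], [2, 1, 3, 3, 4, 3, 4, 4, 2, 0, 3, 0,
    4], [1, 0,     3, 1, 4, 4, 0, 3, 3, 0, 2, 1, 0], [4, 4, 3, 1, 3, 4, 1, 3, 1, 3, 2, 4, 2], [1,
    0, 0, 0, 0, 0,     0, 0, 0, 0, 0, 0, 0], [1, 1, 1, 1, 1, 1, 1, 1, 1, 1, 1, 1, 1]]

/-- The coefficients modulo `5` of the sum of the roots on a line. -/
def lineSumRow : List ℤ := [4, 0, 4, 3, 3, 4, 0, 3, 3, 0, 3, 1, 3]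

/-- The coefficients modulo `q` of the composition of `b` with `s`, modulo `X ^ n - r`. -/
def compMod (q : ℤ) (r s b : List ℤ) : List ℤ :=
  b.foldl (fun acc c => List.zipWith (· + ·) (mulMod q r acc s)
    ((List.range r.length).map fun k => if k + 1 = r.length then c else 0)) (r.map fun _ => 0)

/-- The fifth power modulo `5` and `psl33Poly`. -/
def powFive (a : List ℤ) : List ℤ :=
  mulMod 5 psl33Red a (mulMod 5 psl33Red (mulMod 5 psl33Red a a) (mulMod 5 psl33Red a a))

/-- The addition in `Fin 13` wraps around, so the last case says that X^(5^13) is congruent to X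
modulo 5 and f. -/
lemma powFive_frobRows : ∀ i : Fin 13,
    powFive (frobRows.getD i []) = frobRows.getD (i + 1 : Fin 13) [] := by
  decide +kernel

lemma length_frobRows : ∀ i : Fin 13, (frobRows.getD i []).length = 13 := by decide +kernel

/-- Invertibility of this matrix is the normal basis property of X modulo 5: its Frobenius
conjugates form a basis. -/
lemma frobRows_mul_frobInv : ∀ i j : Fin 13,
    (rowsMatrix frobRows * rowsMatrix frobInv) i j % 5 = if i = j then 1 else 0 := by
  decide +kernel

/-- All coefficients of g evaluated at the line sum vanish modulo 5 and f: the line sum is a root of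
g. -/
lemma compMod_lineSumRow : ∀ k : Fin 13,
    ((compMod 5 psl33Red lineSumRow (1 :: lineRed.map fun c => -c)).getD k 0) % 5 = 0 := by
  decide +kernel

lemma lineSumRow_eq : ∀ k : Fin 13,
    (lineSumRow.getD k 0 - ∑ i ∈ planarSet, (frobRows.getD i.val []).getD k 0) % 5 = 0 := by
  unfold planarSet
  decide +kernel

section

variable {R : Type*} [CommRing R]

lemma polyVal_zipWith_add (x : R) (a b : List ℤ) (h : a.length = b.length) :
    polyVal x (List.zipWith (· + ·) a b) = polyVal x a + polyVal x b := by
  induction a generalizing b with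
  | nil => obtain rfl := List.length_eq_zero_iff.1 h.symm; simp [polyVal]
  | cons a₀ a ih =>
    obtain _ | ⟨b₀, b⟩ := b
    · simp at h
    simp only [List.length_cons, add_left_inj] at h
    simp only [List.zipWith_cons_cons, polyVal, ih b h, List.length_zipWith, h, min_self]
    push_cast
    ring

lemma polyVal_map_neg (x : R) (l : List ℤ) : polyVal x (l.map fun c => -c) = -polyVal x l := by
  induction l with
  | nil => simp [polyVal]
  | cons a l ih => simp only [List.map_cons, polyVal, ih, List.length_map]; push_cast; ring

lemma polyVal_append (x : R) (a b : List ℤ) :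
    polyVal x (a ++ b) = polyVal x a * x ^ b.length + polyVal x b := by
  induction a with
  | nil => simp [polyVal]
  | cons c a ih =>
    simp only [List.cons_append, polyVal, ih, List.length_append]
    ring

lemma polyVal_const (x : R) (c : ℤ) {n : ℕ} (hn : n ≠ 0) :
    polyVal x ((List.range n).map fun k => if k + 1 = n then c else 0) = c := by
  obtain ⟨m, rfl⟩ := Nat.exists_eq_succ_of_ne_zero hn
  rw [List.range_succ, List.map_append, polyVal_append]
  have : (List.range m).map (fun k => if k + 1 = m.succ then c else 0) =
      (List.range m).map fun _ => 0 := by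
    refine List.map_congr_left fun k hk => if_neg ?_
    have := List.mem_range.1 hk
    omega
  rw [this, polyVal_map_zero]
  simp [polyVal]

lemma length_compMod (q : ℤ) (r s b : List ℤ) : (compMod q r s b).length = r.length := by
  unfold compMod
  obtain rfl | ⟨l, c, rfl⟩ := List.eq_nil_or_concat b
  · simp
  · simp [length_mulMod]

lemma polyVal_compMod {q : ℤ} (hq : (q : R) = 0) {x : R} {r : List ℤ} (hr : r ≠ [])
    (hx : x ^ r.length = polyVal x r) (s b : List ℤ) (hs : s.length = r.length) :
    polyVal x (compMod q r s b) = polyVal (polyVal x s) b := by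
  induction b using List.reverseRecOn with
  | nil => exact polyVal_map_zero x r
  | append_singleton b c ih =>
    have h : compMod q r s (b ++ [c]) = List.zipWith (· + ·) (mulMod q r (compMod q r s b) s)
        ((List.range r.length).map fun k => if k + 1 = r.length then c else 0) := by
      simp [compMod]
    rw [h, polyVal_zipWith_add _ _ _ (by simp [length_mulMod]), polyVal_mulMod hq hr hx _ _ hs, ih,
      polyVal_const _ _ (by simpa using hr), polyVal_append]
    simp [polyVal]

lemma polyVal_eq_zero_of_dvd {q : ℤ} (hq : (q : R) = 0) (x : R) (l : List ℤ)
    (h : ∀ k < l.length, q ∣ l.getD k 0) : polyVal x l = 0 := by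
  rw [polyVal_eq_sum]
  refine Finset.sum_eq_zero fun i _ => ?_
  obtain ⟨c, hc⟩ := h i i.2
  rw [hc]
  push_cast
  rw [hq]
  ring

/-- A monic polynomial over a domain is determined by its roots, if there are enough of them. -/
lemma exists_eq_of_pow_eq_polyVal [IsDomain R] {l : List ℤ} (hl : l.length = 13) {r : Fin 13 → R}
    (hr : Function.Injective r) (hroot : ∀ i, r i ^ 13 = polyVal (r i) l) {x : R}
    (hx : x ^ 13 = polyVal x l) : ∃ i, x = r i := by
  have h := congrArg (eval x) (X_pow_sub_polyVal_eq_nodal hl hr hroot)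
  rw [eval_sub, eval_pow, eval_X, eval_polyVal_X, hx, sub_self, Lagrange.eval_nodal] at h
  obtain ⟨i, -, hi⟩ := Finset.prod_eq_zero_iff.1 h.symm
  exact ⟨i, sub_eq_zero.1 hi⟩

end

/-- The translates of `planarSet`. -/
def planarLine (j : ZMod 13) : Finset (ZMod 13) := {i | i - j ∈ planarSet}

lemma mem_planarLine {i j : ZMod 13} : i ∈ planarLine j ↔ i - j ∈ planarSet := by
  simp [planarLine]

lemma planarLine_injective : Function.Injective planarLine := fun j j' h =>
  planarSet_translate_injective j j' fun i => by rw [← mem_planarLine, h, mem_planarLine]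

lemma sum_planarLine {M : Type*} [AddCommMonoid M] (z : ZMod 13 → M) (j : ZMod 13) :
    ∑ i ∈ planarLine j, z i = ∑ i ∈ planarSet, z (i + j) := by
  refine Finset.sum_nbij' (fun i => i - j) (fun i => i + j) ?_ ?_ ?_ ?_ ?_
  · intro i hi; exact mem_planarLine.1 hi
  · intro i hi; rw [mem_planarLine]; simpa using hi
  · simp
  · simp
  · simp

section CharFive

variable {k : Type*} [CommRing k] [CharP k 5]

lemma five_eq_zero : ((5 : ℤ) : k) = 0 := by
  have := CharP.cast_eq_zero k 5
  exact_mod_cast this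

lemma polyVal_powFive {t : k} (ht : t ^ 13 = polyVal t psl33Red) (a : List ℤ)
    (ha : a.length = 13) : polyVal t (powFive a) = polyVal t a ^ 5 := by
  have h : ∀ a b : List ℤ, b.length = 13 →
      polyVal t (mulMod 5 psl33Red a b) = polyVal t a * polyVal t b := fun a b hb =>
    polyVal_mulMod five_eq_zero psl33Red_ne_nil ht a b hb
  rw [powFive, h _ _ (length_mulMod ..), h _ _ (length_mulMod ..), h _ _ ha]
  ring

lemma pow_five_pow {t : k} (ht : t ^ 13 = polyVal t psl33Red) (n : ℕ) :
    t ^ 5 ^ n = polyVal t (frobRows.getD ((Fin.ofNat 13 n : Fin 13) : ℕ) []) := by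
  induction n with
  | zero => simp [frobRows, polyVal]
  | succ n ih =>
    rw [pow_succ, pow_mul, ih, ← polyVal_powFive ht _ (length_frobRows _), powFive_frobRows]
    congr 3
    simp [Fin.ext_iff, Fin.val_add]

lemma pow_five_pow_thirteen {t : k} (ht : t ^ 13 = polyVal t psl33Red) : t ^ 5 ^ 13 = t := by
  rw [pow_five_pow ht]
  simp [frobRows, polyVal]

lemma polyVal_pow_five_pow (x : k) (l : List ℤ) (n : ℕ) :
    polyVal (x ^ 5 ^ n) l = polyVal x l ^ 5 ^ n := by
  have : Fact (Nat.Prime 5) := ⟨by norm_num⟩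
  have := map_polyVal (iterateFrobenius k 5 n) x l
  simpa only [iterateFrobenius_def] using this.symm

variable [IsDomain k]

/-- A fixed point of Frobenius is one of 0, 1, 2, 3, 4, and f takes a value prime to 5 at each of
them. -/
lemma pow_five_ne {t : k} (ht : t ^ 13 = polyVal t psl33Red) : t ^ 5 ≠ t := by
  intro h
  have h5 : (5 : k) = 0 := by exact_mod_cast five_eq_zero (k := k)
  have hz : ∀ n : ℤ, ¬ (5 : ℤ) ∣ n → (n : k) ≠ 0 := fun n hn h0 =>
    hn ((CharP.intCast_eq_zero_iff k 5 n).1 h0)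
  have hprod : t * (t - 1) * (t - 2) * (t - 3) * (t - 4) = 0 := by
    linear_combination h + (-2 * t ^ 4 + 7 * t ^ 3 - 10 * t ^ 2 + 5 * t) * h5
  have hval : ∀ a : ℤ, t = a → ((a ^ 13 - polyVal a psl33Red : ℤ) : k) = 0 := by
    intro a ha
    have := map_polyVal (Int.castRingHom k) a psl33Red
    simp only [eq_intCast] at this
    rw [Int.cast_sub, this, Int.cast_pow, ← ha, ht, sub_self]
  simp only [mul_eq_zero, sub_eq_zero] at hprod
  rcases hprod with (((h | h) | h) | h) | h
  · exact hz _ (by decide) (hval 0 (by simpa using h))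
  · exact hz _ (by decide) (hval 1 (by simpa using h))
  · exact hz _ (by decide) (hval 2 (by simpa using h))
  · exact hz _ (by decide) (hval 3 (by simpa using h))
  · exact hz _ (by decide) (hval 4 (by simpa using h))

/-- The period of t under Frobenius divides the prime 13 and is not 1. -/
lemma injective_pow_five_pow {t : k} (ht : t ^ 13 = polyVal t psl33Red) :
    Function.Injective fun i : Fin 13 => t ^ 5 ^ (i : ℕ) := by
  have hit : ∀ n, (fun x : k => x ^ 5)^[n] t = t ^ 5 ^ n := fun n => by
    induction n with
    | zero => simp
    | succ n ih => rw [Function.iterate_succ_apply', ih, ← pow_mul, ← pow_succ]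
  have hper : Function.minimalPeriod (fun x : k => x ^ 5) t = 13 := by
    have : Fact (Nat.Prime 13) := ⟨by norm_num⟩
    refine Function.minimalPeriod_eq_prime_iff.2 ⟨?_, ?_⟩
    · exact (hit 13).trans (pow_five_pow_thirteen ht)
    · exact pow_five_ne ht
  intro i j hij
  simp only [← hit] at hij
  have := Function.iterate_injOn_Iio_minimalPeriod (f := fun x : k => x ^ 5) (x := t)
    (by rw [hper]; exact i.2) (by rw [hper]; exact j.2) hij
  exact Fin.ext this

/-- The powers `t ^ 5 ^ i` are linearly independent modulo `5`. -/
lemma five_dvd_of_sum_eq_zero {t : k} (ht : t ^ 13 = polyVal t psl33Red) (c : Fin 13 → ℤ)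
    (hc : ∑ i, (c i : k) * t ^ 5 ^ (i : ℕ) = 0) (i : Fin 13) : (5 : ℤ) ∣ c i := by
  have hrow : ∀ i : Fin 13, t ^ 5 ^ (i : ℕ) = ∑ j : Fin 13,
      ((rowsMatrix frobRows i j : ℤ) : k) * t ^ (12 - (j : ℕ)) := fun i => by
    rw [pow_five_pow ht, polyVal_eq_rowSum _ _ (length_frobRows _)]
    simp [rowsMatrix]
  -- The relation is rewritten as a polynomial of degree at most 12 in t, with coefficients d.
  let d : Fin 13 → ℤ := fun j => ∑ i, c i * rowsMatrix frobRows i j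
  have hd : ∑ j : Fin 13, (d j : k) * t ^ (12 - (j : ℕ)) = 0 := by
    rw [← hc]
    simp_rw [hrow, d, Int.cast_sum, Finset.mul_sum, Finset.sum_mul, Int.cast_mul]
    rw [Finset.sum_comm]
    exact Finset.sum_congr rfl fun _ _ => Finset.sum_congr rfl fun _ _ => by ring
  have hV : ∀ j : Fin 13, (d j : k) = 0 := by
    -- Powers of Frobenius show that this polynomial vanishes at 13 distinct conjugates of t, so the
    -- Vandermonde determinant kills its coefficients.
    have hvec : (revVandermonde fun i : Fin 13 => t ^ 5 ^ (i : ℕ)).mulVec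
        (fun j => (d j : k)) = 0 := by
      ext m
      have : Fact (Nat.Prime 5) := ⟨by norm_num⟩
      have h := congrArg (iterateFrobenius k 5 m) hd
      rw [map_zero, map_sum] at h
      rw [Pi.zero_apply, ← h, Matrix.mulVec, dotProduct]
      refine Finset.sum_congr rfl fun j _ => ?_
      rw [map_mul, map_intCast, map_pow, iterateFrobenius_def, revVandermonde, Matrix.of_apply,
        mul_comm]
    have hdet : (revVandermonde fun i : Fin 13 => t ^ 5 ^ (i : ℕ)).det ≠ 0 := by
      rw [det_revVandermonde]
      refine Finset.prod_ne_zero_iff.2 fun i _ => Finset.prod_ne_zero_iff.2 fun j hj => ?_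
      exact sub_ne_zero.2 fun h => (Finset.mem_Ioi.1 hj).ne (injective_pow_five_pow ht h)
    exact congrFun (Matrix.eq_zero_of_mulVec_eq_zero hdet hvec)
  have h5 : ∀ j, (5 : ℤ) ∣ d j := fun j => (CharP.intCast_eq_zero_iff k 5 _).1 (hV j)
  -- `frobInv` recovers c from d modulo 5.
  have hsum : (5 : ℤ) ∣ ∑ l, c l * (rowsMatrix frobRows * rowsMatrix frobInv) l i := by
    have : ∑ l, c l * (rowsMatrix frobRows * rowsMatrix frobInv) l i =
        ∑ j, d j * rowsMatrix frobInv j i := by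
      simp_rw [Matrix.mul_apply, d, Finset.mul_sum, Finset.sum_mul]
      rw [Finset.sum_comm]
      exact Finset.sum_congr rfl fun _ _ => Finset.sum_congr rfl fun _ _ => by ring
    rw [this]
    exact Finset.dvd_sum fun j _ => (h5 j).mul_right _
  have hci : (5 : ℤ) ∣ ∑ l, c l * (rowsMatrix frobRows * rowsMatrix frobInv) l i - c i := by
    have : ∑ l, c l * (rowsMatrix frobRows * rowsMatrix frobInv) l i - c i =
        ∑ l, c l * ((rowsMatrix frobRows * rowsMatrix frobInv) l i - if l = i then 1 else 0) := by
      simp [mul_sub, Finset.sum_sub_distrib]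
    rw [this]
    refine Finset.dvd_sum fun l _ => Dvd.dvd.mul_left ?_ _
    refine Int.dvd_of_emod_eq_zero ?_
    rw [Int.sub_emod, frobRows_mul_frobInv]
    split_ifs <;> rfl
  simpa using dvd_sub hsum hci

/-- The sums of distinct sets of conjugates are distinct. -/
lemma injective_sum_pow_five_pow {t : k} (ht : t ^ 13 = polyVal t psl33Red) :
    Function.Injective fun S : Finset (ZMod 13) => ∑ i ∈ S, t ^ 5 ^ i.val := by
  intro S S' h
  let c : ZMod 13 → ℤ := fun i => (if i ∈ S then 1 else 0) - if i ∈ S' then 1 else 0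
  have hsum : ∑ i : ZMod 13, (c i : k) * t ^ 5 ^ i.val = 0 := by
    have e : ∀ T : Finset (ZMod 13), ∑ i ∈ T, t ^ 5 ^ i.val =
        ∑ i : ZMod 13, (if i ∈ T then 1 else 0) * t ^ 5 ^ i.val := fun T => by simp
    simp only [e] at h
    simp only [c, Int.cast_sub, Int.cast_ite, Int.cast_one, Int.cast_zero, sub_mul,
      Finset.sum_sub_distrib]
    exact sub_eq_zero.2 h
  have hc : ∀ i, (5 : ℤ) ∣ c i := five_dvd_of_sum_eq_zero ht c hsum
  ext i
  -- Each coefficient is -1, 0 or 1, so divisibility by 5 makes it 0.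
  have := hc i
  by_cases h1 : i ∈ S <;> by_cases h2 : i ∈ S' <;> simp [c, h1, h2] at this ⊢

/-- The roots modulo `5` of the polynomial of the lines. -/
lemma exists_planarLine_of_root {t : k} (ht : t ^ 13 = polyVal t psl33Red) {y : k}
    (hy : y ^ 13 = polyVal y lineRed) : ∃ j, y = ∑ i ∈ planarLine j, t ^ 5 ^ i.val := by
  have : Fact (Nat.Prime 5) := ⟨by norm_num⟩
  have hs : polyVal t lineSumRow = ∑ i ∈ planarSet, t ^ 5 ^ i.val := by
    have e : ∀ i : ZMod 13, t ^ 5 ^ i.val = ∑ j : Fin 13,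
        (((frobRows.getD i.val []).getD j 0 : ℤ) : k) * t ^ (12 - (j : ℕ)) := fun i => by
      rw [pow_five_pow ht, polyVal_eq_rowSum _ _ (length_frobRows _)]
      simp [Nat.mod_eq_of_lt i.val_lt]
    simp_rw [e]
    rw [Finset.sum_comm, polyVal_eq_rowSum _ _ rfl]
    refine Finset.sum_congr rfl fun j _ => ?_
    rw [← Finset.sum_mul]
    congr 1
    have := (CharP.intCast_eq_zero_iff k 5 _).2 (Int.dvd_of_emod_eq_zero (lineSumRow_eq j))
    rw [Int.cast_sub, sub_eq_zero] at this
    rw [this, Int.cast_sum]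
  have hroot : polyVal t lineSumRow ^ 13 = polyVal (polyVal t lineSumRow) lineRed := by
    have h := polyVal_compMod five_eq_zero psl33Red_ne_nil ht lineSumRow
      (1 :: lineRed.map fun c => -c) rfl
    rw [polyVal_eq_zero_of_dvd (five_eq_zero) _ _ (fun m hm =>
      Int.dvd_of_emod_eq_zero (compMod_lineSumRow ⟨m, by rwa [length_compMod] at hm⟩))] at h
    rw [polyVal, polyVal_map_neg, Int.cast_one, one_mul, List.length_map, ← sub_eq_add_neg] at h
    exact (sub_eq_zero.1 h.symm)
  have hline : ∀ j : ZMod 13, polyVal t lineSumRow ^ 5 ^ j.val =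
      ∑ i ∈ planarLine j, t ^ 5 ^ i.val := by
    intro j
    rw [hs, sum_pow_char_pow, sum_planarLine]
    refine Finset.sum_congr rfl fun i _ => ?_
    rw [← pow_mul, ← pow_add, pow_five_pow ht, pow_five_pow ht]
    congr 3
    simp [ZMod.val_add, Fin.ext_iff]
  -- The Frobenius conjugates of one line sum are the 13 line sums. They are distinct roots of g,
  -- which has degree 13, so there are no others.
  obtain ⟨j, hj⟩ := exists_eq_of_pow_eq_polyVal (l := lineRed) rfl
    (r := fun j : Fin 13 => polyVal t lineSumRow ^ 5 ^ (j : ℕ)) (fun j j' h => by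
      exact planarLine_injective (injective_sum_pow_five_pow ht
        ((hline j).symm.trans (h.trans (hline j')))))
    (fun j => by rw [polyVal_pow_five_pow, ← hroot, ← pow_mul, ← pow_mul, mul_comm]) hy
  exact ⟨j, hj.trans (hline j)⟩

end CharFive

/-! ### A quartic factor of f over the field of a line sum. -/

/-- The denominator of the factorization of `psl33Poly` over the field generated by the sum of
the roots on a line. -/
def lineDen : ℤ :=
  7223996082226142082592078329047841560319462088810853604141573608253700262966916907968

/-- The coefficients of the factor of `lineDen * psl33Poly` with roots on a line, in terms of the
sum of these roots. -/
def lineFactor : List (List ℤ) :=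
  [[0, 0, 0, 0, 0, 0, 0, 0, 0, 0, 0, 0, lineDen],
    [0, 0, 0, 0, 0, 0, 0, 0, 0, 0, 0, -lineDen, 0],
    [-75112321325090454873758018618328165145576485319335915951521257693871990,
    2843838702226379708833363902288632209012203670940587077212500363715457310,
    969242720049815489281667193296844003605302603370403429129443101168170086710,
    169271100149265043155348676508836010449869022822050333570485326238613867038788,
    9290961869200099045956394626862814152220085328506682209197840464515182703044788,
    -47641597343054221133722764334309678868637973051630096924582778899799848202802608,
    -21825845145146363572687728877949096666936800400349494923148766523083955275397820876,
    -628288160445976840738943399219215912111040796753086537572841092068252527457633136520,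
    1789514737799651223436618063732591965341427744143608028779859878794980026055183457940,
    386537720961571532864085593205772967876747701450580786385526144171430292015785045618820,
    7018615168099962375600149042160164066092912123017922704568818727205419990984870998056454,
    44750989901287851125440981407205836803809267410869300294775428462647237813357647299824710,
    30596823581956273013571191633998576299486353901257479456591208844515023131395400024866706],
    [-960443070630517430991723488459136726794153198149407606883611447220683841,
    32517475998973687564860785437694652912817517689967748257731296564594032213,
    12584803153405086504441249214406128625536603644078977129995867329139582010465,
    2212550877699923567517240433603960127847003095351334156305116289986553478304046,
    126841188046835106749907793560496249644223613288222320130289272835637119829484630,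
    -237366987184473580184439951049722885577867844033147331069687080520961182412748224,
    -287369337008844128942547386948380019321630711796111297178676571750593141961384200602,
    -9095463924464353485732148318689400352357189132752930083303058616933287508833492205860,
    5938782565722328906004222832970706390520984454527554205545631874816859625413541115430,
    5399689631714533153101353947272978724242966438877511973463209787505275930358303850683022,
    104539101088174315243436403960522919508117102425726740500939694197592581503343065520083521,
    667146083286508242262853232753020196173476572569253169669035341972353689938249327610154137,
    -417043371403290955530794109035233497242159233108690275726024570093226874429311850423732589],
    [-378449208314822843052510074970600332334161129036749300325132353779238808,
    89388068232335964819081851410962325289954912212225026562451129277683449984,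
    391973087980801289013397439010123989522495996624243116000181818409034142792,
    -14498948491337469178108980315478051463517018771209634648006123539014794113288,
    -103166551973073497872437632488441361174148545085439521146312186556749387040734408,
    -6276202390611162080162729676281204276375855313473632078776534873381426408451937720,
    62629666999790669784827348986120886294373846094418706730941589403163038119232174728,
    14171427637511548044639658622645586124974619008745312998604113612377945554254287411704,
    247431051632604867198128276493656623248744169039005518114620939230540408282573942873880,
    -3734958722060508196067878704849209355663327148293588729367531063420581916618993934964072,
    -173539053744166599385080798943936487654233125425457592263852735488289936026601814411983360,
    -2290579650790573587069825235340686588478258988690645685837026873798905527234499029843745304,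
    -14617580075032800041842264984762539488128636218468570439837987739696788571343841522137073008]]

/-- The coefficients of the factor of `lineDen * psl33Poly` with roots off a line, in terms of the
sum of the roots on that line. -/
def lineCofactor : List (List ℤ) :=
  [[0, 0, 0, 0, 0, 0, 0, 0, 0, 0, 0, 0, lineDen],
    [0, 0, 0, 0, 0, 0, 0, 0, 0, 0, 0,
    7223996082226142082592078329047841560319462088810853604141573608253700262966916907968,
    -43343976493356852495552469974287049361916772532865121624849441649522201577801501447808],
    [75112321325090454873758018618328165145576485319335915951521257693871990,
    -2843838702226379708833363902288632209012203670940587077212500363715457310,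
    -969242720049815489281667193296844003605302603370403429129443101168170086710,
    -169271100149265043155348676508836010449869022822050333570485326238613867038788,
    -9290961869200099045956394626862814152220085328506682209197840464515182703044788,
    47641597343054221133722764334309678868637973051630096924582778899799848202802608,
    21825845145146363572687728877949096666936800400349494923148766523083955275397820876,
    628288160445976840738943399219215912111040796753086537572841092068252527457633136520,
    -1789514737799651223436618063732591965341427744143608028779859878794980026055183457940,
    -386537720961571532864085593205772967876747701450580786385526144171430292015785045618820,
    -7011391172017736233517556963831116224532592660929111850964677153597166290721904081148486,
    -44794333877781207977936533877180123853171184183402165416400277904296760014935448801272518,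
    -63408213787427410352704411404533872666457350708636376526602236173203329725791136620857362],
    [-1572516838168442881977167534148344755116041760319658077577496457067607199,
    60572574053679611838995070725910522335011833859458181766457634631005310027,
    20243145372959493548330208230898352094555020095568509322859056192477864692479,
    3530196821447277783872932579569942025363502161606929591306389259546508812053906,
    192349151200054423554290608967230374773928002515695126016511658620159897482561514,
    -1099052487798023832862543351185667474966455069359622186386488629044644370621572672,
    -454157830169355834578900038246123635900671404201406355536495514762167087963630565094,
    -12844524470346109601388629796503702356306339009402874399585431304195891083996105299100,
    41026449879330947322316361199118041658897048226382586647890026380638051970600199150490,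
    7899403603108389153445447416829741714721851925620999686010278160564677986184822816676338,
    143160847122805884851311121574439285068356910169876433861216192000158260335581997858797215,
    933865358287017753178158970776952314656522558036086334883516681019376776577815960805999175,
    237806784942930920985489832651937898354339197171131552994737727315455331097642296147841165],
    [-94832644156041202570229461489138796963862948000957670499491981772841227258,
    3346914182000223963460623160826905990498624205276138284534647013133714158666,
    1238377261292161245652252725338289730029887504119846094865310973311458780114730,
    216559438731696348492033494402280360848630642401651212474395583420911599088391316,
    12213251838952179636241105747969712214254159698932670708658744050954485066952785988,
    -41163201237055219423030995622881355285275932119035251646778435577664767398436969528,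
    -28195812827307992145023694364640305253285138333313215888759833091088089717911644229100,
    -851716983936117701534723363645743401171967755931104440433829351264175208972780534940208,
    1615691951558513076963690657763291108499216680389105662497958889029274221039224285933540,
    514240537707975383222067267620607414515689965519225567283608552785265634178262185228017428,
    9538263035104065722807756986878106125371105564455214533146714403649169520386951724977778338,
    60172733415527346493287537192184985624294237453551949025790543841348059558802546692675903866,
    87074665894463612209867635382300259578977115901505003071661988653032818345513017394898548278],
    [-5170501788919739701828266802251558282637375681411702039594494407690398756055,
    189460882102512436226065148225361107803400844849347153623506882640530699144307,
    67039339130432165726862796981233995154850108009751540649379952499031131757649815,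
    11730442538244011928911329715416306984257805395904797597667007293207712098196013682,
    652673036696621547649681262990009708739559716581854357321958499360758465852161033930,
    -2681998147307616599025436876693078041712471777683256925139975947470388688755504721296,
    -1516312657424020686921289231215893986114418390410294645291043171539836650996625376837574,
    -44975026892639447400963267009152182866679664002838689282897742488902378212306199813863276,
    96292550482546221150612393772505180419753325237952106027819503294581330128904673011232442,
    27357777826577817842956520835395212164258799218644959525746021064632992472447692700891270738,
    506652499706619257191775061918140838969956357424970055196937470015597118288225830484500936711,
    3244786299271743626321541202558860948144629201084102573813819487632146536994696895545009890495,
    4404038351324396209663886529788318321729244512293291420295618911527962663206290883557286137957],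
    [173087659456328415520756145846476865277410468536187467850125004782374139418847,
    -6498434843847588378150064647573334571362351879190406450375036304455393008859339,
    -2239663445819496402710009321398802936449287470854558205590141775861156979111074559,
    -390461116639680441645375117759372932410095758681427220766073043817324286042717456594,
    -21491440272621887524177586094514477520871458107205325009259667666672515556833982531274,
    110410049892487884476507059882492959088733116594515787795526367095252943567296923737120,
    50531130666310984466703891712395015152481409110748432753364358216511003779480175604985222,
    1450670789522152977889495359967912990633285590093703876143442239670680163428318735546815964,
    -4375816269447288399667687633746360503665795546757097699034462393503488641940623741776544410,
    -890497644336006848437322779801381681772222459049672786645900246149024471453564773713662345106,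
    -16089665009116500646369044960859794942664441125118754545605484924929911101852793782320516098175,
    -103150670259782590606975375628116905481985429727333911358745051624285707038313729185396372390631,
    -96579888148832951163686221047292012811336490712686935306439759594341571339178016602952427949005],
    [3636723763296263871982381520951651534639863368240189665830829810451776734995377,
    -104126495020981630659976932992772333242936555622778656892240307844258342131508181,
    -48854096091727720415635095956938260636348591381919409038739022380554462551313476145,
    -8593843397695183830933717180076000209418861759039416776828101946019500262072780466750,
    -517512640692943092038591684579300682863042674149160769009246153297801820939473534383558,
    -494470149180476641079853785110647479803794290952769887500948868319356766671133248641584,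
    1137856968975028280963083577460857363991958272336554495447496228651701858550842846182375178,
    38752738427464340381487064815675474850743702390898637757687814015240629895566005704956738836,
    23736620443765224086915398635691050017246996455288281194112924167480335759503498261732082250,
    -22188219415271232224955123670079016024162292620975972495766635871733898027803145757858512178302,
    -445715441404577779780376128849040072248745934927181766952624242072832962600431126214152752008097,
    -2958421434621334330970642788190230031011684105522441785484502159281464752988263063957783390058153,
    -4345741867111301723881269470627876427505347154685230552413431613487665555722812867149652029038355],
    [-49048930990466361188136440648335738057335689219521744443060752532014961482476132,
    2089060527596123578643399366703441152659678118609575522043903185771386787720865108,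
    623559962370844697345528651299582798913344197072162730275303784217891182942985711876,
    107456630296423634032389046758577628509043516163946568968501214947408717229597456261048,
    5560084720073576349620813693613246977861329278538093216670782296133552745382064795579544,
    -57396771786766271297236696652513048742290193971348541682206114816817308243528358308234208,
    -13843444635831546446942581757194329380378817828441111173591231943583078659052334562670317640,
    -338555582454379083245457934338388137402441111266999228547520011136241262269910739652712820624,
    2547062595348878168966786866184301572782460463836209867240456386164214644055073201816961762456,
    222720069344873475660080251650457175064753222392817004643481035372523142918916985936082483512312,
    3490781378814433099146490818262508417068928824826953860289472304890821850189200056624653410928388,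
    21333261210248117023420298232951866928382530292258235036603764253991928185669313216230535561026180,
    25597474966389079677589613341958666049099880641420459890231077068130638671174267775020111854372812],
    [-707381641335342376839128712393599089161559707045352554546372708708442317292772589,
    24800565454277251142610896275221207750547905593902744132150311604208060574430017849,
    9301447215047901779272583481614529140237412025896795920859272980532455667682419822781,
    1613202854777850401745708161743740549548902970146823305380676263525510789480848971916286,
    90870204352982728944308157528659345565037602948849062014011888587715960073398948352715910,
    -393390300918199028595998114545116651697902950248085635124833939531148274460132914953350872,
    -213549859670432049733166849197115502112065808952892814215822016353387952372611498088962314106,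
    -6229857445036645990392029777453192091757121647544471372545080586614185721420142254861978680220,
    20881567080547024955027537716156818663451804952447663956554902035740929129878114541916952573110,
    3841185917728200855799969246271679257188451295748473405374129243551450253623491806059950951656766,
    66965153603381065396759435542006944598115744555282791244990471696643565031798095547953993088190901,
    395349512589934638186288243914201923174633812109547354715310245463051850837100909285387831511433877,
    415398138057076555992990948413994850398480072914205752500513038803259150343964175729339231738359871]]

/-- The row `j` of `lineCofactor`, or zero. -/
def lineCofactorRow (j : ℕ) : List ℤ := lineCofactor.getD j ((List.range 13).map fun _ => 0)

/-- The coefficients of the product of `lineFactor` and `lineCofactor`. -/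
def lineProduct (k : ℕ) : List ℤ :=
  (List.range 5).foldr (fun i acc => if i ≤ k then List.zipWith (· + ·)
    (mulMod 0 lineRed (lineFactor.getD i []) (lineCofactorRow (k - i))) acc else acc)
    ((List.range 13).map fun _ => 0)

-- This certifies the factorization of `lineDen` ^ 2 · f over ℤ[y]/(g), one coefficient at a time;
-- rows beyond the end of `lineCofactor` count as 0 in the convolution.
set_option maxRecDepth 10000 in
lemma lineProduct_eq : ∀ k : Fin 14, lineProduct k = (List.range 13).map fun j =>
    if j + 1 = 13 then lineDen ^ 2 * (1 :: psl33Red.map fun c => -c).getD k 0 else 0 := by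
  decide +kernel

lemma length_lineCofactorRow (j : ℕ) : (lineCofactorRow j).length = 13 := by
  unfold lineCofactorRow
  by_cases hj : j < 10
  · have : ∀ j : Fin 10, (lineCofactor.getD j ((List.range 13).map fun _ => 0)).length = 13 := by
      decide +kernel
    exact this ⟨j, hj⟩
  · rw [List.getD_eq_default _ _ (by
      have : lineCofactor.length = 10 := rfl
      omega)]
    simp

lemma lineDen_ne_zero : lineDen ≠ 0 := by unfold lineDen; norm_num

section

variable {R : Type*} [CommRing R]

lemma polyVal_foldr_add {α : Type*} (y : R) (p : α → Prop) [DecidablePred p] (f : α → List ℤ)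
    (n : ℕ) (hf : ∀ a, (f a).length = n) (acc : List ℤ) (hacc : acc.length = n) (L : List α) :
    (L.foldr (fun a acc => if p a then List.zipWith (· + ·) (f a) acc else acc) acc).length = n ∧
    polyVal y (L.foldr (fun a acc => if p a then List.zipWith (· + ·) (f a) acc else acc) acc) =
      (L.map fun a => if p a then polyVal y (f a) else 0).sum + polyVal y acc := by
  induction L with
  | nil => simp [hacc]
  | cons a L ih =>
    rw [List.foldr_cons, List.map_cons, List.sum_cons]
    split_ifs
    · refine ⟨by rw [List.length_zipWith, ih.1, hf, min_self], ?_⟩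
      rw [polyVal_zipWith_add _ _ _ (by rw [ih.1, hf]), ih.2, add_assoc]
    · exact ⟨ih.1, by rw [ih.2, zero_add]⟩

lemma polyVal_lineProduct {y : R} (hy : y ^ 13 = polyVal y lineRed) (k : ℕ) :
    polyVal y (lineProduct k) = ∑ i ∈ Finset.range 5, if i ≤ k then
      polyVal y (lineFactor.getD i []) * polyVal y (lineCofactorRow (k - i)) else 0 := by
  rw [lineProduct, (polyVal_foldr_add y _ _ 13 (fun i => length_mulMod ..) _ (by simp) _).2,
    polyVal_map_zero, add_zero]
  change _ = ((List.range 5).map fun i => if i ≤ k then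
    polyVal y (lineFactor.getD i []) * polyVal y (lineCofactorRow (k - i)) else 0).sum
  congr 1
  refine List.map_congr_left fun i _ => ?_
  rw [polyVal_mulMod (by simp) (by simp [lineRed]) hy _ _ (length_lineCofactorRow _)]

lemma sum_range_mul_sum_range (a b : ℕ → R) (hb : ∀ j, 10 ≤ j → b j = 0) (x : R) :
    (∑ i ∈ Finset.range 5, a i * x ^ (4 - i)) * (∑ j ∈ Finset.range 10, b j * x ^ (9 - j)) =
      ∑ k ∈ Finset.range 14,
        (∑ i ∈ Finset.range 5, if i ≤ k then a i * b (k - i) else 0) * x ^ (13 - k) := by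
  simp [Finset.sum_range_succ, hb]
  ring

/-- The factorization of `psl33Poly` given by a line. -/
lemma lineFactor_mul_lineCofactor {y : R} (hy : y ^ 13 = polyVal y lineRed) (x : R) :
    (∑ i ∈ Finset.range 5, polyVal y (lineFactor.getD i []) * x ^ (4 - i)) *
      (∑ j ∈ Finset.range 10, polyVal y (lineCofactorRow j) * x ^ (9 - j)) =
    (lineDen : R) ^ 2 * (x ^ 13 - polyVal x psl33Red) := by
  have h : ∀ k : Fin 14, ∑ i ∈ Finset.range 5, (if i ≤ (k : ℕ) then
      polyVal y (lineFactor.getD i []) * polyVal y (lineCofactorRow (k - i)) else 0) =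
      (lineDen : R) ^ 2 * ((1 :: psl33Red.map fun c => -c).getD k 0 : ℤ) := fun k => by
    rw [← polyVal_lineProduct hy, lineProduct_eq, polyVal_const _ _ (by norm_num)]
    push_cast
    rfl
  have hb : ∀ j, 10 ≤ j → polyVal y (lineCofactorRow j) = 0 := fun j hj => by
    rw [lineCofactorRow, List.getD_eq_default _ _ hj, polyVal_map_zero]
  have hf : x ^ 13 - polyVal x psl33Red = ∑ k : Fin 14,
      (((1 :: psl33Red.map fun c => -c).getD k 0 : ℤ) : R) * x ^ (13 - (k : ℕ)) := by
    rw [← polyVal_eq_sum_of_length x (1 :: psl33Red.map fun c => -c) (n := 13) rfl, polyVal,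
      polyVal_map_neg, List.length_map, length_psl33Red]
    push_cast
    ring
  rw [sum_range_mul_sum_range _ _ hb, Finset.sum_range, hf, Finset.mul_sum]
  exact Finset.sum_congr rfl fun k _ => by rw [h, mul_assoc]

end

/-- A root of the polynomial of the lines is a sum of roots of `psl33Poly`. -/
lemma exists_eq_sum_of_lineRoot {E : Type*} [Field E] [CharZero E] {r : Fin 13 → E}
    (hr : Function.Injective r) (hroot : ∀ i, r i ^ 13 = polyVal (r i) psl33Red) {y : E}
    (hy : y ^ 13 = polyVal y lineRed) : ∃ S : Finset (Fin 13), y = ∑ i ∈ S, r i := by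
  classical
  have hd : (lineDen : E) ≠ 0 := by exact_mod_cast lineDen_ne_zero
  have hC : ∀ l, polyVal (C y) l = C (polyVal y l) := fun l => (map_polyVal C y l).symm
  have hmul := lineFactor_mul_lineCofactor (y := C y) (by rw [hC, ← hy, C_pow]) (X : E[X])
  rw [X_pow_sub_polyVal_eq_nodal rfl hr hroot] at hmul
  have hne : (lineDen : E[X]) ^ 2 * Lagrange.nodal Finset.univ r ≠ 0 :=
    mul_ne_zero (pow_ne_zero 2 (by exact_mod_cast lineDen_ne_zero)) Lagrange.nodal_ne_zero
  have hroots : ((lineDen : E[X]) ^ 2 * Lagrange.nodal Finset.univ r).roots =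
      Finset.univ.val.map r := by
    have : (lineDen : E[X]) ^ 2 = C ((lineDen : E) ^ 2) := by simp
    rw [this, roots_C_mul _ (pow_ne_zero 2 hd), Lagrange.nodal,
      Finset.prod_eq_multiset_prod]
    have h := Multiset.map_map (fun a : E => X - C a) r Finset.univ.val
    rw [Function.comp_def] at h
    rw [← h, roots_multiset_prod_X_sub_C]
  have hsplits : ((lineDen : E[X]) ^ 2 * Lagrange.nodal Finset.univ r).Splits := by
    have : (lineDen : E[X]) ^ 2 = C ((lineDen : E) ^ 2) := by simp
    rw [this]
    exact (Splits.prod fun i _ => Splits.X_sub_C (r i)).C_mul _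
  have hval : ∑ i ∈ Finset.range 5, polyVal (C y) (lineFactor.getD i []) * X ^ (4 - i) =
      C (lineDen : E) * X ^ 4 + C (-(lineDen * y)) * X ^ 3 +
        C (polyVal y (lineFactor.getD 2 [])) * X ^ 2 +
        C (polyVal y (lineFactor.getD 3 [])) * X +
        C (polyVal y (lineFactor.getD 4 [])) := by
    have h0 : polyVal y (lineFactor.getD 0 []) = (lineDen : E) := by
      simp [lineFactor, polyVal]
    have h1 : polyVal y (lineFactor.getD 1 []) = -((lineDen : E) * y) := by
      simp [lineFactor, polyVal]
    simp only [Finset.sum_range_succ, Finset.range_zero, Finset.sum_empty, zero_add, hC, h0, h1]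
    norm_num
  rw [hval] at hmul
  generalize ha₁ : -((lineDen : E) * y) = a₁ at hmul
  generalize polyVal y (lineFactor.getD 2 []) = a₂ at hmul
  generalize polyVal y (lineFactor.getD 3 []) = a₃ at hmul
  generalize polyVal y (lineFactor.getD 4 []) = a₄ at hmul
  set A : E[X] := C (lineDen : E) * X ^ 4 + C a₁ * X ^ 3 + C a₂ * X ^ 2 +
    C a₃ * X + C a₄ with hA
  have hdvd : A ∣ (lineDen : E[X]) ^ 2 * Lagrange.nodal Finset.univ r := ⟨_, hmul.symm⟩
  have hAs := hsplits.of_dvd hne hdvd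
  have hle := Polynomial.roots.le_of_dvd hne hdvd
  rw [hroots] at hle
  -- By Vieta the sum of the roots of the quartic is y. The quartic divides a polynomial with the
  -- simple roots r i, so its roots are a subset of them.
  have hnext := hAs.nextCoeff_eq_neg_sum_roots_mul_leadingCoeff
  have hdeg : A.natDegree = 4 := by
    rw [hA]; compute_degree!
  have hlead : A.leadingCoeff = lineDen := by
    rw [leadingCoeff, hdeg, hA]
    simp [coeff_X_pow]
  have hA3 : A.nextCoeff = a₁ := by
    rw [nextCoeff_of_natDegree_pos (by omega), hdeg, hA]
    simp [coeff_X_pow]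
  rw [hlead, hA3, ← ha₁, neg_mul, neg_inj] at hnext
  have hnodup : (Finset.univ.val.map r).Nodup := Finset.univ.nodup.map hr
  have hrootsA : A.roots = (Finset.univ.filter fun i => r i ∈ A.roots).val.map r := by
    refine (Multiset.Nodup.ext (Multiset.nodup_of_le hle hnodup)
      ((Finset.nodup _).map hr)).2 fun a => ⟨fun ha => ?_, fun ha => ?_⟩
    · obtain ⟨i, -, rfl⟩ := Multiset.mem_map.1 (Multiset.mem_of_le hle ha)
      exact Multiset.mem_map.2 ⟨i, by simpa using ha, rfl⟩
    · obtain ⟨i, hi, rfl⟩ := Multiset.mem_map.1 ha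
      exact (Finset.mem_filter.1 (show i ∈ Finset.univ.filter _ from hi)).2
  refine ⟨Finset.univ.filter fun i => r i ∈ A.roots, ?_⟩
  rw [mul_left_cancel₀ hd hnext, Finset.sum_eq_multiset_sum]
  exact congrArg Multiset.sum hrootsA

/-! ### Frobenius elements and the Galois action on the plane. -/

/-- Frobenius elements at an unspecified prime over `q`. -/
lemma exists_frobenius (N : Type*) [Field N] [NumberField N] [IsGalois ℚ N] {q : ℕ}
    (hq : q.Prime) : ∃ P : Ideal (𝓞 N), P.IsMaximal ∧ (q : 𝓞 N) ∈ P ∧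
      ∃ σ : Gal(N/ℚ), ∀ x : 𝓞 N, Ideal.Quotient.mk P (σ • x) = Ideal.Quotient.mk P x ^ q := by
  have hp : Prime (q : ℤ) := Nat.prime_iff_prime_int.1 hq
  have hmax : (Ideal.span {(q : ℤ)}).IsMaximal :=
    PrincipalIdealRing.isMaximal_of_irreducible hp.irreducible
  obtain ⟨P, hP, hover⟩ := Ideal.exists_maximal_ideal_liesOver_of_isIntegral (S := 𝓞 N)
    (Ideal.span {(q : ℤ)})
  have : Finite (𝓞 N ⧸ P) :=
    Ideal.finiteQuotientOfFreeOfNeBot P (Ideal.IsMaximal.ne_bot_of_isIntegral_int P)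
  obtain ⟨σ, hσ⟩ := IsArithFrobAt.exists_of_isInvariant ℤ Gal(N/ℚ) P
  refine ⟨P, hP, ?_, σ, fun x => ?_⟩
  · have : (q : ℤ) ∈ P.under ℤ := by
      rw [← hover.over]
      exact Ideal.mem_span_singleton_self _
    simpa [Ideal.under_def] using this
  · have h := hσ x
    rw [← hover.over, Int.card_ideal_quot] at h
    rw [← map_pow, Ideal.Quotient.eq]
    exact h

lemma charP_quotient {R : Type*} [CommRing R] {P : Ideal R} (hP : P ≠ ⊤) {q : ℕ}
    (hq : q.Prime) (hqP : (q : R) ∈ P) : CharP (R ⧸ P) q := by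
  have : Nontrivial (R ⧸ P) := Ideal.Quotient.nontrivial_iff.2 hP
  have h0 : ((q : ℕ) : R ⧸ P) = 0 := by
    have := Ideal.Quotient.eq_zero_iff_mem.2 hqP
    simpa using this
  exact (CharP.charP_iff_prime_eq_zero hq).2 h0

lemma smul_polyVal {G R : Type*} [Monoid G] [CommRing R] [MulSemiringAction G R] (g : G) (x : R)
    (l : List ℤ) : g • polyVal x l = polyVal (g • x) l :=
  map_polyVal (MulSemiringAction.toRingHom G R g) x l

lemma map_pow_eq_polyVal {R S : Type*} [CommRing R] [CommRing S] (φ : R →+* S) {x : R}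
    {l : List ℤ} {n : ℕ} (hx : x ^ n = polyVal x l) : φ x ^ n = polyVal (φ x) l := by
  rw [← map_polyVal, ← hx, map_pow]

lemma smul_pow_eq_polyVal {G R : Type*} [Monoid G] [CommRing R] [MulSemiringAction G R] (g : G)
    {x : R} {l : List ℤ} (hx : x ^ 13 = polyVal x l) : (g • x) ^ 13 = polyVal (g • x) l := by
  rw [← smul_polyVal, ← hx, smul_pow']

lemma pow_five_pow_val_add_one {k : Type*} [CommRing k] [CharP k 5] {t : k}
    (ht : t ^ 13 = polyVal t psl33Red) (i : ZMod 13) :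
    t ^ 5 ^ (i + 1).val = t ^ 5 ^ (i.val + 1) := by
  rw [pow_five_pow ht, pow_five_pow ht]
  congr 3
  have : (1 : ZMod 13).val = 1 := rfl
  simp [ZMod.val_add, Fin.ext_iff, this]

/-- The roots of `psl33Poly` form a single orbit under a Frobenius element at `5`, and the Galois
group permutes them by collineations. -/
theorem exists_roots_collineation (N : Type*) [Field N] [NumberField N] [IsGalois ℚ N]
    {θ : 𝓞 N} (hθ : θ ^ 13 = polyVal θ psl33Red) :
    ∃ r : ZMod 13 → 𝓞 N, Function.Injective r ∧ (∀ i, r i ^ 13 = polyVal (r i) psl33Red) ∧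
      (∃ i, r i = θ) ∧ (∃ σ : Gal(N/ℚ), ∀ i, σ • r i = r (i + 1)) ∧
      ∀ τ : Gal(N/ℚ), ∃ π ∈ collineationGroup, ∀ i, τ • r i = r (π i) := by
  classical
  obtain ⟨P, hP, h5, σ, hσ⟩ := exists_frobenius N Nat.prime_five
  have hchar : CharP (𝓞 N ⧸ P) 5 := charP_quotient hP.ne_top Nat.prime_five h5
  let φ : 𝓞 N →+* 𝓞 N ⧸ P := Ideal.Quotient.mk P
  have hφσ : ∀ x, φ (σ • x) = φ x ^ 5 := hσ
  have ht : φ θ ^ 13 = polyVal (φ θ) psl33Red := map_pow_eq_polyVal φ hθ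
  have hiter : ∀ (n : ℕ) (x : 𝓞 N), φ (σ ^ n • x) = φ x ^ 5 ^ n := by
    intro n x
    induction n with
    | zero => simp
    | succ n ih => rw [pow_succ', mul_smul, hφσ, ih, ← pow_mul, ← pow_succ]
  -- The labelling is the orbit of θ under a Frobenius element at 5. It reduces to the powers
  -- t^(5^i), which are distinct, so these are all the roots.
  let r : ZMod 13 → 𝓞 N := fun i => σ ^ i.val • θ
  have hφr : ∀ i, φ (r i) = φ θ ^ 5 ^ i.val := fun i => hiter _ _
  have hinj : ∀ i j : ZMod 13, φ (r i) = φ θ ^ 5 ^ j.val → i = j := fun i j h =>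
    injective_pow_five_pow ht ((hφr i).symm.trans h)
  have hr : Function.Injective r := fun i j h => hinj i j (by rw [h, hφr])
  have hroot : ∀ i, r i ^ 13 = polyVal (r i) psl33Red := fun i => smul_pow_eq_polyVal _ hθ
  have hall : ∀ x : 𝓞 N, x ^ 13 = polyVal x psl33Red → ∃ i, x = r i := fun x hx =>
    exists_eq_of_pow_eq_polyVal (r := r) rfl hr hroot hx
  -- At the wrap-around i = 12 the definition of r says nothing. The equality is read off modulo P,
  -- where the roots stay distinct.
  have hσr : ∀ i, σ • r i = r (i + 1) := by
    intro i
    obtain ⟨j, hj⟩ := hall _ (smul_pow_eq_polyVal σ (hroot i))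
    rw [hj, hinj j (i + 1)]
    rw [← hj, hφσ, hφr, pow_five_pow_val_add_one ht, pow_succ 5, pow_mul]
  have hsum : ∀ S : Finset (ZMod 13), φ (∑ i ∈ S, r i) = ∑ i ∈ S, φ θ ^ 5 ^ i.val := fun S => by
    rw [map_sum]
    exact Finset.sum_congr rfl fun i _ => hφr i
  have hsum_inj : ∀ S S' : Finset (ZMod 13), φ (∑ i ∈ S, r i) = φ (∑ i ∈ S', r i) → S = S' :=
    fun S S' h => injective_sum_pow_five_pow ht (by simpa only [hsum] using h)
  obtain ⟨j₀, hj₀⟩ : ∃ j₀, (∑ i ∈ planarLine j₀, r i) ^ 13 =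
      polyVal (∑ i ∈ planarLine j₀, r i) lineRed := by
    let ι : 𝓞 N →+* AlgebraicClosure N := algebraMap (𝓞 N) (AlgebraicClosure N)
    have hι : Function.Injective ι := FaithfulSMul.algebraMap_injective _ _
    -- A root of g is taken in the algebraic closure. Being a sum of roots of f it lies in 𝓞 N, and
    -- its reduction modulo 5 identifies the set of summands as a line.
    obtain ⟨y, hy⟩ := IsAlgClosed.exists_root
      (X ^ 13 - polyVal (X : (AlgebraicClosure N)[X]) lineRed) (by
        rw [degree_sub_eq_left_of_degree_lt
          (by rw [degree_X_pow]; exact degree_polyVal_lt lineRed), degree_X_pow]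
        norm_num)
    rw [IsRoot, eval_sub, eval_pow, eval_X, eval_polyVal_X, sub_eq_zero] at hy
    obtain ⟨S, hS⟩ := exists_eq_sum_of_lineRoot (r := fun i => ι (r i)) (hι.comp hr)
      (fun i => map_pow_eq_polyVal ι (hroot i)) hy
    have hy' : (∑ i ∈ S, r i) ^ 13 = polyVal (∑ i ∈ S, r i) lineRed := by
      apply hι
      rw [map_polyVal, map_pow, map_sum]
      exact hS ▸ hy
    obtain ⟨j, hj⟩ := exists_planarLine_of_root ht (y := φ (∑ i ∈ S, r i))
      (map_pow_eq_polyVal φ hy')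
    rw [← hsum] at hj
    exact ⟨j, hsum_inj _ _ hj ▸ hy'⟩
  -- The 13-cycle translates lines, so one line sum that is a root of g yields all of them.
  have hshift : ∀ (n : ℕ), (∑ i ∈ planarLine (j₀ + n), r i) ^ 13 =
      polyVal (∑ i ∈ planarLine (j₀ + n), r i) lineRed := by
    intro n
    induction n with
    | zero => simpa using hj₀
    | succ n ih =>
      have h := smul_pow_eq_polyVal σ ih
      have e : σ • ∑ i ∈ planarLine (j₀ + n), r i = ∑ i ∈ planarLine (j₀ + (n + 1 : ℕ)), r i := by
        rw [Finset.smul_sum, sum_planarLine, sum_planarLine]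
        refine Finset.sum_congr rfl fun i _ => ?_
        rw [hσr]
        congr 1
        push_cast
        ring
      rwa [e] at h
  have hline : ∀ j, (∑ i ∈ planarLine j, r i) ^ 13 = polyVal (∑ i ∈ planarLine j, r i) lineRed := by
    intro j
    have := hshift (j - j₀).val
    rwa [ZMod.natCast_zmod_val, add_sub_cancel] at this
  have hline_inj : Function.Injective fun j => ∑ i ∈ planarLine j, r i := fun j j' h =>
    planarLine_injective (hsum_inj _ _ (congrArg φ h))
  refine ⟨r, hr, hroot, ⟨0, by simp [r]⟩, ⟨σ, hσr⟩, fun τ => ?_⟩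
  choose π hπ using fun i => hall _ (smul_pow_eq_polyVal τ (hroot i))
  have hπ_inj : Function.Injective π := fun i j h => hr (MulAction.injective τ
    ((hπ i).trans (h ▸ (hπ j).symm)))
  refine ⟨Equiv.ofBijective π (Finite.injective_iff_bijective.1 hπ_inj), fun j => ?_, hπ⟩
  obtain ⟨j', hj'⟩ : ∃ j', τ • ∑ i ∈ planarLine j, r i = ∑ i ∈ planarLine j', r i :=
    exists_eq_of_pow_eq_polyVal (r := fun j : ZMod 13 => ∑ i ∈ planarLine j, r i)
      (l := lineRed) rfl hline_inj hline (smul_pow_eq_polyVal τ (hline j))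
  -- τ sends one line sum to another. Equal sums come from equal index sets, so the underlying
  -- permutation maps one line onto the other.
  have himage : (planarLine j).image π = planarLine j' := by
    apply hsum_inj
    rw [← hj', Finset.smul_sum, Finset.sum_image hπ_inj.injOn]
    exact congrArg φ (Finset.sum_congr rfl fun i _ => (hπ i).symm)
  refine ⟨j', fun i => ?_⟩
  rw [Equiv.ofBijective_apply, ← mem_planarLine, ← mem_planarLine, ← himage,
    hπ_inj.mem_finset_image]

instance : NumberField psl33Poly.SplittingField where
  to_charZero := inferInstance
  to_finiteDimensional := inferInstance

instance : IsSplittingField ℚ psl33Poly.SplittingField psl33Poly :=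
  IsSplittingField.splittingField psl33Poly

instance : IsGalois ℚ psl33Poly.SplittingField where
  to_normal := Normal.of_isSplittingField psl33Poly

/-- The roots of `psl33Poly` are distinct modulo primes not dividing its discriminant. -/
lemma injective_quotient_roots {R : Type*} [CommRing R] [IsDomain R] {P : Ideal R}
    [hP : P.IsPrime] {q : ℕ} (hq : q.Prime) (hqP : (q : R) ∈ P)
    (hndvd : ¬ (q : ℤ) ∣ psl33Prime ^ 4 * psl33Index ^ 2) {r : Fin 13 → R}
    (hr : Function.Injective r) (hroot : ∀ i, r i ^ 13 = polyVal (r i) psl33Red) :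
    Function.Injective fun i => Ideal.Quotient.mk P (r i) := by
  have hchar := charP_quotient hP.ne_top hq hqP
  intro i j hij
  by_contra hne
  have h := congrArg (Ideal.Quotient.mk P) (det_revVandermonde_sq hr hroot)
  have hdet : Ideal.Quotient.mk P (revVandermonde r).det = 0 := by
    rw [RingHom.map_det]
    refine Matrix.det_zero_of_row_eq hne ?_
    ext l
    simp only [RingHom.mapMatrix_apply, Matrix.map_apply, revVandermonde, Matrix.of_apply, map_pow]
    simp only at hij
    rw [hij]
  rw [map_pow, hdet, map_intCast, zero_pow two_ne_zero] at h
  exact hndvd ((CharP.intCast_eq_zero_iff (R ⧸ P) q _).1 h.symm)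

/-- Modulo `3`, the polynomial `psl33Poly` has an irreducible quadratic factor. -/
lemma exists_root_mod_three {k : Type*} [CommRing k] [IsDomain k] [CharP k 3] {r : Fin 13 → k}
    (hr : Function.Injective r) (hroot : ∀ i, r i ^ 13 = polyVal (r i) psl33Red) :
    ∃ i, r i ^ 3 ≠ r i ∧ (r i ^ 3) ^ 3 = r i := by
  have h3 : (3 : k) = 0 := by
    have := CharP.cast_eq_zero k 3
    exact_mod_cast this
  have h3X : (3 : k[X]) = 0 := by rw [← C_ofNat, h3, C_0]
  have hdvd : X ^ 2 + 2 * X + 2 ∣ Lagrange.nodal Finset.univ r := by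
    rw [← X_pow_sub_polyVal_eq_nodal rfl hr hroot]
    -- Quotient and remainder of integral division by X² + 2X + 2; the remainder is a multiple of 3.
    refine ⟨polyVal X [1, -8, -4528, -217003, 8599123, 753700350, 9937616501, -991802538866,
      -31742370204765, 84173774981829, 29303139757025311, 178811095526300469], ?_⟩
    simp only [psl33Red, polyVal, List.length_cons, List.length_nil]
    push_cast
    linear_combination (-902461987925618124 * X - 3913084965058012638) * h3X
  have hsplits : (X ^ 2 + 2 * X + 2 : k[X]).Splits :=
    (Splits.prod fun i _ => Splits.X_sub_C (r i)).of_dvd Lagrange.nodal_ne_zero hdvd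
  obtain ⟨u, hu⟩ := hsplits.exists_eval_eq_zero (by
    have : (X ^ 2 + 2 * X + 2 : k[X]).degree = 2 := by
      compute_degree!
    rw [this]
    norm_num)
  have hu0 : eval u (Lagrange.nodal Finset.univ r) = 0 := eval_eq_zero_of_dvd_of_eval_eq_zero hdvd hu
  rw [Lagrange.eval_nodal] at hu0
  obtain ⟨i, -, hi⟩ := Finset.prod_eq_zero_iff.1 hu0
  obtain rfl : u = r i := sub_eq_zero.1 hi
  simp only [eval_add, eval_pow, eval_X, eval_mul, eval_ofNat] at hu
  refine ⟨i, fun h => ?_, ?_⟩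
  · have h1 : r i + 1 = 0 := by linear_combination h - (r i - 2) * hu - h3
    have : (1 : k) = 0 := by linear_combination hu - (r i + 1) * h1
    exact one_ne_zero this
  · have hc : r i ^ 3 = 2 * r i + 1 := by linear_combination (r i - 2) * hu + h3
    rw [hc]
    linear_combination 8 * hc + (4 * r i ^ 2 + 7 * r i + 3) * h3

/-- The point a lies on a 2-cycle of π, so every odd power of π moves it. -/
lemma two_dvd_orderOf {α : Type*} {π : Equiv.Perm α} {a : α} (h : π (π a) = a)
    (hne : π a ≠ a) : 2 ∣ orderOf π := by
  rw [← even_iff_two_dvd, ← Nat.not_odd_iff_even]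
  rintro ⟨n, hn⟩
  have hsq : ∀ m : ℕ, (π ^ (2 * m)) a = a := fun m => by
    induction m with
    | zero => simp
    | succ m ih => rw [mul_add, mul_one, pow_add, Equiv.Perm.mul_apply, sq, Equiv.Perm.mul_apply, h,
        ih]
  apply hne
  have := pow_orderOf_eq_one π
  rw [hn, pow_succ', Equiv.Perm.mul_def] at this
  have h2 := DFunLike.congr_fun this a
  rwa [Equiv.trans_apply, hsq] at h2

/-! ### The Galois group of the splitting field, and irreducibility. -/

lemma exists_integer_root : ∃ θ : 𝓞 psl33Poly.SplittingField, θ ^ 13 = polyVal θ psl33Red := by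
  have hdeg : psl33Poly.natDegree = 13 := by
    unfold psl33Poly; compute_degree!
  obtain ⟨x, hx⟩ := (SplittingField.splits psl33Poly).exists_eval_eq_zero (by
    rw [degree_map]
    exact fun h => by simp [natDegree, h] at hdeg)
  rw [eval_map_algebraMap, aeval_psl33Poly, sub_eq_zero] at hx
  obtain ⟨θ, rfl⟩ : ∃ θ : 𝓞 psl33Poly.SplittingField, (θ : psl33Poly.SplittingField) = x :=
    ⟨⟨x, isIntegral_of_pow_eq_polyVal hx⟩, rfl⟩
  refine ⟨θ, RingOfIntegers.coe_injective ?_⟩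
  rw [map_polyVal, map_pow]
  exact hx

/-- The representation of the Galois group on the roots. -/
theorem exists_roots_collineationGroup : ∃ r : ZMod 13 → 𝓞 psl33Poly.SplittingField,
    Function.Injective r ∧ (∀ i, r i ^ 13 = polyVal (r i) psl33Red) ∧
    (∃ σ : Gal(psl33Poly.SplittingField/ℚ), ∀ i, σ • r i = r (i + 1)) ∧
    (∀ τ : Gal(psl33Poly.SplittingField/ℚ), (∀ i, τ • r i = r i) → τ = 1) ∧
    Nonempty (Gal(psl33Poly.SplittingField/ℚ) ≃* collineationGroup) := by
  obtain ⟨θ, hθ⟩ := exists_integer_root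
  obtain ⟨r, hr, hroot, -, ⟨σ, hσ⟩, hπ⟩ := exists_roots_collineation psl33Poly.SplittingField hθ
  have hfaith : ∀ τ : Gal(psl33Poly.SplittingField/ℚ), (∀ i, τ • r i = r i) → τ = 1 := by
    intro τ hτ
    refine AlgEquiv.coe_toAlgHom_injective (AlgHom.ext_of_adjoin_eq_top
      (IsSplittingField.adjoin_rootSet psl33Poly.SplittingField psl33Poly) fun x hx => ?_)
    have hx' : x ^ 13 = polyVal x psl33Red := by
      have := aeval_eq_zero_of_mem_rootSet hx
      rwa [aeval_psl33Poly, sub_eq_zero] at this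
    obtain ⟨i, hi⟩ := exists_eq_of_pow_eq_polyVal
      (r := fun i : ZMod 13 => (r i : psl33Poly.SplittingField)) rfl
      (RingOfIntegers.coe_injective.comp hr)
      (fun i => map_pow_eq_polyVal (algebraMap (𝓞 psl33Poly.SplittingField) _) (hroot i)) hx'
    rw [hi]
    exact congrArg (algebraMap (𝓞 psl33Poly.SplittingField) psl33Poly.SplittingField) (hτ i)
  refine ⟨r, hr, hroot, ⟨σ, hσ⟩, hfaith, ?_⟩
  choose π hmem hact using hπ
  let ρ : Gal(psl33Poly.SplittingField/ℚ) →* Equiv.Perm (ZMod 13) := MonoidHom.mk' π fun τ τ' => by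
    ext1 i
    apply hr
    rw [← hact, mul_smul, hact τ' i, hact τ, Equiv.Perm.mul_apply]
  have hρ : Function.Injective ρ := (injective_iff_map_eq_one ρ).2 fun τ hτ => hfaith τ fun i => by
    rw [hact, show π τ = 1 from hτ, Equiv.Perm.one_apply]
  have hΓ : ρ.range = collineationGroup := by
    refine eq_collineationGroup ?_ ⟨σ, ?_⟩ ?_
    · rintro _ ⟨τ, rfl⟩
      exact hmem τ
    · ext1 i
      exact hr ((hact σ i).symm.trans (hσ i))
    -- Even order: a Frobenius element at 3 interchanges the two roots that reduce to those of an
    -- irreducible quadratic factor. The roots stay distinct, as 3 does not divide the discriminant.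
    · obtain ⟨P, hP, h3, τ, hτ⟩ := exists_frobenius psl33Poly.SplittingField Nat.prime_three
      have hchar := charP_quotient hP.ne_top Nat.prime_three h3
      have hinj := injective_quotient_roots (r := r) (hP := hP.isPrime) Nat.prime_three h3
        (by unfold psl33Index; norm_num) hr hroot
      obtain ⟨i, h1, h2⟩ : ∃ i : ZMod 13,
          Ideal.Quotient.mk P (r i) ^ 3 ≠ Ideal.Quotient.mk P (r i) ∧
          (Ideal.Quotient.mk P (r i) ^ 3) ^ 3 = Ideal.Quotient.mk P (r i) :=
        exists_root_mod_three hinj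
          fun i => map_pow_eq_polyVal (Ideal.Quotient.mk P) (hroot i)
      refine (two_dvd_orderOf (π := ρ τ) (a := i) ?_ ?_).trans
        (Subgroup.orderOf_dvd_natCard _ ⟨τ, rfl⟩)
      · have h2' : Ideal.Quotient.mk P (r (π τ (π τ i))) = Ideal.Quotient.mk P (r i) := by
          rw [← hact, ← hact, hτ, hτ]
          exact h2
        exact hinj h2'
      · intro h
        apply h1
        have h' : Ideal.Quotient.mk P (r (π τ i)) = Ideal.Quotient.mk P (r i) :=
          congrArg (fun j => Ideal.Quotient.mk P (r j)) h
        rw [← hact, hτ] at h'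
        exact h'
  exact ⟨(MonoidHom.ofInjective hρ).trans (MulEquiv.subgroupCongr hΓ)⟩

theorem nonempty_gal_mulEquiv : Nonempty
    (psl33Poly.Gal ≃* Matrix.ProjectiveSpecialLinearGroup (Fin 3) (ZMod 3)) := by
  obtain ⟨r, -, -, -, -, ⟨e⟩⟩ := exists_roots_collineationGroup
  obtain ⟨e'⟩ := nonempty_collineationGroup_mulEquiv
  exact ⟨e.trans e'⟩

lemma monic_psl33Poly : psl33Poly.Monic := by
  unfold psl33Poly; monicity!

lemma natDegree_psl33Poly : psl33Poly.natDegree = 13 := by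
  unfold psl33Poly; compute_degree!

/-- The 13-cycle in the Galois group makes all 13 roots conjugate, so the minimal polynomial of one
of them has degree at least 13. -/
theorem irreducible_psl33Poly : Irreducible psl33Poly := by
  obtain ⟨r, hr, hroot, ⟨σ, hσ⟩, -, -⟩ := exists_roots_collineationGroup
  let x : ZMod 13 → psl33Poly.SplittingField := fun i => r i
  have hx : Function.Injective x := RingOfIntegers.coe_injective.comp hr
  have hint : IsIntegral ℚ (x 0) := Algebra.IsIntegral.isIntegral _
  have hdvd : minpoly ℚ (x 0) ∣ psl33Poly := by
    refine minpoly.dvd _ _ ?_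
    rw [aeval_psl33Poly, sub_eq_zero]
    exact map_pow_eq_polyVal (algebraMap (𝓞 psl33Poly.SplittingField) _) (hroot 0)
  have hmem : ∀ n : ℕ, aeval (x (n : ZMod 13)) (minpoly ℚ (x 0)) = 0 := fun n => by
    induction n with
    | zero => simp
    | succ n ih =>
      have h : σ (x n) = x (n + 1 : ℕ) := by
        rw [Nat.cast_succ]
        exact congrArg (algebraMap (𝓞 psl33Poly.SplittingField) psl33Poly.SplittingField) (hσ n)
      rw [← h, ← AlgEquiv.coe_toAlgHom, aeval_algHom_apply, ih, map_zero]
  have hcard : 13 ≤ (minpoly ℚ (x 0)).natDegree := by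
    have h1 : Set.range x ⊆ (minpoly ℚ (x 0)).rootSet psl33Poly.SplittingField := by
      rintro _ ⟨i, rfl⟩
      rw [mem_rootSet_of_ne (minpoly.ne_zero hint), ← ZMod.natCast_zmod_val i]
      exact hmem _
    have h2 := Set.ncard_le_ncard h1 (rootSet_finite _ _)
    rw [← Set.image_univ, Set.ncard_image_of_injective _ hx, Set.ncard_univ, Nat.card_zmod] at h2
    exact h2.trans (ncard_rootSet_le _ _)
  have heq := eq_of_monic_of_dvd_of_natDegree_le (minpoly.monic hint) monic_psl33Poly hdvd
    (by rwa [natDegree_psl33Poly])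
  rw [heq]
  exact minpoly.irreducible hint

/-! ### Primality of p and ramification in the splitting field. -/

/-- Lucas's test, with 5 as a primitive root and the complete factorization of p - 1. -/
lemma prime_psl33Prime : Nat.Prime 83420911386433 := by
  have h1 : Nat.Prime 2557 := by norm_num
  have h2 : Nat.Prime 3331753 := by norm_num
  refine lucas_primality _ (5 : ZMod 83420911386433) ?_ ?_
  · reduce_mod_char
  · intro q hq hdvd
    have hfac : 83420911386433 - 1 = 2 ^ 6 * 3 ^ 2 * 17 * 2557 * 3331753 := by norm_num
    rw [hfac] at hdvd
    have hcases : q = 2 ∨ q = 3 ∨ q = 17 ∨ q = 2557 ∨ q = 3331753 := by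
      rcases (Nat.Prime.dvd_mul hq).1 hdvd with h | h
      · rcases (Nat.Prime.dvd_mul hq).1 h with h | h
        · rcases (Nat.Prime.dvd_mul hq).1 h with h | h
          · rcases (Nat.Prime.dvd_mul hq).1 h with h | h
            · exact Or.inl ((Nat.prime_dvd_prime_iff_eq hq Nat.prime_two).1 (hq.dvd_of_dvd_pow h))
            · exact Or.inr (Or.inl
                ((Nat.prime_dvd_prime_iff_eq hq Nat.prime_three).1 (hq.dvd_of_dvd_pow h)))
          · exact Or.inr (Or.inr (Or.inl ((Nat.prime_dvd_prime_iff_eq hq (by norm_num)).1 h)))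
        · exact Or.inr (Or.inr (Or.inr (Or.inl ((Nat.prime_dvd_prime_iff_eq hq h1).1 h))))
      · exact Or.inr (Or.inr (Or.inr (Or.inr ((Nat.prime_dvd_prime_iff_eq hq h2).1 h))))
    rcases hcases with rfl | rfl | rfl | rfl | rfl
    all_goals norm_num only
    all_goals reduce_mod_char
    all_goals decide

section

variable (N : Type*) [Field N] [NumberField N]

lemma isUnramifiedAt_iff_ramificationIdx' {q : ℕ} (hq : q.Prime) (P : Ideal (𝓞 N)) [P.IsPrime]
    [hover : P.LiesOver (Ideal.span {(q : ℤ)})] :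
    Algebra.IsUnramifiedAt ℤ P ↔ Ideal.ramificationIdx' (Ideal.span {(q : ℤ)}) P = 1 := by
  have hp : (Ideal.span {(q : ℤ)}).IsPrime :=
    (Ideal.span_singleton_prime (by exact_mod_cast hq.ne_zero)).2 (Nat.prime_iff_prime_int.1 hq)
  have hbot : Ideal.span {(q : ℤ)} ≠ ⊥ := by
    rw [Ne, Ideal.span_singleton_eq_bot]
    exact_mod_cast hq.ne_zero
  have hP : P ≠ ⊥ := Ideal.ne_bot_of_liesOver_of_ne_bot hbot P
  let := Localization.AtPrime.algebraOfLiesOver (Ideal.span {(q : ℤ)}) P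
  have := Algebra.EssFiniteType.of_comp ℤ (Localization.AtPrime (Ideal.span {(q : ℤ)}))
    (Localization.AtPrime P)
  rw [Algebra.isUnramifiedAt_iff_map_eq ℤ (Ideal.span {(q : ℤ)}) P,
    Ideal.IsDedekindDomain.ramificationIdx'_eq_one_iff hP
      (Ideal.map_le_iff_le_comap.2 hover.over.le)]
  -- Separability of the residue extension is automatic, the residue field at q being perfect.
  exact and_iff_right Algebra.IsAlgebraic.isSeparable_of_perfectField

/-- In a Galois extension the order of the inertia group is the ramification index. -/
lemma exists_inertia_ne_one [IsGalois ℚ N] {q : ℕ} (hq : q.Prime) (P : Ideal (𝓞 N)) [P.IsPrime]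
    [hover : P.LiesOver (Ideal.span {(q : ℤ)})]
    (h : 1 < Ideal.ramificationIdx' (Ideal.span {(q : ℤ)}) P) :
    ∃ τ : Gal(N/ℚ), τ ≠ 1 ∧ ∀ x : 𝓞 N, Ideal.Quotient.mk P (τ • x) = Ideal.Quotient.mk P x := by
  have hp : (Ideal.span {(q : ℤ)}).IsPrime :=
    (Ideal.span_singleton_prime (by exact_mod_cast hq.ne_zero)).2 (Nat.prime_iff_prime_int.1 hq)
  have hne : Nat.card (P.inertia Gal(N/ℚ)) ≠ 1 := by
    rw [Ideal.card_inertia_eq_ramificationIdxIn (R := ℤ) (Ideal.span {(q : ℤ)}) P,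
      Ideal.ramificationIdxIn_eq_ramificationIdx (Ideal.span {(q : ℤ)}) P Gal(N/ℚ), Ne,
      Ideal.ramificationIdx_eq_one_iff, isUnramifiedAt_iff_ramificationIdx' N hq]
    exact h.ne'
  have hbot : P.inertia Gal(N/ℚ) ≠ ⊥ := fun hb => hne (by rw [hb]; simp)
  obtain ⟨τ, hτ⟩ := Subgroup.ne_bot_iff_exists_ne_one.1 hbot
  exact ⟨τ, fun h => hτ (Subtype.ext h), fun x => Ideal.Quotient.eq.2 (τ.2 x)⟩

end

lemma exists_integralElement {N : Type*} [Field N] [NumberField N] {x : 𝓞 N}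
    (hx : x ^ 13 = polyVal x psl33Red) (j : Fin 13) :
    ∃ w : 𝓞 N, (w : N) = integralElement (x : N) j :=
  ⟨⟨_, isIntegral_integralElement (map_pow_eq_polyVal (algebraMap (𝓞 N) N) hx) j⟩, rfl⟩

lemma smul_integralElement {N : Type*} [Field N] [NumberField N] (τ : Gal(N/ℚ)) (x : N)
    (j : Fin 13) : τ (integralElement x j) = integralElement (τ x) j := by
  have h := map_polyVal (τ : N →+* N) x (scaledBasis.getD j [])
  rw [integralElement, integralElement, map_div₀, map_intCast]
  exact congrArg (· / (psl33Index : N)) h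

/-- Only `psl33Prime` can ramify in the splitting field of `psl33Poly`. -/
theorem eq_psl33Prime_of_ramifiesIn {q : ℕ} (hq : q.Prime)
    (h : RamifiesIn q psl33Poly.SplittingField) : q = 83420911386433 := by
  obtain ⟨P, hP, hover, hram⟩ := h
  obtain ⟨τ, hτ, hin⟩ := exists_inertia_ne_one psl33Poly.SplittingField hq P hram
  obtain ⟨r, hr, hroot, -, hfaith, -⟩ := exists_roots_collineationGroup
  obtain ⟨i, hi⟩ : ∃ i, τ • r i ≠ r i := by
    by_contra! hall
    exact hτ (hfaith τ hall)
  obtain ⟨j, hj⟩ := exists_eq_of_pow_eq_polyVal (r := r) rfl hr hroot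
    (smul_pow_eq_polyVal τ (hroot i))
  choose w hw using fun i : Fin 13 => exists_integralElement (hroot i)
  have hdet : (Matrix.of w).det ^ 2 = (psl33Prime : 𝓞 psl33Poly.SplittingField) ^ 4 := by
    apply RingOfIntegers.coe_injective
    have h := det_integralElement_sq
      (r := fun i => algebraMap (𝓞 psl33Poly.SplittingField) psl33Poly.SplittingField (r i))
      (RingOfIntegers.coe_injective.comp hr) fun i => map_pow_eq_polyVal _ (hroot i)
    rw [map_pow, map_pow, map_intCast, ← h, RingHom.map_det]
    congr 2
    ext a b
    exact hw a b
  -- τ carries the row of r i to the row of r j and is trivial modulo P. The matrix therefore has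
  -- two equal rows modulo P, and its determinant, of square p^4, lies in P.
  have hrow : ∀ l, Ideal.Quotient.mk P (w i l) = Ideal.Quotient.mk P (w j l) := by
    intro l
    rw [← hin (w i l)]
    congr 1
    apply RingOfIntegers.coe_injective
    refine Eq.trans ?_ (hw j l).symm
    have h1 := smul_integralElement τ (r i : psl33Poly.SplittingField) l
    have h2 : τ (r i : psl33Poly.SplittingField) = (r j : psl33Poly.SplittingField) :=
      congrArg (algebraMap (𝓞 psl33Poly.SplittingField) psl33Poly.SplittingField) hj
    rw [h2] at h1
    rw [← h1]
    exact congrArg τ (hw i l)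
  have hzero : Ideal.Quotient.mk P (Matrix.of w).det = 0 := by
    rw [RingHom.map_det]
    refine Matrix.det_zero_of_row_eq (i := i) (j := j) (fun hij => hi (hj.trans (by rw [hij]))) ?_
    ext l
    exact hrow l
  have hqP : (q : 𝓞 psl33Poly.SplittingField) ∈ P := by
    have : (q : ℤ) ∈ P.under ℤ := by
      rw [← hover.over]
      exact Ideal.mem_span_singleton_self _
    simpa [Ideal.under_def] using this
  have hchar := charP_quotient hP.ne_top hq hqP
  have h4 : ((psl33Prime ^ 4 : ℤ) : 𝓞 psl33Poly.SplittingField ⧸ P) = 0 := by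
    have := congrArg (Ideal.Quotient.mk P) hdet
    rw [map_pow, hzero, zero_pow two_ne_zero, map_pow, map_intCast] at this
    rw [Int.cast_pow, ← this]
  have hdvd := (CharP.intCast_eq_zero_iff _ q _).1 h4
  have hdvd' : q ∣ 83420911386433 := by
    have := Int.Prime.dvd_pow' hq hdvd
    exact_mod_cast this
  exact (Nat.prime_dvd_prime_iff_eq hq prime_psl33Prime).1 hdvd'

/-- By Minkowski a nontrivial extension of ℚ is ramified at some prime. Only p is possible, so p
does ramify. -/
theorem ramifiesIn_iff {q : ℕ} (hq : q.Prime) :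
    RamifiesIn q psl33Poly.SplittingField ↔ q = 83420911386433 := by
  refine ⟨eq_psl33Prime_of_ramifiesIn hq, ?_⟩
  have hrank : 1 < Module.finrank ℚ psl33Poly.SplittingField := by
    obtain ⟨r, hr, hroot, ⟨σ, hσ⟩, -, -⟩ := exists_roots_collineationGroup
    by_contra hle
    have h1 : Module.finrank ℚ psl33Poly.SplittingField = 1 :=
      le_antisymm (not_lt.1 hle) Module.finrank_pos
    have hsub : Nat.card Gal(psl33Poly.SplittingField/ℚ) = 1 := by
      rw [IsGalois.card_aut_eq_finrank, h1]
    have := (Nat.card_eq_one_iff_unique.1 hsub).1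
    have h01 : r 0 = r (0 + 1) := by rw [← hσ, Subsingleton.elim σ 1, one_smul]
    exact absurd (hr h01) (by decide)
  obtain ⟨p₀, hp₀, hall⟩ := NumberField.exists_not_isUnramifiedAt_int_of_isGalois
    (K := psl33Poly.SplittingField) (𝒪 := 𝓞 psl33Poly.SplittingField) hrank
  have hram : RamifiesIn p₀ psl33Poly.SplittingField := by
    have hmax : (Ideal.span {(p₀ : ℤ)}).IsMaximal :=
      PrincipalIdealRing.isMaximal_of_irreducible (Nat.prime_iff_prime_int.1 hp₀).irreducible
    obtain ⟨P, hP, hover⟩ := Ideal.exists_maximal_ideal_liesOver_of_isIntegral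
      (S := 𝓞 psl33Poly.SplittingField) (Ideal.span {(p₀ : ℤ)})
    have hprime := hP.isPrime
    refine ⟨P, hprime, hover, ?_⟩
    have hmem : (p₀ : 𝓞 psl33Poly.SplittingField) ∈ P := by
      have : (p₀ : ℤ) ∈ P.under ℤ := by
        rw [← hover.over]
        exact Ideal.mem_span_singleton_self _
      simpa [Ideal.under_def] using this
    have h1 : Ideal.ramificationIdx' (Ideal.span {(p₀ : ℤ)}) P ≠ 1 := fun h =>
      hall P hprime hmem ((isUnramifiedAt_iff_ramificationIdx' _ hp₀ P).2 h)
    have h0 : Ideal.ramificationIdx' (Ideal.span {(p₀ : ℤ)}) P ≠ 0 :=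
      Ideal.IsDedekindDomain.ramificationIdx'_ne_zero_of_liesOver P (by
        rw [Ne, Ideal.span_singleton_eq_bot]
        exact_mod_cast hp₀.ne_zero)
    omega
  rintro rfl
  rwa [eq_psl33Prime_of_ramifiesIn hp₀ hram] at hram

/-! ### Dedekind's criterion at p. -/

/-- The factor of multiplicity one of `psl33Poly` modulo `psl33Prime`. -/
def dedekindA : List ℤ :=
  [1, 23475858864927, 29167351085353, 16394563652736, 10305210853547, -1280694072580]

/-- The factor of multiplicity two of `psl33Poly` modulo `psl33Prime`. -/
def dedekindB : List ℤ :=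
  [1, 29972526260750, 8312023933589, -4692236030943, 35659403146079]

/-- The quotient of `psl33Poly - dedekindA * dedekindB ^ 2` by `psl33Prime`. -/
def dedekindF : List ℤ :=
  [-1, -27638320953081, -252809423562430881610234807, -454319537267405278559985969,
  -291052846422090399525382523, -714311549070148706085816711, -899199557475722103304230899,
  -491700753784333202731756610, -619354586808286549328831412, -423164706015705592815582239,
  -199125512975135507609143313, -162220857407346381845133423, 19521743801303822592363988]

lemma dedekind_factorization {R : Type*} [CommRing R] (x : R) :
    x ^ 13 - polyVal x psl33Red = polyVal x dedekindA * polyVal x dedekindB ^ 2 +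
      (psl33Prime : R) * polyVal x dedekindF := by
  simp only [dedekindA, dedekindB, dedekindF, psl33Red, polyVal, List.length_cons, List.length_nil]
  push_cast
  ring

section

variable {k : Type*} [Field k] [CharP k 83420911386433]

lemma separable_dedekindA : (polyVal (X : k[X]) dedekindA).Separable := by
  have hp : (83420911386433 : k[X]) = 0 := by
    have := CharP.cast_eq_zero k[X] 83420911386433
    exact_mod_cast this
  have hd : derivative (polyVal (X : k[X]) dedekindA) = polyVal X
      [5, 93903435459708, 87502053256059, 32789127305472, 10305210853547] := by
    simp only [dedekindA, polyVal, List.length_cons, List.length_nil, derivative_add, derivative_mul,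
      derivative_X_pow, derivative_intCast, derivative_zero]
    push_cast
    simp only [map_ofNat, map_one, map_zero]
    ring
  rw [Separable, hd]
  refine ⟨polyVal X
      [30658828624368, 8923840973402, 27870749719599, 32814884408682],
    polyVal X
      [10552416552413, -7071508684986, 4265629312459, 22944895286890, -16645907072233], ?_⟩
  -- The Bézout relation holds over ℤ up to p times this polynomial, so what remains is an identity
  -- of integer polynomials. The next three lemmas use the same device.
  have h : polyVal (X : k[X])
      [1, 20506255230164, 16339437949907, 18520571500621, 53346981369248, 23715396391852,
      1840320440547, -82501893664, -2560094425164] * 83420911386433 = 0 := by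
    rw [hp, mul_zero]
  refine Eq.trans ?_ (zero_add (1 : k[X]))
  rw [← h]
  simp only [dedekindA, polyVal, List.length_cons, List.length_nil]
  push_cast
  ring

lemma separable_dedekindB : (polyVal (X : k[X]) dedekindB).Separable := by
  have hp : (83420911386433 : k[X]) = 0 := by
    have := CharP.cast_eq_zero k[X] 83420911386433
    exact_mod_cast this
  have hd : derivative (polyVal (X : k[X]) dedekindB) = polyVal X
      [4, 89917578782250, 16624047867178, -4692236030943] := by
    simp only [dedekindB, polyVal, List.length_cons, List.length_nil, derivative_add, derivative_mul,
      derivative_X_pow, derivative_intCast, derivative_zero]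
    push_cast
    simp only [map_ofNat, map_one, map_zero]
    ring
  rw [Separable, hd]
  refine ⟨polyVal X
      [-29254726626443, 268841789075, 23023252573040],
    polyVal X
      [28168909503219, -39592076748072, -25902350449057, 5492580417353], ?_⟩
  have h : polyVal (X : k[X])
      [1, 19851642110839, -39880294343651, -27449504040959, -7240927192714, 1371419496630,
      9532657319160] * 83420911386433 = 0 := by
    rw [hp, mul_zero]
  refine Eq.trans ?_ (zero_add (1 : k[X]))
  rw [← h]
  simp only [dedekindB, polyVal, List.length_cons, List.length_nil]
  push_cast
  ring

lemma isCoprime_dedekindA_dedekindB : IsCoprime (polyVal (X : k[X]) dedekindA) (polyVal X dedekindB) := by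
  have hp : (83420911386433 : k[X]) = 0 := by
    have := CharP.cast_eq_zero k[X] 83420911386433
    exact_mod_cast this
  refine ⟨polyVal X
      [-13204268478469, -13362018171999, 22874409284927, 5734290605912],
    polyVal X
      [13204268478469, 30927329959059, -3272655418083, -41536025651597, 6436752048160], ?_⟩
  have h : polyVal (X : k[X])
      [1028324182559, 4050615272385, 333308762559, -5990559265855, 16630910599984, 5736544794375,
      -17759991657383, 2663443260863] * 83420911386433 = 0 := by
    rw [hp, mul_zero]
  refine Eq.trans ?_ (zero_add (1 : k[X]))
  rw [← h]
  simp only [dedekindA, dedekindB, polyVal, List.length_cons, List.length_nil]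
  push_cast
  ring

/-- The decisive condition in Dedekind's criterion: (f - A B²)/p has no common root modulo p with
the repeated factor B. -/
lemma isCoprime_dedekindF_dedekindB : IsCoprime (polyVal (X : k[X]) dedekindF) (polyVal X dedekindB) := by
  have hp : (83420911386433 : k[X]) = 0 := by
    have := CharP.cast_eq_zero k[X] 83420911386433
    exact_mod_cast this
  refine ⟨polyVal X
      [22880608134056, 27256702616203, 9540324745340, -37276504291433],
    polyVal X
      [22880608134056, 39005084797491, 23583917052191, -34647364063727, -14958820269294,
      14474162574521, 27702530751912, -8533842112810, -11628201228261, 22862417802882,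
      31810148753529, 25927923603658], ?_⟩
  have h : polyVal (X : k[X])
      [640223608944, -69340327946461382199155350, -207212535672280198047975966,
      -257184946654398014937389792, -230008610106061218446562440, -310297552967557492058064078,
      -380299832965447109179037790, -114179633444445382114150637, 27141895907319039538058104,
      -43995515663230640398841249, 118807482107707947294315956, 118668598291486430724763414,
      76805223506615854709228602, 74720716414750215908626472, -8723260804640182993504831] * 83420911386433 = 0 := by
    rw [hp, mul_zero]
  refine Eq.trans ?_ (zero_add (1 : k[X]))
  rw [← h]
  simp only [dedekindB, dedekindF, polyVal, List.length_cons, List.length_nil]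
  push_cast
  ring

end

lemma eq_zero_of_forall_eval_eq_zero {k : Type*} [Field k] {G H : k[X]} (hG : G.Splits) (hsep : G.Separable)
    (hroots : ∀ a, G.eval a = 0 → H.eval a = 0) (hdeg : H.degree < G.degree) : H = 0 := by
  by_contra hH
  have hle : G.roots ≤ H.roots := by
    refine (Multiset.le_iff_subset (nodup_roots hsep)).2 fun a ha => ?_
    exact (mem_roots hH).2 (hroots a ((mem_roots'.1 ha).2))
  exact hH (eq_zero_of_dvd_of_degree_lt (hG.dvd_of_roots_le_roots hsep.ne_zero hle) hdeg)

lemma monic_polyVal_one_cons {R : Type*} [CommRing R] (l : List ℤ) :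
    (polyVal (X : R[X]) (1 :: l)).Monic := by
  rw [polyVal, Int.cast_one, one_mul]
  exact monic_X_pow_add (degree_polyVal_lt l)

lemma degree_polyVal_one_cons {R : Type*} [CommRing R] [Nontrivial R] (l : List ℤ) :
    (polyVal (X : R[X]) (1 :: l)).degree = l.length := by
  rw [polyVal, Int.cast_one, one_mul, degree_add_eq_left_of_degree_lt, degree_X_pow]
  rw [degree_X_pow]
  exact degree_polyVal_lt l

lemma map_polyVal_X {R S : Type*} [CommRing R] [CommRing S] (φ : R →+* S) (l : List ℤ) :
    (polyVal (X : R[X]) l).map φ = polyVal X l := by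
  have := map_polyVal (mapRingHom φ) (X : R[X]) l
  simpa using this

/-- Dedekind's criterion for `psl33Poly` at `psl33Prime`. -/
theorem dvd_coeff_of_forall_dvd_aeval {O : Type*} [CommRing O] [IsDomain O] [CharZero O]
    {P : Ideal O} [hP : P.IsMaximal] (hpP : (psl33Prime : O) ∈ P) {r : Fin 13 → O}
    (hr : Function.Injective r) (hroot : ∀ i, r i ^ 13 = polyVal (r i) psl33Red) {h : ℤ[X]}
    (hdeg : h.degree < 13) (hdvd : ∀ i, (psl33Prime : O) ∣ aeval (r i) h) (n : ℕ) :
    psl33Prime ∣ h.coeff n := by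
  let : Field (O ⧸ P) := Ideal.Quotient.field P
  have hchar : CharP (O ⧸ P) 83420911386433 :=
    charP_quotient hP.ne_top prime_psl33Prime (by exact_mod_cast hpP)
  let φ : O →+* O ⧸ P := Ideal.Quotient.mk P
  let ψ : ℤ →+* O ⧸ P := Int.castRingHom (O ⧸ P)
  have hφ : ∀ (x : O) (H : ℤ[X]), φ (aeval x H) = (H.map ψ).eval (φ x) := fun x H => by
    rw [aeval_def, hom_eval₂, eval_map]
    congr 1
  have hp0 : φ (psl33Prime : O) = 0 := Ideal.Quotient.eq_zero_iff_mem.2 hpP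
  have hcoeff : ∀ H : ℤ[X], H.map ψ = 0 → ∀ n, psl33Prime ∣ H.coeff n := fun H hH n => by
    have : ψ (H.coeff n) = 0 := by rw [← coeff_map, hH, coeff_zero]
    exact (CharP.intCast_eq_zero_iff (O ⧸ P) 83420911386433 _).1 this
  let A : ℤ[X] := polyVal X dedekindA
  let B : ℤ[X] := polyVal X dedekindB
  let F : ℤ[X] := polyVal X dedekindF
  have hA : A.Monic := monic_polyVal_one_cons _
  have hB : B.Monic := monic_polyVal_one_cons _
  have hAdeg : A.degree = 5 := degree_polyVal_one_cons _
  have hBdeg : B.degree = 4 := degree_polyVal_one_cons _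
  have hAk : A.map ψ = polyVal X dedekindA := map_polyVal_X _ _
  have hBk : B.map ψ = polyVal X dedekindB := map_polyVal_X _ _
  have hFk : F.map ψ = polyVal X dedekindF := map_polyVal_X _ _
  have haeval : ∀ (x : O) (l : List ℤ), aeval x (polyVal (X : ℤ[X]) l) = polyVal x l :=
    fun x l => by
      have := map_polyVal (aeval x : ℤ[X] →ₐ[ℤ] O).toRingHom X l
      simpa using this
  have hfac : ∀ i, aeval (r i) A * aeval (r i) B ^ 2 = -((psl33Prime : O) * aeval (r i) F) := by
    intro i
    have := dedekind_factorization (r i)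
    rw [← hroot, sub_self] at this
    rw [haeval, haeval, haeval]
    linear_combination -this
  have hnodal : A.map ψ * B.map ψ ^ 2 = ∏ i, (X - C (φ (r i))) := by
    have h1 := congrArg (map φ) (X_pow_sub_polyVal_eq_nodal rfl hr hroot)
    rw [dedekind_factorization, Lagrange.nodal, Polynomial.map_prod] at h1
    simp only [Polynomial.map_add, Polynomial.map_mul, Polynomial.map_pow, map_polyVal_X,
      Polynomial.map_sub, map_X, map_C, Polynomial.map_intCast] at h1
    have hp : ((psl33Prime : ℤ) : (O ⧸ P)[X]) = 0 := by
      rw [← C_eq_intCast, ← map_intCast φ, hp0, C_0]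
    rw [hp, zero_mul, add_zero] at h1
    rw [hAk, hBk, h1]
  have hsplits : (A.map ψ * B.map ψ ^ 2).Splits := by
    rw [hnodal]
    exact Splits.prod fun i _ => Splits.X_sub_C _
  have hne : A.map ψ * B.map ψ ^ 2 ≠ 0 :=
    ((hA.map ψ).mul ((hB.map ψ).pow 2)).ne_zero
  have hABs : (A.map ψ * B.map ψ).Splits :=
    hsplits.of_dvd hne (mul_dvd_mul_left _ (dvd_pow_self _ two_ne_zero))
  have hBs : (B.map ψ).Splits := hABs.of_dvd ((hA.map ψ).mul (hB.map ψ)).ne_zero (dvd_mul_left _ _)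
  have hABsep : (A.map ψ * B.map ψ).Separable := by
    rw [hAk, hBk]
    exact separable_dedekindA.mul separable_dedekindB isCoprime_dedekindA_dedekindB
  have hBsep : (B.map ψ).Separable := hABsep.of_mul_right
  have hpoint : ∀ a, (A.map ψ * B.map ψ ^ 2).eval a = 0 → ∃ i, a = φ (r i) := by
    intro a ha
    rw [hnodal, eval_prod] at ha
    obtain ⟨i, -, hi⟩ := Finset.prod_eq_zero_iff.1 ha
    rw [eval_sub, eval_X, eval_C, sub_eq_zero] at hi
    exact ⟨i, hi⟩
  have hAB : (A * B).Monic := hA.mul hB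
  have hABdeg : (A * B).degree = 9 := by
    rw [degree_mul, hAdeg, hBdeg]
    norm_num
  have hdiv := modByMonic_add_div h (A * B)
  set u := h %ₘ (A * B) with hu
  set w := h /ₘ (A * B) with hw
  -- Modulo P, h vanishes at every root of the separable polynomial AB, hence so does its remainder
  -- u, whose degree is below 9.
  have hu0 : u.map ψ = 0 := by
    refine eq_zero_of_forall_eval_eq_zero hABs hABsep (fun a ha => ?_) ?_
    · obtain ⟨i, rfl⟩ := hpoint a (by
        rw [pow_two, ← mul_assoc, eval_mul, ha, zero_mul])
      have h1 : φ (aeval (r i) h) = 0 := by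
        obtain ⟨y, hy⟩ := hdvd i
        rw [hy, map_mul, hp0, zero_mul]
      rw [hφ, ← hdiv, Polynomial.map_add, Polynomial.map_mul, Polynomial.map_mul, eval_add,
        eval_mul, ha, zero_mul, add_zero] at h1
      exact h1
    · rw [← Polynomial.map_mul, hAB.degree_map]
      exact degree_map_le.trans_lt (degree_modByMonic_lt _ hAB)
  obtain ⟨u', hu'⟩ : C psl33Prime ∣ u := C_dvd_iff_dvd_coeff _ _ |>.2 (hcoeff u hu0)
  -- With u = p u', multiply h = p u' + A B w by B, replace A B² by -p F at the roots, and cancel p.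
  -- At roots of B modulo P this leaves F w = 0 with F nonzero. So w, of degree below 4, vanishes at
  -- the four roots of B.
  have hw0 : w.map ψ = 0 := by
    refine eq_zero_of_forall_eval_eq_zero hBs hBsep (fun a ha => ?_) ?_
    · obtain ⟨i, rfl⟩ := hpoint a (by rw [eval_mul, eval_pow, ha]; ring)
      obtain ⟨y, hy⟩ := hdvd i
      have hpne : (psl33Prime : O) ≠ 0 := by norm_num
      have h1 : y * aeval (r i) B = -(aeval (r i) F * aeval (r i) w) +
          aeval (r i) u' * aeval (r i) B := by
        apply mul_left_cancel₀ hpne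
        have h2 : aeval (r i) h = (psl33Prime : O) * aeval (r i) u' +
            aeval (r i) A * aeval (r i) B * aeval (r i) w := by
          rw [← hdiv, hu', map_add, map_mul, map_mul, map_mul, aeval_C]
          simp
        rw [hy] at h2
        linear_combination aeval (r i) B * h2 + aeval (r i) w * hfac i
      have h2 := congrArg φ h1
      simp only [map_mul, map_add, map_neg, hφ, ha, mul_zero, add_zero] at h2
      have h3 : (F.map ψ).eval (φ (r i)) ≠ 0 := by
        intro h0
        obtain ⟨s, t, hst⟩ := isCoprime_dedekindF_dedekindB (k := O ⧸ P)
        have := congrArg (eval (φ (r i))) hst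
        rw [← hFk, ← hBk, eval_add, eval_mul, eval_mul, h0, ha] at this
        simp at this
      exact (mul_eq_zero.1 (neg_eq_zero.1 h2.symm)).resolve_left h3
    · rw [hB.degree_map, hBdeg]
      refine degree_map_le.trans_lt ?_
      by_cases hlt : h.degree < (A * B).degree
      · rw [hw, (divByMonic_eq_zero_iff hAB).2 hlt, degree_zero]
        exact WithBot.bot_lt_coe 4
      · have := degree_add_divByMonic hAB (not_lt.1 hlt)
        rw [hABdeg] at this
        rw [← this] at hdeg
        have h13 : (13 : WithBot ℕ) = 9 + 4 := by norm_num
        rw [h13] at hdeg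
        exact lt_of_add_lt_add_left hdeg
  have hh0 : h.map ψ = 0 := by
    rw [← hdiv, Polynomial.map_add, Polynomial.map_mul, hu0, hw0, mul_zero, add_zero]
  exact hcoeff h hh0 n

/-! ### The discriminant of the root fields. -/

section RootField

variable {K : Type*} [Field K] [NumberField K]

lemma coe_discr_int {ι : Type*} [Fintype ι] [DecidableEq ι] (x : ι → 𝓞 K) :
    ((Algebra.discr ℤ x : ℤ) : ℚ) = Algebra.discr ℚ fun i => (x i : K) := by
  rw [Algebra.discr_def, Algebra.discr_def, ← eq_intCast (algebraMap ℤ ℚ), RingHom.map_det]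
  congr 1
  ext i j
  simp only [RingHom.mapMatrix_apply, Matrix.map_apply, Algebra.traceMatrix_apply,
    Algebra.traceForm_apply, eq_intCast]
  rw [Algebra.coe_trace_int]
  exact congrArg _ (map_mul (algebraMap (𝓞 K) K) _ _)

/-- A power basis generated by a root of `psl33Poly`. -/
lemma exists_powerBasis {θ : K} (hθ : aeval θ psl33Poly = 0) (htop : ℚ⟮θ⟯ = ⊤) :
    ∃ pb : PowerBasis ℚ K, pb.gen = θ ∧ minpoly ℚ θ = psl33Poly ∧ Module.finrank ℚ K = 13 := by
  have hint : IsIntegral ℚ θ := Algebra.IsIntegral.isIntegral θ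
  have hmin : minpoly ℚ θ = psl33Poly :=
    (minpoly.eq_of_irreducible_of_monic irreducible_psl33Poly hθ monic_psl33Poly).symm
  refine ⟨PowerBasis.ofAdjoinEqTop hint ((adjoin_simple_eq_top_iff_of_isAlgebraic
    (Algebra.IsAlgebraic.isAlgebraic θ)).1 htop),
    PowerBasis.ofAdjoinEqTop_gen _ _, hmin, ?_⟩
  rw [← natDegree_psl33Poly, ← hmin, ← IntermediateField.adjoin.finrank hint, htop,
    IntermediateField.finrank_top']

lemma discr_eq_det_sq {θ : K} (hθ : aeval θ psl33Poly = 0) (htop : ℚ⟮θ⟯ = ⊤) :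
    ∃ r : Fin 13 → AlgebraicClosure K, Function.Injective r ∧
      (∀ i, r i ^ 13 = polyVal (r i) psl33Red) ∧
      ∃ e : Fin 13 → K →ₐ[ℚ] AlgebraicClosure K, (∀ i, e i θ = r i) ∧
        ∀ b : Fin 13 → K, algebraMap ℚ (AlgebraicClosure K) (Algebra.discr ℚ b) =
          (Matrix.of fun i j => e i (b j)).det ^ 2 := by
  obtain ⟨pb, hgen, hmin, hrank⟩ := exists_powerBasis hθ htop
  have hcard : Fintype.card (K →ₐ[ℚ] AlgebraicClosure K) = 13 := by
    rw [AlgHom.card, hrank]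
  let e : Fin 13 ≃ (K →ₐ[ℚ] AlgebraicClosure K) := (Fintype.equivFinOfCardEq hcard).symm
  have hx : θ ^ 13 = polyVal θ psl33Red := by rwa [aeval_psl33Poly, sub_eq_zero] at hθ
  refine ⟨fun i => e i θ, fun i j hij => e.injective (pb.algHom_ext (by rwa [hgen])),
    fun i => map_pow_eq_polyVal (e i : K →+* AlgebraicClosure K) hx, e, fun _ => rfl, fun b => ?_⟩
  rw [Algebra.discr_eq_det_embeddingsMatrixReindex_pow_two ℚ (AlgebraicClosure K) b e,
    ← Matrix.det_transpose]
  rfl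

/-- The discriminant of the powers of a root of `psl33Poly`. -/
lemma discr_powers {θ : 𝓞 K} (hθ : aeval (θ : K) psl33Poly = 0) (htop : ℚ⟮(θ : K)⟯ = ⊤) :
    Algebra.discr ℤ (fun j : Fin 13 => θ ^ (12 - (j : ℕ))) = psl33Prime ^ 4 * psl33Index ^ 2 := by
  obtain ⟨r, hr, hroot, e, he, hdisc⟩ := discr_eq_det_sq hθ htop
  apply Int.cast_injective (α := ℚ)
  rw [coe_discr_int]
  apply (algebraMap ℚ (AlgebraicClosure K)).injective
  rw [hdisc, map_intCast, ← det_revVandermonde_sq hr hroot]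
  congr 2
  ext i j
  simp [revVandermonde, he]

/-- The discriminant of the elements `integralElement`. -/
lemma discr_integralElement {θ : 𝓞 K} (hθ : aeval (θ : K) psl33Poly = 0)
    (htop : ℚ⟮(θ : K)⟯ = ⊤) {w : Fin 13 → 𝓞 K} (hw : ∀ j, (w j : K) = integralElement (θ : K) j) :
    Algebra.discr ℤ w = psl33Prime ^ 4 := by
  obtain ⟨r, hr, hroot, e, he, hdisc⟩ := discr_eq_det_sq hθ htop
  apply Int.cast_injective (α := ℚ)
  rw [coe_discr_int]
  apply (algebraMap ℚ (AlgebraicClosure K)).injective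
  rw [hdisc, map_intCast, Int.cast_pow, ← det_integralElement_sq hr hroot]
  congr 2
  ext i j
  rw [Matrix.of_apply, Matrix.of_apply, hw, ← he, integralElement, integralElement, map_div₀,
    map_intCast]
  congr 1
  exact map_polyVal (e i : K →+* AlgebraicClosure K) _ _

/-- The index of the order generated by a root of `psl33Poly` is prime to `psl33Prime`. -/
lemma not_dvd_det_toMatrix {θ : 𝓞 K} (hθ : aeval (θ : K) psl33Poly = 0)
    (htop : ℚ⟮(θ : K)⟯ = ⊤) (b : Module.Basis (Fin 13) ℤ (𝓞 K)) :
    ¬ psl33Prime ∣ (b.toMatrix fun j : Fin 13 => θ ^ (12 - (j : ℕ))).det := by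
  intro hdvd
  have : Fact (Nat.Prime 83420911386433) := ⟨prime_psl33Prime⟩
  set M := b.toMatrix fun j : Fin 13 => θ ^ (12 - (j : ℕ)) with hM
  have hdet : (M.map (Int.castRingHom (ZMod 83420911386433))).det = 0 := by
    have h := (Int.castRingHom (ZMod 83420911386433)).map_det M
    rw [eq_intCast, (ZMod.intCast_zmod_eq_zero_iff_dvd _ _).2 hdvd] at h
    exact h.symm
  -- A kernel vector modulo p lifts to integers c, not all divisible by p, for which the
  -- corresponding combination of powers of θ lies in p 𝓞 K.
  obtain ⟨v, hv0, hv⟩ := Matrix.exists_mulVec_eq_zero_iff.2 hdet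
  let c : Fin 13 → ℤ := fun j => (v j).val
  have hc : ∀ j, ((c j : ℤ) : ZMod 83420911386433) = v j := fun j => by simp [c]
  have hMc : ∀ i, psl33Prime ∣ ∑ j, M i j * c j := fun i => by
    refine (ZMod.intCast_zmod_eq_zero_iff_dvd _ 83420911386433).1 ?_
    have := congrFun hv i
    rw [Matrix.mulVec, dotProduct, Pi.zero_apply] at this
    rw [Int.cast_sum, ← this]
    refine Finset.sum_congr rfl fun j _ => ?_
    rw [Int.cast_mul, hc]
    rfl
  choose d hd using hMc
  have hsum : ∑ j, (c j : 𝓞 K) * θ ^ (12 - (j : ℕ)) =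
      (psl33Prime : 𝓞 K) * ∑ i, (d i : 𝓞 K) * b i := by
    have hj : ∀ j : Fin 13, θ ^ (12 - (j : ℕ)) = ∑ i, (M i j : 𝓞 K) * b i := fun j => by
      have := b.sum_toMatrix_smul_self (fun j : Fin 13 => θ ^ (12 - (j : ℕ))) j
      simp_rw [zsmul_eq_mul] at this
      exact this.symm
    simp_rw [hj, Finset.mul_sum]
    rw [Finset.sum_comm]
    refine Finset.sum_congr rfl fun i _ => ?_
    have := congrArg (Int.cast : ℤ → 𝓞 K) (hd i)
    rw [Int.cast_sum, Int.cast_mul] at this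
    rw [← mul_assoc, ← this, Finset.sum_mul]
    refine Finset.sum_congr rfl fun j _ => ?_
    rw [Int.cast_mul]
    ring
  let h : ℤ[X] := ∑ j : Fin 13, C (c j) * X ^ (12 - (j : ℕ))
  have hcoeff : ∀ j : Fin 13, h.coeff (12 - (j : ℕ)) = c j := fun j => by
    simp only [h, finsetSum_coeff, coeff_C_mul, coeff_X_pow]
    rw [Finset.sum_eq_single j]
    · simp
    · intro i _ hij
      rw [if_neg, mul_zero]
      have : (i : ℕ) ≠ j := fun h => hij (Fin.ext h)
      omega
    · simp
  have hdeg : h.degree < 13 := by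
    refine (degree_sum_le _ _).trans_lt ((Finset.sup_lt_iff (WithBot.bot_lt_coe 13)).2 fun j _ => ?_)
    refine (degree_C_mul_X_pow_le _ _).trans_lt ?_
    exact_mod_cast (by omega : 12 - (j : ℕ) < 13)
  obtain ⟨pb, hgen, hmin, -⟩ := exists_powerBasis hθ htop
  obtain ⟨r, hr, hroot, -, -, -⟩ := exists_roots_collineationGroup
  obtain ⟨P, hP, hpP, -⟩ := exists_frobenius psl33Poly.SplittingField prime_psl33Prime
  have hroots : ∀ i, (psl33Prime : 𝓞 psl33Poly.SplittingField) ∣ aeval (r i) h := by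
    intro i
    have hmem : aeval (r i : psl33Poly.SplittingField) (minpoly ℚ pb.gen) = 0 := by
      rw [hgen, hmin, aeval_psl33Poly, sub_eq_zero]
      exact map_pow_eq_polyVal (algebraMap (𝓞 psl33Poly.SplittingField) _) (hroot i)
    -- The embedding θ ↦ r i transports the divisibility by p to every root in the splitting field,
    -- as Dedekind's criterion requires.
    let ψ : K →ₐ[ℚ] psl33Poly.SplittingField := pb.lift (r i : psl33Poly.SplittingField) hmem
    have hψ : ψ θ = (r i : psl33Poly.SplittingField) :=
      (congrArg ψ hgen.symm).trans (pb.lift_gen _ hmem)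
    let y : 𝓞 psl33Poly.SplittingField :=
      RingOfIntegers.mapRingHom ψ (∑ i, (d i : 𝓞 K) * b i)
    refine ⟨y, RingOfIntegers.coe_injective ?_⟩
    have h1 := congrArg (fun z : 𝓞 K => ψ z) hsum
    simp only [map_sum, map_mul, map_intCast, map_pow, hψ] at h1
    have h2 : algebraMap _ psl33Poly.SplittingField y =
        ψ (algebraMap (𝓞 K) K (∑ i, (d i : 𝓞 K) * b i)) := rfl
    rw [map_mul, map_intCast, h2]
    simp only [h, map_sum, map_mul, map_pow, aeval_X, map_intCast, eq_intCast]
    exact h1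
  refine hv0 (funext fun j => ?_)
  have hj := dvd_coeff_of_forall_dvd_aeval (P := P) (by exact_mod_cast hpP) hr hroot hdeg hroots
    (12 - (j : ℕ))
  rw [hcoeff] at hj
  rw [← hc, Pi.zero_apply]
  exact (ZMod.intCast_zmod_eq_zero_iff_dvd _ 83420911386433).2 hj

/-- The discriminant of the root fields of `psl33Poly`. -/
theorem discr_rootField {θ : K} (hθ : aeval θ psl33Poly = 0) (htop : ℚ⟮θ⟯ = ⊤) :
    NumberField.discr K = 83420911386433 ^ 4 := by
  have hx : θ ^ 13 = polyVal θ psl33Red := by rwa [aeval_psl33Poly, sub_eq_zero] at hθ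
  obtain ⟨θ, rfl⟩ : ∃ θ' : 𝓞 K, (θ' : K) = θ := ⟨⟨θ, isIntegral_of_pow_eq_polyVal hx⟩, rfl⟩
  have hx' : θ ^ 13 = polyVal θ psl33Red := by
    apply RingOfIntegers.coe_injective
    rw [map_polyVal, map_pow]
    exact hx
  obtain ⟨-, -, -, hrank⟩ := exists_powerBasis hθ htop
  have hcard : Fintype.card (Module.Free.ChooseBasisIndex ℤ (𝓞 K)) = 13 := by
    rw [← Module.finrank_eq_card_chooseBasisIndex, RingOfIntegers.rank, hrank]
  let b : Module.Basis (Fin 13) ℤ (𝓞 K) :=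
    (RingOfIntegers.basis K).reindex (Fintype.equivFinOfCardEq hcard)
  have hchange : ∀ x : Fin 13 → 𝓞 K,
      Algebra.discr ℤ x = (b.toMatrix x).det ^ 2 * NumberField.discr K := fun x => by
    rw [← NumberField.discr_eq_discr K b, ← Algebra.discr_of_matrix_vecMul,
      b.toMatrix_map_vecMul]
  choose w hw using fun j => exists_integralElement hx' j
  have h0 := hchange fun j : Fin 13 => θ ^ (12 - (j : ℕ))
  have h1 := hchange w
  rw [discr_powers hθ htop] at h0
  rw [discr_integralElement hθ htop hw] at h1
  have hndvd := not_dvd_det_toMatrix hθ htop b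
  generalize (b.toMatrix fun j : Fin 13 => θ ^ (12 - (j : ℕ))).det = k₀ at h0 hndvd
  generalize (b.toMatrix w).det = k₁ at h1
  have hp : Prime psl33Prime := Nat.prime_iff_prime_int.1 prime_psl33Prime
  -- From p^4 m² = k₀² · disc with k₀, the index determinant of ℤ[θ], prime to p.
  have hdvd : psl33Prime ^ 4 ∣ NumberField.discr K :=
    (((hp.coprime_iff_not_dvd.2 hndvd).pow_left.pow_right)).dvd_of_dvd_mul_left
      (h0 ▸ dvd_mul_right _ _)
  obtain ⟨s, hs⟩ := hdvd
  have hp4 : psl33Prime ^ 4 ≠ 0 := pow_ne_zero 4 hp.ne_zero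
  -- The integral elements give p^4 = k₁² · disc with disc = p^4 s. Positivity of the square then
  -- leaves only s = 1, which also fixes the sign.
  have hk : k₁ ^ 2 * s = 1 := by
    apply mul_left_cancel₀ hp4
    rw [hs] at h1
    linear_combination -h1
  have hs0 : 0 < s := by
    by_contra hneg
    nlinarith [sq_nonneg k₁]
  have hs1 : s = 1 := Int.eq_one_of_dvd_one hs0.le ⟨k₁ ^ 2, by linear_combination -hk⟩
  rw [hs, hs1, mul_one]

end RootField

theorem lemma14 :
    Irreducible psl33Poly ∧
    Nonempty (psl33Poly.Gal ≃* Matrix.ProjectiveSpecialLinearGroup (Fin 3) (ZMod 3)) ∧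
    Nat.Prime 83420911386433 ∧
    (∀ q : ℕ, q.Prime → (RamifiesIn q psl33Poly.SplittingField ↔ q = 83420911386433)) ∧
    (∀ (K : Type*) [Field K] [NumberField K] (θ : K),
      aeval θ psl33Poly = 0 → ℚ⟮θ⟯ = ⊤ → NumberField.discr K = 83420911386433 ^ 4) :=
  ⟨irreducible_psl33Poly, nonempty_gal_mulEquiv, prime_psl33Prime, fun _ hq => ramifiesIn_iff hq,
    fun _ _ _ _ hθ htop => discr_rootField hθ htop⟩
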